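/- Let $K$ be a local field of positive characteristic $p$ (a non-discrete, locally compact field with a non-archimedean absolute value), with ring of integers $\mathcal O=\{|x|\le 1\}$, maximal ideal $\mathfrak P=\{|x|<1\}$, residue field $\mathcal O/\mathfrak P\cong GF(q)$, $q=p^c$, prime element $\mathfrak p$, and Haar measure on $K^+$ normalized by $|\mathcal O|=1$. Let $1=\epsilon_0,\epsilon_1,\dots,\epsilon_{c-1}\in\mathcal O$ be elements whose span over $GF(p)$ is a subfield of $K$ with $q$ elements representing $\mathcal O/\mathfrak P$. For $0\le n<q$ with base-$p$ expansion $n=\sum_{i<c} a_i p^i$ put $u(n)=\big(\sum_{i<c} a_i\epsilon_i\big)\mathfrak p^{-1}$, and for $n=\sum_{k=0}^s b_kq^k$ with $0\le b_k<q$ put $u(n)=\sum_{k=0}^s u(b_k)\mathfrak p^{-k}$; then $\{u(n)\}_{n\in\mathbb N_0}$ is a subgroup of $K^+$ and a complete set of representatives of $K/\mathcal O$. Let $\chi$ be a continuous unitary character of $K^+$ that is trivial on $\mathcal O$, nontrivial on $\mathfrak p^{-1}\mathcal O$, and satisfies $\chi(\epsilon_i\mathfrak p^{-j})=1$ for $0\le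 i<c$ and $j\ge 2$, and let $\hat f$ be the extension to $L^2(K)$ of the Fourier transform $\hat f(\xi)=\int_K f(x)\chi(-\xi x)\,dx$. For $f\in L^2(K)$ let $T_kf(x)=f(x-u(k))$ and $D^jf(x)=q^{j/2}f(\mathfrak p^{-j}x)$. Let $\Psi=\{\psi_1,\dots,\psi_L\}\subset L^2(K)$ be an orthonormal multiwavelet, i.e. $\{D^jT_k\psi_l: 1\le l\le L,\ j\in\mathbb Z,\ k\in\mathbb N_0\}$ is an orthonormal basis of $L^2(K)$, and let $V=\overline{\mathrm{span}}\{D^jT_k\psi_l: 1\le l\le L,\ j<0,\ k\in\mathbb N_0\}$ be its space of negative dilates. For a closed subspace $V'$ of $L^2(K)$ invariant under all $T_k$, a range function of $V'$ is a measurable map $J$ from $\mathcal O$ to the closed subspaces of $\ell^2(\mathbb N_0)$ such that $V'=\{f\in L^2(K): (\hat f(\xi+u(k)))_{k\in\mathbb N_0}\in J(\xi)\text{ for a.e. }\xi\in\mathcal O\}$, and the multiplicity function of $V'$ is $m(\xi)=\dim J(\xi)$, $\xi\in\mathcal O$. Then $V$ is invariant under all $T_k$ and has a multiplicity function $m$ (the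 wavelet multiplicity function of $\Psi$), and for every such $m$, for a.e. $\xi\in\mathcal O$, $m(\xi)$ is finite and $$m(\xi)=D_\Psi(\xi):=\sum_{l=1}^{L}\sum_{j=1}^{\infty}\sum_{k\in\mathbb N_0}\big|\hat\psi_l(\mathfrak p^{-j}(\xi+u(k)))\big|^2 .$$ -/

import Mathlib

open MeasureTheory
open scoped ENNReal

noncomputable section

namespace LocalFieldWavelet

/-! ### The local field, its prime element, its translation set and its basic character -/

section Field

variable {K : Type*} [NontriviallyNormedField K]

/-- `π` is a prime element: an element of `{x : |x| < 1}` of maximal absolute value. -/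
structure IsPrimeElement (π : K) : Prop where
  norm_lt_one : ‖π‖ < 1
  norm_le : ∀ x : K, ‖x‖ < 1 → ‖x‖ ≤ ‖π‖

theorem IsPrimeElement.ne_zero {π : K} (h : IsPrimeElement π) : π ≠ 0 := by
  obtain ⟨x, hx0, hx1⟩ := NormedField.exists_norm_lt_one K
  exact norm_pos_iff.1 (hx0.trans_le (h.norm_le x hx1))

/-- `ε₀ = 1, ε₁, …, ε_{c-1}` generate over `GF(p)` a copy in `K` of the residue field `GF(p ^ c)`:
their additive span is a subfield with `p ^ c` elements that meets every residue class of the ring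
of integers. -/
structure IsResidueBasis (p c : ℕ) [NeZero c] (ε : Fin c → K) : Prop where
  zero_eq_one : ε 0 = 1
  span_eq : ∃ F : Subfield K, Nat.card F = p ^ c ∧
    (AddSubgroup.closure (Set.range ε) : Set K) = F ∧
    ∀ x : K, ‖x‖ ≤ 1 → ∃ a ∈ F, ‖x - a‖ < 1

/-- For `b = ∑ aᵢ pⁱ` with base-`p` digits `aᵢ`, the element `∑ aᵢ εᵢ`. -/
def digit (p : ℕ) {c : ℕ} (ε : Fin c → K) (b : ℕ) : K :=
  ∑ i : Fin c, ((b / p ^ (i : ℕ) % p : ℕ) : K) * ε i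

/-- The translation `u(n)`: for `n = ∑ bₖ qᵏ` with `q = p ^ c` and base-`q` digits `bₖ`, it is
`∑ u(bₖ) π⁻ᵏ`, where `u(b) = digit b * π⁻¹` for `b < q`. (All digits with `k > n` vanish.) -/
def u (p : ℕ) {c : ℕ} (π : K) (ε : Fin c → K) (n : ℕ) : K :=
  ∑ k ∈ Finset.range (n + 1),
    digit p ε (n / (p ^ c) ^ k % p ^ c) * π⁻¹ * (π⁻¹) ^ k

/-- The basic character `χ` of `K⁺`: continuous, trivial on the ring of integers, nontrivial on
`π⁻¹𝒪`, and equal to `1` at `εᵢ π⁻ʲ` for `j ≥ 2`. -/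
structure IsBasicCharacter {c : ℕ} (π : K) (ε : Fin c → K) (χ : AddChar K Circle) : Prop where
  continuous : Continuous χ
  trivial_on_integers : ∀ x : K, ‖x‖ ≤ 1 → χ x = 1
  nontrivial : ∃ x : K, ‖π * x‖ ≤ 1 ∧ χ x ≠ 1
  eq_one : ∀ (i : Fin c) (j : ℕ), 2 ≤ j → χ (ε i * (π⁻¹) ^ j) = 1

end Field

/-! ### Translations, dilations and the Fourier transform on `L²(K)` -/

section Operators

variable {K : Type*} [NontriviallyNormedField K] [LocallyCompactSpace K]
  [MeasurableSpace K] [BorelSpace K] {μ : Measure K} [μ.IsAddHaarMeasure]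

/-- Translation: `(T_a f)(x) = f(x - a)`. -/
def translate (a : K) (f : Lp ℂ 2 μ) : Lp ℂ 2 μ :=
  Lp.compMeasurePreserving (fun x : K => x - a) (measurePreserving_sub_right μ a) f

theorem memLp_comp_mul_left {a : K} (ha : a ≠ 0) {f : K → ℂ} (hf : MemLp f 2 μ) :
    MemLp (fun x => f (a * x)) 2 μ := by
  have : ProperSpace K := ProperSpace.of_locallyCompactSpace K
  let e : K ≃L[K] K := ContinuousLinearEquiv.unitsEquivAut K (Units.mk0 a ha)
  have he : (fun x : K => a * x) = e := by
    funext x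
    simp [e, mul_comm]
  have : (μ.map e).IsAddHaarMeasure := e.isAddHaarMeasure_map μ
  have h1 : μ.map e = Measure.addHaarScalarFactor (μ.map e) μ • μ :=
    Measure.isAddLeftInvariant_eq_smul _ _
  have h2 : MemLp f 2 (μ.map e) := by
    rw [h1]
    exact hf.smul_measure ENNReal.coe_ne_top
  have h3 := h2.comp_of_map e.continuous.measurable.aemeasurable
  rw [← he] at h3
  exact h3

/-- Dilation: `(Dʲ f)(x) = q ^ (j / 2) * f(π⁻ʲ x)`. -/
def dilate (q : ℕ) {π : K} (hπ : IsPrimeElement π) (j : ℤ) (f : Lp ℂ 2 μ) : Lp ℂ 2 μ :=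
  ((memLp_comp_mul_left (zpow_ne_zero (-j) hπ.ne_zero) (Lp.memLp f)).const_mul
    (((q : ℝ) ^ ((j : ℝ) / 2) : ℝ) : ℂ)).toLp
    (fun x => (((q : ℝ) ^ ((j : ℝ) / 2) : ℝ) : ℂ) * f (π ^ (-j) * x))

/-- `g` is the `L²` Fourier transform of `f`: the pair `(f, g)` is an `L² × L²` limit of pairs
`(F, F̂)` with `F ∈ L¹ ∩ L²`, where `F̂(ξ) = ∫ F(x) χ(-xξ) dx`. -/
def IsFourierTransform (χ : AddChar K Circle) (f g : Lp ℂ 2 μ) : Prop :=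
  (f, g) ∈ closure {P : Lp ℂ 2 μ × Lp ℂ 2 μ |
    Integrable P.1 μ ∧ P.2 =ᵐ[μ] Fourier.fourierIntegral χ μ P.1}

/-- The Fourier transform on `L²(K)`, the extension by continuity of the Fourier integral from
`L¹ ∩ L²`. -/
def fourier (χ : AddChar K Circle) (f : Lp ℂ 2 μ) : Lp ℂ 2 μ :=
  Classical.epsilon fun g => IsFourierTransform χ f g

end Operators

/-! ### Multiwavelets, translation invariant spaces and multiplicity functions -/

section Wavelets

variable {K : Type*} [NontriviallyNormedField K] [LocallyCompactSpace K]
  [MeasurableSpace K] [BorelSpace K] {μ : Measure K} [μ.IsAddHaarMeasure]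

/-- The element `Dʲ T_k f` of an affine system, `T_k` being the translation by `u(k)` and `Dʲ` the
dilation with factor `q = p ^ c`. -/
def affine (p : ℕ) {c : ℕ} {π : K} (hπ : IsPrimeElement π) (ε : Fin c → K)
    (f : Lp ℂ 2 μ) (j : ℤ) (k : ℕ) : Lp ℂ 2 μ :=
  dilate (p ^ c) hπ j (translate (u p π ε k) f)

/-- `Ψ = {ψ₁, …, ψ_L}` is an orthonormal multiwavelet of order `L`: the system
`{Dʲ T_k ψ_l : 1 ≤ l ≤ L, j ∈ ℤ, k ∈ ℕ₀}` is an orthonormal basis of `L²(K)`. -/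
structure IsOrthonormalMultiwavelet (p : ℕ) {c : ℕ} {π : K} (hπ : IsPrimeElement π)
    (ε : Fin c → K) {L : ℕ} (ψ : Fin L → Lp ℂ 2 μ) : Prop where
  orthonormal : Orthonormal ℂ fun i : Fin L × ℤ × ℕ => affine p hπ ε (ψ i.1) i.2.1 i.2.2
  complete : (Submodule.span ℂ
    (Set.range fun i : Fin L × ℤ × ℕ => affine p hπ ε (ψ i.1) i.2.1 i.2.2)).topologicalClosure = ⊤

/-- The space of negative dilates of `Ψ`: the closed span of
`{Dʲ T_k ψ_l : 1 ≤ l ≤ L, j < 0, k ∈ ℕ₀}`. -/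
def negativeDilates (p : ℕ) {c : ℕ} {π : K} (hπ : IsPrimeElement π) (ε : Fin c → K) {L : ℕ}
    (ψ : Fin L → Lp ℂ 2 μ) : Submodule ℂ (Lp ℂ 2 μ) :=
  (Submodule.span ℂ
    {g | ∃ (l : Fin L) (j : ℤ) (k : ℕ), j < 0 ∧ g = affine p hπ ε (ψ l) j k}).topologicalClosure

/-- A closed subspace of `L²(K)` that is invariant under the translations by the `u(k)`. -/
structure IsTranslationInvariant (p : ℕ) {c : ℕ} (π : K) (ε : Fin c → K)
    (V : Submodule ℂ (Lp ℂ 2 μ)) : Prop where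
  isClosed : IsClosed (V : Set (Lp ℂ 2 μ))
  translate_mem : ∀ f ∈ V, ∀ k : ℕ, translate (u p π ε k) f ∈ V

/-- The sequence space `ℓ²`, whose `k`-th coordinate belongs to the translation `u(k)`. -/
abbrev Ell2 : Type := lp (fun _ : ℕ => ℂ) 2

/-- `J` is a (measurable) range function of `V`. It assigns to each `ξ` a closed subspace of `ℓ²`
(only `ξ` in the ring of integers matter), its orthogonal projections depend weakly measurably on
`ξ`, and `V` consists of the `f ∈ L²(K)` whose fibre `(f̂(ξ + u(k)))ₖ` lies in `J(ξ)` for almost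
every `ξ` in the ring of integers. -/
structure IsRangeFunction (p : ℕ) {c : ℕ} (π : K) (ε : Fin c → K) (χ : AddChar K Circle)
    (V : Submodule ℂ (Lp ℂ 2 μ)) (J : K → ClosedSubmodule ℂ Ell2) : Prop where
  measurable : ∀ a b : Ell2,
    AEMeasurable (fun ξ => inner ℂ a ((J ξ).toSubmodule.starProjection b))
      (μ.restrict (Metric.closedBall 0 1))
  mem_iff : ∀ f : Lp ℂ 2 μ, f ∈ V ↔
    ∀ᵐ ξ ∂(μ.restrict (Metric.closedBall 0 1)),
      ∃ v ∈ J ξ, ∀ k : ℕ, v k = fourier χ f (ξ + u p π ε k)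

/-- `m` is the multiplicity function of the translation invariant space `V`: for almost every `ξ`
in the ring of integers, `m(ξ)` is the dimension of `J(ξ)`, for a range function `J` of `V`. -/
def IsMultiplicityFunction (p : ℕ) {c : ℕ} (π : K) (ε : Fin c → K) (χ : AddChar K Circle)
    (V : Submodule ℂ (Lp ℂ 2 μ)) (m : K → ℕ∞) : Prop :=
  IsTranslationInvariant p π ε V ∧
  ∃ J : K → ClosedSubmodule ℂ Ell2, IsRangeFunction p π ε χ V J ∧
    ∀ᵐ ξ ∂(μ.restrict (Metric.closedBall 0 1)),
      m ξ = Cardinal.toENat (Module.rank ℂ (J ξ).toSubmodule)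

/-- The wavelet dimension function
`D_Ψ(ξ) = ∑_l ∑_{j ≥ 1} ∑_{k ≥ 0} |ψ̂_l(π⁻ʲ (ξ + u(k)))|²`, with values in `[0, ∞]`. -/
def dimensionFunction (p : ℕ) {c : ℕ} (π : K) (ε : Fin c → K) (χ : AddChar K Circle) {L : ℕ}
    (ψ : Fin L → Lp ℂ 2 μ) (ξ : K) : ℝ≥0∞ :=
  ∑ l : Fin L, ∑' j : ℕ, ∑' k : ℕ,
    ‖fourier χ (ψ l) ((π⁻¹) ^ (j + 1) * (ξ + u p π ε k))‖ₑ ^ 2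

end Wavelets

end LocalFieldWavelet

end

noncomputable section

namespace LocalFieldWavelet

open Metric

set_option linter.unusedSectionVars false

/-! ### The translation set `u`, its digits, and the character on it. -/

section Algebra

variable {K : Type*} [NontriviallyNormedField K] [IsUltrametricDist K]
  {p c : ℕ} [Fact p.Prime] [CharP K p] [NeZero c] {π : K} {ε : Fin c → K}

/-! The orthogonal complement of $V$ is the closed span of the affine system at the scales $j\ge 0$.
Since $u(mq^j+d)=u(m)\mathfrak p^{-j}+u(d)$ for $d<q^j$, one has $T_mD^jT_d=D^jT_{mq^j+d}$
(`translate_affine`). So this system consists of all translates of the countable family $\varphi_i$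
of `generators` $D^jT_d\psi_l$, $0\le d<q^j$.

Because $\chi(u(n)u(m))=1$, the Fourier transform turns $T_k$ into multiplication by a function that
is constant along each fiber $\xi+u(n)$. Hence the numbers $\langle T_kg,f\rangle$ are the Fourier
coefficients on $\mathcal O$ of the inner product of the fibers of $\hat g$ and $\hat f$
(`setIntegral_inner_fiber`). Orthonormality of the translates thus becomes orthonormality in
$\ell^2$ of the fibers of $\hat\varphi_i$ for a.e. $\xi$, and the orthogonal complement $J(\xi)$ of
these fibers is a range function of $V$. Range functions are unique a.e. (`IsRangeFunction.ae_eq`),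
so only $\dim J(\xi)$ has to be computed.

That dimension is the trace $\sum_m\|P_{J(\xi)}e_m\|^2$ (`tsum_enorm_starProjection_single`), and by
Parseval $\|P_{J(\xi)}e_m\|^2=1-\sum_i|\hat\varphi_i(x)|^2$ with $x=\xi+u(m)$. For each $l$, the
$q^j$ generators at scale $j$ carry the weight $q^{-j}$ each, so the subtracted sum is
$\sum_{j\ge0}\sum_l|\hat\psi_l(\mathfrak p^jx)|^2$. The Calderón identity $\sum_{j\in\mathbb
Z}\sum_l|\hat\psi_l(\mathfrak p^jx)|^2=1$ leaves exactly the terms with negative exponent, and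
summation over $m$ gives $D_\Psi(\xi)$. It is finite a.e. because its integral over $\mathcal O$ is
a convergent geometric series.

The Calderón identity comes from Parseval for the wavelet basis, applied to functions whose
transforms are indicators of pieces of radius $|\mathfrak p|^r$ of a set $E$ lying in a shell
$|x|=\text{const}$. The energy at the scales $j\ge -r$ is computed exactly; all other scales
together contribute at most $q^{-r}\sum_l\|\psi_l\|^2$, which vanishes as $r\to\infty$. -/

theorem norm_sub_le_max_of_ultrametric (x y : K) : ‖x - y‖ ≤ max ‖x‖ ‖y‖ := by
  simpa [sub_eq_add_neg] using IsUltrametricDist.norm_add_le_max x (-y)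

theorem one_lt_residueCard (p c : ℕ) [Fact p.Prime] [NeZero c] : 1 < p ^ c :=
  Nat.one_lt_pow (NeZero.ne c) (Fact.out : p.Prime).one_lt

theorem residueCard_pos (p c : ℕ) [Fact p.Prime] [NeZero c] : 0 < p ^ c :=
  (one_lt_residueCard p c).le

omit [IsUltrametricDist K] in
theorem IsPrimeElement.norm_pos (hπ : IsPrimeElement π) : 0 < ‖π‖ := norm_pos_iff.2 hπ.ne_zero

-- The value group has a gap between $1$ and $|\mathfrak p|^{-1}$: if $|x|>1$, the maximality of
-- $|\mathfrak p|$ applies to $x^{-1}$.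
omit [IsUltrametricDist K] in
theorem IsPrimeElement.norm_le_one_of_lt (hπ : IsPrimeElement π) {x : K} (hx : ‖x‖ < ‖π⁻¹‖) :
    ‖x‖ ≤ 1 := by
  by_contra! h
  have h0 : x ≠ 0 := by rintro rfl; simp at h; linarith
  have h1 := hπ.norm_le x⁻¹ (by rw [norm_inv]; exact inv_lt_one_of_one_lt₀ h)
  rw [norm_inv] at h1 hx
  have := inv_anti₀ (inv_pos.2 (norm_pos_iff.2 h0)) h1
  rw [inv_inv] at this
  linarith

omit [IsUltrametricDist K] in
/-- Every nonzero element has the absolute value of a power of the prime element. -/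
theorem IsPrimeElement.exists_norm_eq_zpow (hπ : IsPrimeElement π) {x : K} (hx : x ≠ 0) :
    ∃ s : ℤ, ‖x‖ = ‖π‖ ^ s := by
  have h1 : 1 < ‖π‖⁻¹ := (one_lt_inv₀ hπ.norm_pos).2 hπ.norm_lt_one
  obtain ⟨n, hn1, hn2⟩ := exists_mem_Ico_zpow (norm_pos_iff.2 hx) h1
  refine ⟨-n, ?_⟩
  rw [zpow_neg, ← inv_zpow]
  refine le_antisymm ?_ hn1
  have hp : 0 < ‖π‖⁻¹ ^ n := zpow_pos (by positivity) n
  have hz : ‖x * π ^ n‖ = ‖x‖ / ‖π‖⁻¹ ^ n := by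
    rw [norm_mul, norm_zpow, inv_zpow, div_inv_eq_mul]
  -- The scaled element has norm in $[1,|\mathfrak p|^{-1})$, and the gap above $1$ forces it to be
  -- $1$.
  have := hπ.norm_le_one_of_lt (x := x * π ^ n) (by
    rw [hz, norm_inv, div_lt_iff₀ hp, ← zpow_one_add₀ (by positivity), add_comm]; exact hn2)
  rwa [hz, div_le_one hp] at this

/-- The copy of the residue field spanned by `ε`. -/
def IsResidueBasis.subfield (hε : IsResidueBasis p c ε) : Subfield K :=
  Classical.choose hε.span_eq

omit [IsUltrametricDist K] [Fact p.Prime] [CharP K p] in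
theorem IsResidueBasis.card_subfield (hε : IsResidueBasis p c ε) :
    Nat.card hε.subfield = p ^ c := (Classical.choose_spec hε.span_eq).1

omit [IsUltrametricDist K] [Fact p.Prime] [CharP K p] in
theorem IsResidueBasis.coe_subfield (hε : IsResidueBasis p c ε) :
    (AddSubgroup.closure (Set.range ε) : Set K) = hε.subfield :=
  (Classical.choose_spec hε.span_eq).2.1

omit [IsUltrametricDist K] [Fact p.Prime] [CharP K p] in
theorem IsResidueBasis.mem_subfield_iff (hε : IsResidueBasis p c ε) {x : K} :
    x ∈ hε.subfield ↔ x ∈ AddSubgroup.closure (Set.range ε) := by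
  rw [← SetLike.mem_coe, ← hε.coe_subfield, SetLike.mem_coe]

omit [IsUltrametricDist K] [Fact p.Prime] [CharP K p] in
theorem IsResidueBasis.exists_norm_sub_lt (hε : IsResidueBasis p c ε) {x : K} (hx : ‖x‖ ≤ 1) :
    ∃ a ∈ hε.subfield, ‖x - a‖ < 1 := (Classical.choose_spec hε.span_eq).2.2 x hx

omit [IsUltrametricDist K] [CharP K p] in
theorem IsResidueBasis.finite_subfield (hε : IsResidueBasis p c ε) : Finite hε.subfield :=
  Nat.finite_of_card_ne_zero (by rw [hε.card_subfield]; exact (residueCard_pos p c).ne')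

-- A nonzero element of a finite field is a root of unity.
omit [IsUltrametricDist K] [CharP K p] in
theorem IsResidueBasis.norm_eq_one (hε : IsResidueBasis p c ε) {a : K} (ha : a ∈ hε.subfield)
    (h0 : a ≠ 0) : ‖a‖ = 1 := by
  have := hε.finite_subfield
  have h1 : (⟨a, ha⟩ : hε.subfield) ≠ 0 := fun h => h0 (congrArg Subtype.val h)
  obtain ⟨n, hn, hn1⟩ := isOfFinOrder_iff_pow_eq_one.1
    (isOfFinOrder_of_finite (Units.mk0 (⟨a, ha⟩ : hε.subfield) h1))
  have h2 : a ^ n = 1 := by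
    have := congrArg (fun x : (hε.subfield)ˣ => ((x : hε.subfield) : K)) hn1
    simpa using this
  have h3 : ‖a‖ ^ n = 1 := by rw [← norm_pow, h2, norm_one]
  exact (pow_eq_one_iff_of_nonneg (norm_nonneg a) hn.ne').1 h3

omit [IsUltrametricDist K] [CharP K p] in
theorem IsResidueBasis.norm_le_one (hε : IsResidueBasis p c ε) {a : K} (ha : a ∈ hε.subfield) :
    ‖a‖ ≤ 1 := by
  by_cases h : a = 0
  · simp [h]
  · exact (hε.norm_eq_one ha h).le

omit [IsUltrametricDist K] [Fact p.Prime] [CharP K p] in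
theorem IsResidueBasis.digit_mem (hε : IsResidueBasis p c ε) (b : ℕ) :
    digit p ε b ∈ hε.subfield := by
  refine sum_mem fun i _ => mul_mem (natCast_mem _ _) ?_
  rw [hε.mem_subfield_iff]
  exact AddSubgroup.subset_closure ⟨i, rfl⟩

-- Elements of the span are integer combinations of the `ε i`; in characteristic $p$ the
-- coefficients may be reduced to base-$p$ digits.
omit [IsUltrametricDist K] in
theorem IsResidueBasis.exists_digit_eq (hε : IsResidueBasis p c ε) {a : K}
    (ha : a ∈ hε.subfield) : ∃ b < p ^ c, digit p ε b = a := by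
  rw [hε.mem_subfield_iff, AddSubgroup.mem_closure_range_iff_of_fintype] at ha
  obtain ⟨g, hg⟩ := ha
  have hp : 0 < p := (Fact.out : p.Prime).pos
  have hp' : (0 : ℤ) < p := by exact_mod_cast hp
  let d : Fin c → Fin p := fun i => ⟨(g i % p).toNat, by
    have h1 := Int.emod_lt_of_pos (g i) hp'
    have h2 := Int.emod_nonneg (g i) hp'.ne'
    omega⟩
  refine ⟨finFunctionFinEquiv d, (finFunctionFinEquiv d).2, ?_⟩
  rw [hg, digit]
  refine Finset.sum_congr rfl fun i _ => ?_
  have h3 : ((finFunctionFinEquiv d : ℕ) / p ^ (i : ℕ) % p : ℕ) = (g i % p).toNat := by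
    have := finFunctionFinEquiv_symm_apply_val (finFunctionFinEquiv d) i
    rw [Equiv.symm_apply_apply] at this
    rw [← this]
  rw [h3, zsmul_eq_mul]
  congr 1
  have h4 : (((g i % p).toNat : ℤ) : K) = ((g i : ℤ) : K) := by
    rw [CharP.intCast_eq_intCast K p, Int.toNat_of_nonneg (Int.emod_nonneg (g i) hp'.ne')]
    exact Int.mod_modEq _ _
  exact_mod_cast h4

-- A surjection between two sets with $q$ elements is injective, so no independence of the `ε i` has
-- to be proved separately.
omit [IsUltrametricDist K] in
theorem IsResidueBasis.digit_injOn (hε : IsResidueBasis p c ε) {b b' : ℕ} (hb : b < p ^ c)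
    (hb' : b' < p ^ c) (h : digit p ε b = digit p ε b') : b = b' := by
  have := hε.finite_subfield
  let f : Fin (p ^ c) → hε.subfield := fun b => ⟨digit p ε b, hε.digit_mem b⟩
  have hs : Function.Surjective f := by
    rintro ⟨a, ha⟩
    obtain ⟨b, hb, h⟩ := hε.exists_digit_eq ha
    exact ⟨⟨b, hb⟩, Subtype.ext h⟩
  have hf := (Nat.bijective_iff_surjective_and_card f).2
    ⟨hs, by rw [hε.card_subfield, Nat.card_fin]⟩
  have := @hf.1 ⟨b, hb⟩ ⟨b', hb'⟩ (Subtype.ext h)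
  simpa using this

omit [IsUltrametricDist K] [Fact p.Prime] [CharP K p] [NeZero c] in
theorem digit_zero : digit p ε 0 = 0 := by simp [digit]

-- Leading zero digits contribute nothing, so the number of digits in the sum can be chosen to suit
-- the induction.
omit [IsUltrametricDist K] [CharP K p] in
theorem u_eq_sum_range {n N : ℕ} (h : n < (p ^ c) ^ N) :
    u p π ε n = ∑ k ∈ Finset.range N,
      digit p ε (n / (p ^ c) ^ k % p ^ c) * π⁻¹ * (π⁻¹) ^ k := by
  have hq := one_lt_residueCard p c
  have key : ∀ {A B : ℕ}, A ≤ B → n < (p ^ c) ^ A →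
      ∑ k ∈ Finset.range A, digit p ε (n / (p ^ c) ^ k % p ^ c) * π⁻¹ * (π⁻¹) ^ k =
      ∑ k ∈ Finset.range B, digit p ε (n / (p ^ c) ^ k % p ^ c) * π⁻¹ * (π⁻¹) ^ k := by
    intro A B hAB hA
    refine Finset.sum_subset (Finset.range_mono hAB) fun k _ hk => ?_
    have : n / (p ^ c) ^ k = 0 := Nat.div_eq_of_lt
      (hA.trans_le (Nat.pow_le_pow_right hq.le (by simpa using hk)))
    rw [this, Nat.zero_mod, digit_zero, zero_mul, zero_mul]
  rw [u]
  rcases le_total (n + 1) N with h1 | h1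
  · exact key h1 ((Nat.lt_succ_self n).trans (Nat.lt_pow_self hq))
  · exact (key h1 h).symm

omit [IsUltrametricDist K] [CharP K p] in
/-- Splitting off the lowest digit of `u(n)`. -/
theorem u_rec (n : ℕ) :
    u p π ε n = (digit p ε (n % p ^ c) + u p π ε (n / p ^ c)) * π⁻¹ := by
  have hq := one_lt_residueCard p c
  have h1 : n < (p ^ c) ^ (n + 1) := (Nat.lt_succ_self n).trans (Nat.lt_pow_self hq)
  have h2 : n / p ^ c < (p ^ c) ^ n :=
    (Nat.div_le_self _ _).trans_lt (Nat.lt_pow_self hq)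
  rw [u_eq_sum_range h1, u_eq_sum_range h2, Finset.sum_range_succ', add_comm, add_mul,
    Finset.sum_mul]
  congr 1
  · simp
  · refine Finset.sum_congr rfl fun k _ => ?_
    rw [Nat.div_div_eq_div_mul, ← pow_succ' (p ^ c) k, pow_succ (π⁻¹) k]
    ring

omit [IsUltrametricDist K] [CharP K p] [Fact p.Prime] [NeZero c] in
theorem u_zero : u p π ε 0 = 0 := by simp [u, digit_zero]

omit [IsUltrametricDist K] [CharP K p] in
theorem u_digit_add {b : ℕ} (hb : b < p ^ c) (n : ℕ) :
    u p π ε (n * p ^ c + b) = (digit p ε b + u p π ε n) * π⁻¹ := by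
  have hq := residueCard_pos p c
  rw [u_rec, Nat.mul_comm, Nat.mul_add_mod, Nat.mod_eq_of_lt hb, Nat.mul_add_div hq, Nat.div_eq_of_lt hb,
    add_zero]

omit [IsUltrametricDist K] [CharP K p] in
/-- Splitting off the lowest `j` digits of `u(n)`. -/
theorem u_mul_pow_add {j d : ℕ} (hd : d < (p ^ c) ^ j) (n : ℕ) :
    u p π ε (n * (p ^ c) ^ j + d) = u p π ε n * (π⁻¹) ^ j + u p π ε d := by
  have hq := residueCard_pos p c
  induction j generalizing d with
  | zero =>
    have : d = 0 := by simpa using hd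
    simp [this, u_zero]
  | succ j ih =>
    have h1 : d / p ^ c < (p ^ c) ^ j := Nat.div_lt_of_lt_mul (by rwa [← pow_succ'])
    have h2 : n * (p ^ c) ^ (j + 1) + d
        = (n * (p ^ c) ^ j + d / p ^ c) * p ^ c + d % p ^ c := by
      conv_lhs => rw [← Nat.div_add_mod d (p ^ c)]
      ring
    rw [h2, u_digit_add (Nat.mod_lt _ hq), ih h1, u_rec d]
    ring

-- Addition is digitwise and without carries, since the digits form an additive group.
omit [IsUltrametricDist K] in
theorem IsResidueBasis.exists_u_add (hε : IsResidueBasis p c ε) (n m : ℕ) :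
    ∃ k, u p π ε n + u p π ε m = u p π ε k := by
  have hq := one_lt_residueCard p c
  induction n using Nat.strong_induction_on generalizing m with
  | _ n ih =>
    rcases Nat.eq_zero_or_pos n with rfl | hn
    · exact ⟨m, by rw [u_zero, zero_add]⟩
    obtain ⟨k, hk⟩ := ih (n / p ^ c) (Nat.div_lt_self hn hq) (m / p ^ c)
    obtain ⟨b, hb, h⟩ := hε.exists_digit_eq
      (add_mem (hε.digit_mem (n % p ^ c)) (hε.digit_mem (m % p ^ c)))
    refine ⟨k * p ^ c + b, ?_⟩
    rw [u_digit_add hb, ← hk, h, u_rec n, u_rec m]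
    ring

omit [IsUltrametricDist K] in
theorem IsResidueBasis.exists_u_neg (hε : IsResidueBasis p c ε) (n : ℕ) :
    ∃ k, -u p π ε n = u p π ε k := by
  have hq := one_lt_residueCard p c
  induction n using Nat.strong_induction_on with
  | _ n ih =>
    rcases Nat.eq_zero_or_pos n with rfl | hn
    · exact ⟨0, by rw [u_zero, neg_zero]⟩
    obtain ⟨k, hk⟩ := ih (n / p ^ c) (Nat.div_lt_self hn hq)
    obtain ⟨b, hb, h⟩ := hε.exists_digit_eq (neg_mem (hε.digit_mem (n % p ^ c)))
    refine ⟨k * p ^ c + b, ?_⟩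
    rw [u_digit_add hb, ← hk, h, u_rec n]
    ring

omit [IsUltrametricDist K] in
theorem IsResidueBasis.exists_u_sub (hε : IsResidueBasis p c ε) (n m : ℕ) :
    ∃ k, u p π ε n - u p π ε m = u p π ε k := by
  obtain ⟨k, hk⟩ := hε.exists_u_neg (π := π) m
  obtain ⟨l, hl⟩ := hε.exists_u_add (π := π) n k
  exact ⟨l, by rw [sub_eq_add_neg, hk, hl]⟩

/-- In `u_rec` the factor in front of $\mathfrak p^{-1}$ has norm at least $1$: it is either a
single nonzero digit, or a digit of norm at most $1$ added to some $u(n')$ with $n'\ne0$, whose norm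
exceeds $1$ by induction and therefore dominates. -/
theorem norm_inv_le_norm_u (hπ : IsPrimeElement π) (hε : IsResidueBasis p c ε) {n : ℕ}
    (hn : n ≠ 0) : ‖π⁻¹‖ ≤ ‖u p π ε n‖ := by
  have hq := one_lt_residueCard p c
  have h1 : 1 < ‖π⁻¹‖ := by
    rw [norm_inv]; exact (one_lt_inv₀ hπ.norm_pos).2 hπ.norm_lt_one
  induction n using Nat.strong_induction_on with
  | _ n ih =>
    rw [u_rec, norm_mul]
    refine le_mul_of_one_le_left (norm_nonneg _) ?_
    by_cases h0 : n / p ^ c = 0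
    · rw [h0, u_zero, add_zero, hε.norm_eq_one (hε.digit_mem _)]
      intro h
      have h2 : n < p ^ c := by
        rcases (Nat.div_eq_zero_iff).1 h0 with h | h
        · omega
        · exact h
      rw [Nat.mod_eq_of_lt h2] at h
      exact hn (hε.digit_injOn h2 (by omega) (h.trans digit_zero.symm))
    · have h2 := ih _ (Nat.div_lt_self (Nat.pos_of_ne_zero hn) hq) h0
      have h3 : ‖digit p ε (n % p ^ c)‖ ≤ 1 := hε.norm_le_one (hε.digit_mem _)
      rw [IsUltrametricDist.norm_add_eq_max_of_norm_ne_norm (by linarith)]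
      exact le_max_of_le_right (h1.le.trans h2)

theorem eq_zero_of_norm_u_le_one (hπ : IsPrimeElement π) (hε : IsResidueBasis p c ε) {n : ℕ}
    (h : ‖u p π ε n‖ ≤ 1) : n = 0 := by
  by_contra hn
  have h1 : 1 < ‖π⁻¹‖ := by
    rw [norm_inv]; exact (one_lt_inv₀ hπ.norm_pos).2 hπ.norm_lt_one
  linarith [norm_inv_le_norm_u hπ hε hn]

theorem u_injective (hπ : IsPrimeElement π) (hε : IsResidueBasis p c ε) :
    Function.Injective (u p π ε) := by
  have hq := one_lt_residueCard p c
  have hp0 : π⁻¹ ≠ 0 := inv_ne_zero hπ.ne_zero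
  intro n m h
  induction n using Nat.strong_induction_on generalizing m with
  | _ n ih =>
    rcases Nat.eq_zero_or_pos n with rfl | hn
    · exact (eq_zero_of_norm_u_le_one hπ hε (by rw [← h, u_zero]; simp)).symm
    rw [u_rec n, u_rec m] at h
    have h1 := mul_right_cancel₀ hp0 h
    obtain ⟨t, ht⟩ := hε.exists_u_sub (π := π) (n / p ^ c) (m / p ^ c)
    have h2 : u p π ε t = digit p ε (m % p ^ c) - digit p ε (n % p ^ c) := by
      rw [← ht]; linear_combination h1
    have h3 : t = 0 := eq_zero_of_norm_u_le_one hπ hε (by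
      rw [h2]; exact hε.norm_le_one (sub_mem (hε.digit_mem _) (hε.digit_mem _)))
    rw [h3, u_zero] at h2 ht
    have h4 := ih _ (Nat.div_lt_self hn hq) (sub_eq_zero.1 ht)
    have h5 := hε.digit_injOn (Nat.mod_lt n hq.le) (Nat.mod_lt m hq.le) (sub_eq_zero.1 h2.symm).symm
    rw [← Nat.div_add_mod n (p ^ c), ← Nat.div_add_mod m (p ^ c), h4, h5]

theorem eq_of_norm_u_sub_le_one (hπ : IsPrimeElement π) (hε : IsResidueBasis p c ε) {n m : ℕ}
    (h : ‖u p π ε n - u p π ε m‖ ≤ 1) : n = m := by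
  obtain ⟨t, ht⟩ := hε.exists_u_sub (π := π) n m
  rw [ht] at h
  rw [eq_zero_of_norm_u_le_one hπ hε h, u_zero] at ht
  exact u_injective hπ hε (sub_eq_zero.1 ht)

omit [CharP K p] in
theorem norm_u_le (hπ : IsPrimeElement π) (hε : IsResidueBasis p c ε) {j d : ℕ}
    (hd : d < (p ^ c) ^ j) : ‖u p π ε d‖ ≤ ‖π⁻¹‖ ^ j := by
  have h1 : 1 < ‖π⁻¹‖ := by
    rw [norm_inv]; exact (one_lt_inv₀ hπ.norm_pos).2 hπ.norm_lt_one
  induction j generalizing d with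
  | zero =>
    have : d = 0 := by simpa using hd
    simp [this, u_zero]
  | succ j ih =>
    rw [u_rec, norm_mul, pow_succ]
    refine mul_le_mul_of_nonneg_right ?_ (norm_nonneg _)
    refine (IsUltrametricDist.norm_add_le_max _ _).trans (max_le ?_ ?_)
    · exact (hε.norm_le_one (hε.digit_mem _)).trans (one_le_pow₀ h1.le)
    · exact ih (Nat.div_lt_of_lt_mul (by rwa [← pow_succ']))

/-- Removing the low digits leaves $u(\lfloor n/q^j\rfloor)\mathfrak p^{-j}$ of norm at most
$|\mathfrak p|^{-j}$, so $u(\lfloor n/q^j\rfloor)$ is integral and its index is $0$. -/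
theorem lt_of_norm_u_le (hπ : IsPrimeElement π) (hε : IsResidueBasis p c ε) {j n : ℕ}
    (hn : ‖u p π ε n‖ ≤ ‖π⁻¹‖ ^ j) : n < (p ^ c) ^ j := by
  have hq : 0 < (p ^ c) ^ j := pow_pos (residueCard_pos p c) j
  have h1 := u_mul_pow_add (π := π) (ε := ε) (Nat.mod_lt n hq) (n / (p ^ c) ^ j)
  rw [Nat.div_add_mod'] at h1
  have h2 : ‖u p π ε (n / (p ^ c) ^ j) * (π⁻¹) ^ j‖ ≤ ‖π⁻¹‖ ^ j := by
    have : u p π ε (n / (p ^ c) ^ j) * (π⁻¹) ^ j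
        = u p π ε n - u p π ε (n % (p ^ c) ^ j) := by rw [h1]; ring
    rw [this]
    exact (norm_sub_le_max_of_ultrametric _ _).trans
      (max_le hn (norm_u_le hπ hε (Nat.mod_lt n hq)))
  rw [norm_mul, norm_pow] at h2
  have h3 : 0 < ‖π⁻¹‖ ^ j := pow_pos (norm_pos_iff.2 (inv_ne_zero hπ.ne_zero)) j
  have h4 := eq_zero_of_norm_u_le_one hπ hε ((mul_le_iff_le_one_left h3).1 h2)
  rcases (Nat.div_eq_zero_iff).1 h4 with h | h
  · omega
  · exact h

-- Induction on the size of $x$: $x\mathfrak p$ is smaller, hence within $\mathcal O$ of some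
-- $u(m)$, and the integral remainder is a digit modulo $\mathfrak P$. Dividing by $\mathfrak p$
-- turns $\mathfrak P$ into $\mathcal O$.
omit [IsUltrametricDist K] in
theorem exists_norm_sub_u_le_one (hπ : IsPrimeElement π) (hε : IsResidueBasis p c ε) (x : K) :
    ∃ n, ‖x - u p π ε n‖ ≤ 1 := by
  have h1 : 1 < ‖π⁻¹‖ := by
    rw [norm_inv]; exact (one_lt_inv₀ hπ.norm_pos).2 hπ.norm_lt_one
  have hπ0 := hπ.ne_zero
  obtain ⟨N, hN⟩ := pow_unbounded_of_one_lt ‖x‖ h1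
  replace hN := hN.le
  induction N generalizing x with
  | zero => exact ⟨0, by simpa [u_zero] using hN⟩
  | succ N ih =>
    have h2 : ‖x * π‖ ≤ ‖π⁻¹‖ ^ N := by
      rw [norm_mul, ← le_div_iff₀ hπ.norm_pos, div_eq_mul_inv, ← norm_inv, ← pow_succ]
      exact hN
    obtain ⟨m, hm⟩ := ih (x * π) h2
    obtain ⟨a, ha, hxa⟩ := hε.exists_norm_sub_lt hm
    obtain ⟨b, hb, rfl⟩ := hε.exists_digit_eq ha
    refine ⟨m * p ^ c + b, ?_⟩
    have h3 := hπ.norm_le _ hxa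
    have h4 : x - u p π ε (m * p ^ c + b) = (x * π - u p π ε m - digit p ε b) * π⁻¹ := by
      rw [u_digit_add hb]
      field_simp
      ring
    rw [h4, norm_mul, norm_inv, ← div_eq_mul_inv, div_le_one hπ.norm_pos]
    exact h3

theorem exists_norm_sub_u_le_one_of_norm_le (hπ : IsPrimeElement π) (hε : IsResidueBasis p c ε)
    {x : K} {j : ℕ} (hx : ‖x‖ ≤ ‖π⁻¹‖ ^ j) : ∃ n < (p ^ c) ^ j, ‖x - u p π ε n‖ ≤ 1 := by
  have h1 : 1 < ‖π⁻¹‖ := by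
    rw [norm_inv]; exact (one_lt_inv₀ hπ.norm_pos).2 hπ.norm_lt_one
  obtain ⟨n, hn⟩ := exists_norm_sub_u_le_one hπ hε x
  refine ⟨n, lt_of_norm_u_le hπ hε ?_, hn⟩
  have : u p π ε n = x - (x - u p π ε n) := by ring
  rw [this]
  exact (norm_sub_le_max_of_ultrametric _ _).trans (max_le hx (hn.trans (one_le_pow₀ h1.le)))

variable {χ : AddChar K Circle}

omit [IsUltrametricDist K] [Fact p.Prime] [CharP K p] in
theorem IsBasicCharacter.subfield_mul_pow (hχ : IsBasicCharacter π ε χ)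
    (hε : IsResidueBasis p c ε) {a : K} (ha : a ∈ hε.subfield) {j : ℕ} (hj : 2 ≤ j) :
    χ (a * (π⁻¹) ^ j) = 1 := by
  rw [hε.mem_subfield_iff] at ha
  induction ha using AddSubgroup.closure_induction with
  | mem x hx =>
    obtain ⟨i, rfl⟩ := hx
    exact hχ.eq_one i j hj
  | zero => simp
  | add x y _ _ hx hy => rw [add_mul, AddChar.map_add_eq_mul, hx, hy, mul_one]
  | neg x _ hx => rw [neg_mul, AddChar.map_neg_eq_inv, hx, inv_one]

omit [IsUltrametricDist K] [CharP K p] in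
theorem IsBasicCharacter.subfield_mul_u (hχ : IsBasicCharacter π ε χ)
    (hε : IsResidueBasis p c ε) {a : K} (ha : a ∈ hε.subfield) {j : ℕ} (hj : 1 ≤ j) (m : ℕ) :
    χ (a * (π⁻¹) ^ j * u p π ε m) = 1 := by
  have hq := one_lt_residueCard p c
  induction m using Nat.strong_induction_on generalizing j with
  | _ m ih =>
    rcases Nat.eq_zero_or_pos m with rfl | hm
    · simp [u_zero]
    have h1 : a * (π⁻¹) ^ j * u p π ε m = a * digit p ε (m % p ^ c) * (π⁻¹) ^ (j + 1)
        + a * (π⁻¹) ^ (j + 1) * u p π ε (m / p ^ c) := by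
      rw [u_rec m]; ring
    rw [h1, AddChar.map_add_eq_mul, ih _ (Nat.div_lt_self hm hq) (by omega), mul_one]
    exact hχ.subfield_mul_pow hε (mul_mem ha (hε.digit_mem _)) (by omega)

omit [IsUltrametricDist K] [CharP K p] in
theorem IsBasicCharacter.u_mul_pow_mul_u (hχ : IsBasicCharacter π ε χ)
    (hε : IsResidueBasis p c ε) (n m j : ℕ) : χ (u p π ε n * (π⁻¹) ^ j * u p π ε m) = 1 := by
  have hq := one_lt_residueCard p c
  induction n using Nat.strong_induction_on generalizing j with
  | _ n ih =>
    rcases Nat.eq_zero_or_pos n with rfl | hn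
    · simp [u_zero]
    have h1 : u p π ε n * (π⁻¹) ^ j * u p π ε m
        = digit p ε (n % p ^ c) * (π⁻¹) ^ (j + 1) * u p π ε m
        + u p π ε (n / p ^ c) * (π⁻¹) ^ (j + 1) * u p π ε m := by
      rw [u_rec n]; ring
    rw [h1, AddChar.map_add_eq_mul, ih _ (Nat.div_lt_self hn hq), mul_one]
    exact hχ.subfield_mul_u hε (hε.digit_mem _) (by omega) m

-- Multiplied out, the product has coefficients in the finite subfield and only powers $\mathfrak
-- p^{-i}$ with $i\ge2$, where $\chi$ is trivial. This makes $\chi(u(n)\,\cdot)$ invariant under all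
-- translations by $u(m)$.
omit [IsUltrametricDist K] [CharP K p] in
theorem IsBasicCharacter.u_mul_u (hχ : IsBasicCharacter π ε χ)
    (hε : IsResidueBasis p c ε) (n m : ℕ) : χ (u p π ε n * u p π ε m) = 1 := by
  simpa using hχ.u_mul_pow_mul_u hε n m 0

-- Here $y\mathcal O$ contains $\mathfrak p^{-1}\mathcal O$, on which $\chi$ is nontrivial.
omit [IsUltrametricDist K] [CharP K p] [Fact p.Prime] [NeZero c] in
theorem IsBasicCharacter.exists_integer_ne_one (hχ : IsBasicCharacter π ε χ)
    (hπ : IsPrimeElement π) {y : K} (hy : ‖π⁻¹‖ ≤ ‖y‖) : ∃ x : K, ‖x‖ ≤ 1 ∧ χ (y * x) ≠ 1 := by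
  obtain ⟨w, hw, hw1⟩ := hχ.nontrivial
  have hp : 0 < ‖π⁻¹‖ := norm_pos_iff.2 (inv_ne_zero hπ.ne_zero)
  have hy0 : y ≠ 0 := norm_pos_iff.1 (hp.trans_le hy)
  refine ⟨w / y, ?_, by rwa [mul_div_cancel₀ _ hy0]⟩
  rw [norm_div, div_le_one (hp.trans_le hy)]
  refine le_trans ?_ hy
  rw [norm_mul, mul_comm] at hw
  rwa [norm_inv, ← one_div, le_div_iff₀ hπ.norm_pos]

omit [IsUltrametricDist K] [CharP K p] [Fact p.Prime] in
theorem IsBasicCharacter.exists_subfield_ne_one (hχ : IsBasicCharacter π ε χ)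
    (hπ : IsPrimeElement π) (hε : IsResidueBasis p c ε) :
    ∃ a ∈ hε.subfield, χ (a * π⁻¹) ≠ 1 := by
  obtain ⟨w, hw, hw1⟩ := hχ.nontrivial
  obtain ⟨a, ha, h⟩ := hε.exists_norm_sub_lt hw
  refine ⟨a, ha, ?_⟩
  have hπ0 := hπ.ne_zero
  have h1 : w = a * π⁻¹ + (π * w - a) * π⁻¹ := by field_simp; ring
  rw [h1, AddChar.map_add_eq_mul, hχ.trivial_on_integers ((π * w - a) * π⁻¹), mul_one] at hw1
  · exact hw1
  · rw [norm_mul, norm_inv, ← div_eq_mul_inv, div_le_one hπ.norm_pos]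
    exact hπ.norm_le _ h

/-- The characters `χ(u(n) ·)` with `n < q ^ r` separate the points of `𝒪` modulo `π ^ r`. -/
theorem IsBasicCharacter.exists_u_ne_one (hχ : IsBasicCharacter π ε χ)
    (hπ : IsPrimeElement π) (hε : IsResidueBasis p c ε) {x : K} {r : ℕ} (hx : ‖x‖ ≤ 1)
    (hxr : ‖π‖ ^ r < ‖x‖) : ∃ n < (p ^ c) ^ r, χ (u p π ε n * x) ≠ 1 := by
  have hπ0 := hπ.ne_zero
  have hp := hπ.norm_pos
  have hx0 : x ≠ 0 := norm_pos_iff.1 ((pow_pos hp r).trans hxr)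
  obtain ⟨s, hs⟩ := hπ.exists_norm_eq_zpow hx0
  have hs0 : 0 ≤ s := by
    by_contra! h
    have := (one_lt_zpow_iff_right_of_lt_one₀ hp hπ.norm_lt_one).2 h
    linarith
  lift s to ℕ using hs0
  rw [zpow_natCast] at hs
  have hsr : s < r := by
    rw [hs] at hxr
    exact (pow_lt_pow_iff_right_of_lt_one₀ hp hπ.norm_lt_one).1 hxr
  obtain ⟨f, hf, hf1⟩ := hχ.exists_subfield_ne_one hπ hε
  have hz : ‖x * (π⁻¹) ^ s‖ = 1 := by
    rw [norm_mul, hs, norm_pow, norm_inv, ← mul_pow, mul_inv_cancel₀ hp.ne', one_pow]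
  obtain ⟨a, ha, hxa⟩ := hε.exists_norm_sub_lt hz.le
  have ha0 : a ≠ 0 := by
    rintro rfl
    rw [sub_zero, hz] at hxa
    exact lt_irrefl _ hxa
  -- With $x\in\mathfrak p^s(a+\mathfrak P)$, the digit $f/a$ placed at $\mathfrak p^{-s-1}$ gives a
  -- product congruent to $f\mathfrak p^{-1}$ modulo $\mathcal O$, where $\chi\ne1$.
  have hfa : f / a ∈ hε.subfield := div_mem hf ha
  obtain ⟨b, hb, hbf⟩ := hε.exists_digit_eq hfa
  have hd : u p π ε (b * (p ^ c) ^ s) = f / a * π⁻¹ * (π⁻¹) ^ s := by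
    have := u_mul_pow_add (π := π) (ε := ε) (pow_pos (residueCard_pos p c) s) b
    rw [add_zero, u_zero, add_zero] at this
    have h2 := u_digit_add (π := π) (ε := ε) hb 0
    rw [Nat.zero_mul, Nat.zero_add, u_zero, add_zero] at h2
    rw [this, h2, hbf]
  refine ⟨b * (p ^ c) ^ s, lt_of_norm_u_le hπ hε ?_, ?_⟩
  · rw [hd, mul_assoc, ← pow_succ', norm_mul, norm_pow]
    have h1 : 1 ≤ ‖π⁻¹‖ := by
      rw [norm_inv]; exact ((one_lt_inv₀ hπ.norm_pos).2 hπ.norm_lt_one).le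
    calc _ ≤ 1 * ‖π⁻¹‖ ^ (s + 1) :=
          mul_le_mul_of_nonneg_right (hε.norm_le_one hfa) (by positivity)
      _ ≤ _ := by rw [one_mul]; exact pow_le_pow_right₀ h1 hsr
  · have h3 : f / a * π⁻¹ * (π⁻¹) ^ s * x
        = f * π⁻¹ + f / a * ((x * (π⁻¹) ^ s - a) * π⁻¹) := by
      field_simp; ring
    rw [hd, h3, AddChar.map_add_eq_mul, hχ.trivial_on_integers (f / a * _), mul_one]
    · exact hf1
    · rw [norm_mul]
      refine mul_le_one₀ (hε.norm_le_one hfa) (norm_nonneg _) ?_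
      rw [norm_mul, norm_inv, ← div_eq_mul_inv, div_le_one hπ.norm_pos]
      exact hπ.norm_le _ hxa

end Algebra

/-! ### Haar measure, cosets of the integers, and Fourier coefficients on $\mathcal O$. -/

section Measure

variable {K : Type*} [NontriviallyNormedField K]

theorem properSpace_of_locallyCompact [LocallyCompactSpace K] : ProperSpace K :=
  ProperSpace.of_locallyCompactSpace K

attribute [local instance] properSpace_of_locallyCompact

variable [IsUltrametricDist K] {p c : ℕ} [Fact p.Prime] [CharP K p] [NeZero c] {π : K}
  {ε : Fin c → K} {χ : AddChar K Circle}

theorem iUnion_closedBall_u (hπ : IsPrimeElement π) (hε : IsResidueBasis p c ε) :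
    ⋃ n, closedBall (u p π ε n) 1 = Set.univ := by
  refine Set.eq_univ_of_forall fun x => Set.mem_iUnion.2 ?_
  simpa [dist_eq_norm] using exists_norm_sub_u_le_one hπ hε x

theorem pairwise_disjoint_closedBall_u (hπ : IsPrimeElement π) (hε : IsResidueBasis p c ε) :
    Pairwise (Function.onFun Disjoint fun n => closedBall (u p π ε n) 1) := by
  intro n m hnm
  refine (IsUltrametricDist.closedBall_eq_or_disjoint _ _ _).resolve_left fun h => hnm ?_
  have : u p π ε n ∈ closedBall (u p π ε m) 1 := h ▸ mem_closedBall_self zero_le_one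
  exact eq_of_norm_u_sub_le_one hπ hε (by simpa [dist_eq_norm] using this)

theorem preimage_add_right_closedBall (a : K) :
    (fun x => x + a) ⁻¹' closedBall a 1 = closedBall 0 1 := by
  ext x; simp [dist_eq_norm]

theorem add_u_mem_closedBall_iff (hπ : IsPrimeElement π) (hε : IsResidueBasis p c ε) {x : K}
    (hx : x ∈ closedBall (0 : K) 1) {n k : ℕ} :
    x + u p π ε n ∈ closedBall (u p π ε k) 1 ↔ n = k := by
  rw [mem_closedBall, dist_zero_right] at hx
  rw [mem_closedBall, dist_eq_norm]
  constructor
  · intro h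
    refine eq_of_norm_u_sub_le_one hπ hε ?_
    have : u p π ε n - u p π ε k = (x + u p π ε n - u p π ε k) - x := by ring
    rw [this]
    exact (norm_sub_le_max_of_ultrametric _ _).trans (max_le h hx)
  · rintro rfl
    simpa using hx

variable [LocallyCompactSpace K] [MeasurableSpace K] [BorelSpace K] {μ : Measure K}
  [μ.IsAddHaarMeasure]

theorem setLIntegral_closedBall_eq (a : K) (f : K → ℝ≥0∞) :
    ∫⁻ x in closedBall a 1, f x ∂μ = ∫⁻ x in closedBall 0 1, f (x + a) ∂μ := by
  rw [← (measurePreserving_add_right μ a).setLIntegral_comp_preimage_emb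
    (measurableEmbedding_addRight a), preimage_add_right_closedBall]

theorem setIntegral_closedBall_eq (a : K) (f : K → ℂ) :
    ∫ x in closedBall a 1, f x ∂μ = ∫ x in closedBall 0 1, f (x + a) ∂μ := by
  rw [← (measurePreserving_add_right μ a).setIntegral_preimage_emb
    (measurableEmbedding_addRight a), preimage_add_right_closedBall]

/-- Integration over `K` by summing over the cosets `𝒪 + u(n)`. -/
theorem lintegral_eq_tsum_lintegral_add_u (hπ : IsPrimeElement π) (hε : IsResidueBasis p c ε)
    (f : K → ℝ≥0∞) :
    ∫⁻ x, f x ∂μ = ∑' n, ∫⁻ x in closedBall 0 1, f (x + u p π ε n) ∂μ := by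
  rw [← setLIntegral_univ, ← iUnion_closedBall_u hπ hε,
    lintegral_iUnion (fun _ => measurableSet_closedBall) (pairwise_disjoint_closedBall_u hπ hε)]
  exact tsum_congr fun n => setLIntegral_closedBall_eq _ _

theorem hasSum_integral_add_u (hπ : IsPrimeElement π) (hε : IsResidueBasis p c ε)
    {f : K → ℂ} (hf : Integrable f μ) :
    HasSum (fun n => ∫ x in closedBall 0 1, f (x + u p π ε n) ∂μ) (∫ x, f x ∂μ) := by
  have h := hasSum_integral_iUnion (f := f) (μ := μ)
    (fun n => measurableSet_closedBall (x := u p π ε n) (ε := 1))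
    (pairwise_disjoint_closedBall_u hπ hε) (by rwa [iUnion_closedBall_u hπ hε, integrableOn_univ])
  rw [iUnion_closedBall_u hπ hε, setIntegral_univ] at h
  have h2 : (fun n => ∫ x in closedBall 0 1, f (x + u p π ε n) ∂μ)
      = fun n => ∫ x in closedBall (u p π ε n) 1, f x ∂μ :=
    funext fun n => (setIntegral_closedBall_eq _ f).symm
  rwa [h2]

theorem ae_restrict_closedBall_iff (a : K) (P : K → Prop) :
    (∀ᵐ x ∂μ.restrict (closedBall a 1), P x) ↔
      ∀ᵐ x ∂μ.restrict (closedBall 0 1), P (x + a) := by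
  have h := ((measurePreserving_add_right μ a).restrict_preimage_emb
    (measurableEmbedding_addRight a) (closedBall a 1))
  rw [preimage_add_right_closedBall] at h
  rw [← h.map_eq, (measurableEmbedding_addRight a).ae_map_iff]

theorem ae_iff_ae_add_u (hπ : IsPrimeElement π) (hε : IsResidueBasis p c ε) (P : K → Prop) :
    (∀ᵐ x ∂μ, P x) ↔ ∀ᵐ x ∂μ.restrict (closedBall 0 1), ∀ n, P (x + u p π ε n) := by
  rw [ae_all_iff, ← Measure.restrict_univ (μ := μ), ← iUnion_closedBall_u hπ hε,
    ae_restrict_iUnion_iff, Measure.restrict_restrict_of_subset]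
  · exact forall_congr' fun n => ae_restrict_closedBall_iff _ _
  · rw [iUnion_closedBall_u hπ hε]; exact Set.subset_univ _

theorem closedBall_pow_eq_iUnion (hπ : IsPrimeElement π) (hε : IsResidueBasis p c ε) (j : ℕ) :
    closedBall (0 : K) (‖π⁻¹‖ ^ j) = ⋃ n : Fin ((p ^ c) ^ j), closedBall (u p π ε n) 1 := by
  have h1 : 1 ≤ ‖π⁻¹‖ := by
    rw [norm_inv]; exact ((one_lt_inv₀ hπ.norm_pos).2 hπ.norm_lt_one).le
  ext x
  simp only [mem_closedBall, dist_eq_norm, sub_zero, Set.mem_iUnion]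
  constructor
  · intro hx
    obtain ⟨n, hn, h⟩ := exists_norm_sub_u_le_one_of_norm_le hπ hε hx
    exact ⟨⟨n, hn⟩, h⟩
  · rintro ⟨n, hn⟩
    rw [← sub_add_cancel x (u p π ε n)]
    exact (IsUltrametricDist.norm_add_le_max _ _).trans
      (max_le (hn.trans (one_le_pow₀ h1)) (norm_u_le hπ hε n.2))

theorem measure_closedBall_one (hμ : μ (closedBall 0 1) = 1) (a : K) :
    μ (closedBall a 1) = 1 := by
  rw [← hμ, ← preimage_add_right_closedBall a,
    (measurePreserving_add_right μ a).measure_preimage measurableSet_closedBall.nullMeasurableSet]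

/-- By uniqueness of Haar measure only the mass of $\mathcal O$ matters; its preimage is $\mathfrak
p^{-j}\mathcal O$, a disjoint union of $q^j$ cosets of $\mathcal O$. -/
theorem map_mul_pow (hμ : μ (closedBall 0 1) = 1) (hπ : IsPrimeElement π)
    (hε : IsResidueBasis p c ε) (j : ℕ) :
    μ.map (fun x => π ^ j * x) = ((p ^ c : ℕ) : ℝ≥0∞) ^ j • μ := by
  have hj : π ^ j ≠ 0 := pow_ne_zero _ hπ.ne_zero
  let e : K ≃L[K] K := ContinuousLinearEquiv.unitsEquivAut K (Units.mk0 _ hj)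
  have he : (fun x : K => π ^ j * x) = e := by
    funext x
    simp [e, mul_comm]
  have : (μ.map e).IsAddHaarMeasure := e.isAddHaarMeasure_map μ
  rw [he]
  have h1 : μ.map e = Measure.addHaarScalarFactor (μ.map e) μ • μ :=
    Measure.isAddLeftInvariant_eq_smul _ _
  have h2 : (μ.map e) (closedBall 0 1) = ((p ^ c : ℕ) : ℝ≥0∞) ^ j := by
    rw [Measure.map_apply e.continuous.measurable measurableSet_closedBall]
    have : e ⁻¹' closedBall 0 1 = closedBall 0 (‖π⁻¹‖ ^ j) := by
      ext x
      rw [← he]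
      simp only [Set.mem_preimage, mem_closedBall, dist_zero_right, norm_mul, norm_pow, norm_inv,
        inv_pow]
      rw [← one_div, le_div_iff₀ (pow_pos hπ.norm_pos j), mul_comm]
    rw [this, closedBall_pow_eq_iUnion hπ hε, measure_iUnion _ fun _ => measurableSet_closedBall]
    · simp [measure_closedBall_one hμ]
    · intro a b hab
      exact pairwise_disjoint_closedBall_u hπ hε fun h => hab (Fin.ext h)
  generalize Measure.addHaarScalarFactor (μ.map e) μ = k at h1
  rw [h1, Measure.smul_apply, hμ, ENNReal.smul_def, smul_eq_mul, mul_one] at h2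
  rw [h1, ← h2]
  rfl

theorem residueCard_ne_zero (p c : ℕ) [Fact p.Prime] [NeZero c] : ((p ^ c : ℕ) : ℝ≥0∞) ≠ 0 :=
  Nat.cast_ne_zero.2 (residueCard_pos p c).ne'

theorem map_mul_zpow (hμ : μ (closedBall 0 1) = 1) (hπ : IsPrimeElement π)
    (hε : IsResidueBasis p c ε) (j : ℤ) :
    μ.map (fun x => π ^ j * x) = ((p ^ c : ℕ) : ℝ≥0∞) ^ j • μ := by
  obtain ⟨n, rfl | rfl⟩ := j.eq_nat_or_neg
  · simpa using map_mul_pow hμ hπ hε n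
  · have h1 := map_mul_pow hμ hπ hε n
    have hm : ∀ a : K, Measurable fun x : K => a * x := fun a => measurable_const_mul a
    have h2 := congrArg (Measure.map fun x => π ^ (-n : ℤ) * x) h1
    rw [Measure.map_map (hm _) (hm _), Measure.map_smul] at h2
    have h3 : (fun x => π ^ (-n : ℤ) * x) ∘ (fun x => π ^ n * x) = id := by
      funext x
      have := pow_ne_zero n hπ.ne_zero
      simp [this]
    rw [h3, Measure.map_id] at h2
    conv_rhs => rw [h2]
    rw [smul_smul, ENNReal.zpow_neg, zpow_natCast, ENNReal.inv_mul_cancel, one_smul]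
    · exact pow_ne_zero _ (residueCard_ne_zero p c)
    · exact ENNReal.pow_ne_top (ENNReal.natCast_ne_top _)

theorem lintegral_comp_zpow_mul (hμ : μ (closedBall 0 1) = 1) (hπ : IsPrimeElement π)
    (hε : IsResidueBasis p c ε) (j : ℤ) (f : K → ℝ≥0∞) :
    ∫⁻ x, f (π ^ j * x) ∂μ = ((p ^ c : ℕ) : ℝ≥0∞) ^ j * ∫⁻ x, f x ∂μ := by
  have h := lintegral_map_equiv (μ := μ) f
    (MeasurableEquiv.mulLeft₀ (π ^ j) (zpow_ne_zero j hπ.ne_zero))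
  have h2 : ⇑(MeasurableEquiv.mulLeft₀ (π ^ j) (zpow_ne_zero j hπ.ne_zero))
    = fun x => π ^ j * x := rfl
  rw [h2, map_mul_zpow hμ hπ hε, lintegral_smul_measure, smul_eq_mul] at h
  exact h.symm

theorem integral_comp_zpow_mul (hμ : μ (closedBall 0 1) = 1) (hπ : IsPrimeElement π)
    (hε : IsResidueBasis p c ε) (j : ℤ) (f : K → ℂ) :
    ∫ x, f (π ^ j * x) ∂μ = ((p ^ c : ℕ) : ℂ) ^ j * ∫ x, f x ∂μ := by
  have h := integral_map_equiv (μ := μ)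
    (MeasurableEquiv.mulLeft₀ (π ^ j) (zpow_ne_zero j hπ.ne_zero)) f
  have h2 : ⇑(MeasurableEquiv.mulLeft₀ (π ^ j) (zpow_ne_zero j hπ.ne_zero))
    = fun x => π ^ j * x := rfl
  rw [h2, map_mul_zpow hμ hπ hε, integral_smul_measure] at h
  rw [← h]
  obtain ⟨n, rfl | rfl⟩ := j.eq_nat_or_neg <;> simp [ENNReal.zpow_neg]

theorem quasiMeasurePreserving_zpow_mul (hμ : μ (closedBall 0 1) = 1) (hπ : IsPrimeElement π)
    (hε : IsResidueBasis p c ε) (j : ℤ) :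
    Measure.QuasiMeasurePreserving (fun x => π ^ j * x) μ μ :=
  ⟨measurable_const_mul _, by
    rw [map_mul_zpow hμ hπ hε]
    exact Measure.smul_absolutelyContinuous⟩

/-- For $n\ne0$, translating the integral by an integer $a$ with $\chi(u(n)a)\ne1$ multiplies it by
that number, so it vanishes. -/
theorem setIntegral_character (hμ : μ (closedBall 0 1) = 1) (hπ : IsPrimeElement π)
    (hε : IsResidueBasis p c ε) (hχ : IsBasicCharacter π ε χ) (n : ℕ) :
    ∫ x in closedBall 0 1, (χ (u p π ε n * x) : ℂ) ∂μ = if n = 0 then 1 else 0 := by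
  split_ifs with hn
  · subst hn
    simp [u_zero, measureReal_def, hμ]
  obtain ⟨a, ha, ha1⟩ := hχ.exists_integer_ne_one hπ (norm_inv_le_norm_u hπ hε hn)
  have hball : closedBall a 1 = closedBall (0 : K) 1 := by
    refine (IsUltrametricDist.closedBall_eq_of_mem ?_).symm
    simpa using ha
  have h := setIntegral_closedBall_eq (μ := μ) a (fun x => (χ (u p π ε n * x) : ℂ))
  simp only [mul_add, AddChar.map_add_eq_mul, Circle.coe_mul] at h
  rw [integral_mul_const, hball] at h
  have h1 : (χ (u p π ε n * a) : ℂ) ≠ 1 := fun h => ha1 (Circle.ext (by simpa using h))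
  have h2 : (∫ x in closedBall 0 1, (χ (u p π ε n * x) : ℂ) ∂μ) * ((χ (u p π ε n * a) : ℂ) - 1)
    = 0 := by rw [mul_sub, ← h]; ring
  exact (mul_eq_zero.1 h2).resolve_right (sub_ne_zero.2 h1)

/-- Orthogonality over the finite group $\{u(n):n<q^r\}$: if some member gives a value different
from $1$, shifting the summation by it multiplies the sum by that value. -/
theorem sum_character_eq (hπ : IsPrimeElement π) (hε : IsResidueBasis p c ε)
    (hχ : IsBasicCharacter π ε χ) (r : ℕ) {x : K} (hx : ‖x‖ ≤ 1) :
    ∑ n ∈ Finset.range ((p ^ c) ^ r), (χ (u p π ε n * x) : ℂ)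
      = if ‖x‖ ≤ ‖π‖ ^ r then (((p ^ c) ^ r : ℕ) : ℂ) else 0 := by
  split_ifs with h
  · have : ∀ n ∈ Finset.range ((p ^ c) ^ r), (χ (u p π ε n * x) : ℂ) = 1 := by
      intro n hn
      rw [hχ.trivial_on_integers, Circle.coe_one]
      rw [norm_mul]
      calc _ ≤ ‖π⁻¹‖ ^ r * ‖π‖ ^ r :=
            mul_le_mul (norm_u_le hπ hε (Finset.mem_range.1 hn)) h (norm_nonneg _) (by positivity)
        _ = 1 := by rw [norm_inv, ← mul_pow, inv_mul_cancel₀ hπ.norm_pos.ne', one_pow]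
    rw [Finset.sum_congr rfl this]
    simp
  · obtain ⟨m, hm, hm1⟩ := hχ.exists_u_ne_one hπ hε hx (not_le.1 h)
    choose σ hσ using fun n => hε.exists_u_add (π := π) n m
    have hmaps : Set.MapsTo σ (Finset.range ((p ^ c) ^ r)) (Finset.range ((p ^ c) ^ r)) := by
      intro n hn
      rw [Finset.coe_range, Set.mem_Iio] at hn ⊢
      refine lt_of_norm_u_le hπ hε ?_
      rw [← hσ]
      exact (IsUltrametricDist.norm_add_le_max _ _).trans
        (max_le (norm_u_le hπ hε hn) (norm_u_le hπ hε hm))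
    have hinj : Set.InjOn σ (Finset.range ((p ^ c) ^ r)) := by
      intro a _ b _ hab
      have := (hσ a).trans ((congrArg (u p π ε) hab).trans (hσ b).symm)
      exact u_injective hπ hε (add_right_cancel this)
    have h1 := Finset.sum_nbij (f := fun n => (χ (u p π ε n * x) * χ (u p π ε m * x) : ℂ))
      (g := fun n => (χ (u p π ε n * x) : ℂ)) σ
      hmaps hinj (Finset.surjOn_of_injOn_of_card_le σ hmaps hinj le_rfl) (fun n _ => by
        rw [← hσ, add_mul, AddChar.map_add_eq_mul, Circle.coe_mul])
    rw [← Finset.sum_mul] at h1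
    have h2 : (χ (u p π ε m * x) : ℂ) ≠ 1 := fun h => hm1 (Circle.ext (by simpa using h))
    have h3 : (∑ n ∈ Finset.range ((p ^ c) ^ r), (χ (u p π ε n * x) : ℂ))
      * ((χ (u p π ε m * x) : ℂ) - 1) = 0 := by rw [mul_sub, h1]; ring
    exact (mul_eq_zero.1 h3).resolve_right (sub_ne_zero.2 h2)

theorem continuous_character_mul (hχ : IsBasicCharacter π ε χ) (a : K) :
    Continuous fun x => (χ (a * x) : ℂ) := by
  have := hχ.continuous
  fun_prop

theorem integrable_character_mul {ν : Measure K} (hχ : IsBasicCharacter π ε χ) (a : K)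
    {g : K → ℂ} (hg : Integrable g ν) : Integrable (fun x => (χ (a * x) : ℂ) * g x) ν :=
  hg.bdd_mul (c := 1) (continuous_character_mul hχ a).aestronglyMeasurable
    (Filter.Eventually.of_forall fun _ => (Circle.norm_coe _).le)

/-- The balls whose radius is a power of the prime element form a basis of the topology. -/
theorem isTopologicalBasis_closedBall_pow (hπ : IsPrimeElement π) :
    TopologicalSpace.IsTopologicalBasis
      {s : Set K | ∃ (a : K) (r : ℕ), s = closedBall a (‖π‖ ^ r)} := by
  refine TopologicalSpace.isTopologicalBasis_of_isOpen_of_nhds ?_ ?_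
  · rintro _ ⟨a, r, rfl⟩
    exact IsUltrametricDist.isOpen_closedBall _ (pow_pos hπ.norm_pos r).ne'
  · intro a v ha hv
    obtain ⟨δ, hδ, h⟩ := Metric.isOpen_iff.1 hv a ha
    obtain ⟨r, hr⟩ := exists_pow_lt_of_lt_one hδ hπ.norm_lt_one
    exact ⟨_, ⟨a, r, rfl⟩, mem_closedBall_self (by positivity),
      (closedBall_subset_ball hr).trans h⟩

theorem isPiSystem_closedBall_pow (π : K) :
    IsPiSystem {s : Set K | ∃ (a : K) (r : ℕ), s = closedBall a (‖π‖ ^ r)} := by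
  rintro _ ⟨a, r, rfl⟩ _ ⟨b, s, rfl⟩ hne
  rcases IsUltrametricDist.closedBall_subset_trichotomy a b (‖π‖ ^ r) (‖π‖ ^ s) with h | h | h
  · rw [Set.inter_eq_left.2 h]; exact ⟨a, r, rfl⟩
  · rw [Set.inter_eq_right.2 h]; exact ⟨b, s, rfl⟩
  · exact absurd h (Set.not_disjoint_iff_nonempty_inter.2 hne)

/-- An integrable function on `𝒪` is determined by its Fourier coefficients. -/
theorem ae_eq_zero_of_forall_coeff_eq_zero (hπ : IsPrimeElement π) (hε : IsResidueBasis p c ε)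
    (hχ : IsBasicCharacter π ε χ) {g : K → ℂ} (hg : IntegrableOn g (closedBall 0 1) μ)
    (h : ∀ n, ∫ x in closedBall 0 1, (χ (u p π ε n * x) : ℂ) * g x ∂μ = 0) :
    g =ᵐ[μ.restrict (closedBall 0 1)] 0 := by
  have hball : ∀ (a : K) (r : ℕ), ∫ x in closedBall a (‖π‖ ^ r), g x
      ∂(μ.restrict (closedBall 0 1)) = 0 := by
    intro a r
    rw [Measure.restrict_restrict measurableSet_closedBall]
    have hr : ‖π‖ ^ r ≤ 1 := pow_le_one₀ (norm_nonneg _) hπ.norm_lt_one.le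
    by_cases ha : a ∈ closedBall (0 : K) 1
    · rw [mem_closedBall, dist_zero_right] at ha
      -- The Dirichlet kernel of length $q^r$ is $q^r$ times the indicator of a ball, so vanishing
      -- Fourier coefficients give vanishing integrals over balls.
      have h1 : ∫ x in closedBall 0 1, (∑ n ∈ Finset.range ((p ^ c) ^ r),
          (χ (u p π ε n * (x - a)) : ℂ)) * g x ∂μ = 0 := by
        simp_rw [Finset.sum_mul]
        rw [integral_finsetSum]
        · refine Finset.sum_eq_zero fun n _ => ?_
          simp_rw [mul_sub, sub_eq_add_neg, AddChar.map_add_eq_mul, Circle.coe_mul, mul_assoc,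
            mul_left_comm _ (χ (-(u p π ε n * a)) : ℂ)]
          rw [integral_const_mul, h n, mul_zero]
        · intro n _
          simp_rw [mul_sub, sub_eq_add_neg, AddChar.map_add_eq_mul, Circle.coe_mul, mul_assoc,
            mul_left_comm _ (χ (-(u p π ε n * a)) : ℂ)]
          exact (integrable_character_mul hχ _ hg).const_mul _
      have h2 : ∫ x in closedBall 0 1, (∑ n ∈ Finset.range ((p ^ c) ^ r),
          (χ (u p π ε n * (x - a)) : ℂ)) * g x ∂μ
          = ∫ x in closedBall 0 1, (((p ^ c) ^ r : ℕ) : ℂ) *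
            (closedBall a (‖π‖ ^ r)).indicator g x ∂μ := by
        refine setIntegral_congr_fun measurableSet_closedBall fun x hx => ?_
        rw [mem_closedBall, dist_zero_right] at hx
        rw [sum_character_eq hπ hε hχ r ((norm_sub_le_max_of_ultrametric x a).trans (max_le hx ha))]
        by_cases hxa : ‖x - a‖ ≤ ‖π‖ ^ r
        · rw [if_pos hxa, Set.indicator_of_mem (by rwa [mem_closedBall, dist_eq_norm])]
        · rw [if_neg hxa, Set.indicator_of_notMem (by rwa [mem_closedBall, dist_eq_norm]), zero_mul,
            mul_zero]
      rw [h1, integral_const_mul, setIntegral_indicator measurableSet_closedBall,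
        Set.inter_comm] at h2
      refine (mul_eq_zero.1 h2.symm).resolve_left ?_
      exact_mod_cast (pow_pos (residueCard_pos p c) r).ne'
    · have : closedBall a (‖π‖ ^ r) ∩ closedBall 0 1 = ∅ := by
        refine Set.eq_empty_of_forall_notMem fun x hx => ha ?_
        have h1 : x ∈ closedBall a 1 := closedBall_subset_closedBall hr hx.1
        rw [IsUltrametricDist.closedBall_eq_of_mem hx.2]
        rwa [mem_closedBall_comm]
      simp [this]
  -- In an ultrametric space these balls form a π-system, and they generate the Borel sets.
  have hall : ∀ s, MeasurableSet s → ∫ x in s, g x ∂(μ.restrict (closedBall 0 1)) = 0 := by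
    intro s hs
    refine MeasurableSpace.induction_on_inter
      (C := fun s _ => ∫ x in s, g x ∂(μ.restrict (closedBall 0 1)) = 0)
      ((BorelSpace.measurable_eq (α := K)).trans
        (isTopologicalBasis_closedBall_pow hπ).borel_eq_generateFrom)
      (isPiSystem_closedBall_pow π) (by simp) ?_ ?_ ?_ s hs
    · rintro _ ⟨a, r, rfl⟩
      exact hball a r
    · intro t ht h0
      have h1 := integral_add_compl ht hg
      have h2 : ∫ x, g x ∂(μ.restrict (closedBall 0 1)) = 0 := by
        simpa [u_zero] using h 0
      rwa [h0, zero_add, h2] at h1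
    · intro f hf hfm h0
      rw [integral_iUnion hfm hf (Integrable.integrableOn hg)]
      simp [h0]
  exact Integrable.ae_eq_zero_of_forall_setIntegral_eq_zero hg fun s hs _ => hall s hs

end Measure

/-! ### Parseval's identity and unitary maps between Hilbert bases. -/

section HilbertBasis

variable {ι E : Type*} [NormedAddCommGroup E] [InnerProductSpace ℂ E]

theorem eq_of_forall_inner_hilbertBasis_eq (b : HilbertBasis ι ℂ E) {x y : E}
    (h : ∀ i, inner ℂ (b i) x = inner ℂ (b i) y) : x = y := by
  refine b.repr.injective (lp.ext (funext fun i => ?_))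
  rw [b.repr_apply_apply, b.repr_apply_apply, h i]

/-- Parseval's identity in the extended nonnegative reals. -/
theorem tsum_enorm_inner_sq (b : HilbertBasis ι ℂ E) (x : E) :
    ∑' i, ‖inner ℂ (b i) x‖ₑ ^ 2 = ‖x‖ₑ ^ 2 := by
  have h := Complex.hasSum_re (b.hasSum_inner_mul_inner x x)
  have h1 : ∀ i, (inner ℂ x (b i) * inner ℂ (b i) x).re = ‖inner ℂ (b i) x‖ ^ 2 := by
    intro i
    rw [← inner_conj_symm x (b i), Complex.conj_mul', ← Complex.ofReal_pow, Complex.ofReal_re]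
  have h2 : (inner ℂ x x).re = ‖x‖ ^ 2 := by
    rw [inner_self_eq_norm_sq_to_K]; norm_cast
  simp_rw [h1] at h
  rw [h2] at h
  have h3 : ∀ r : ℝ, 0 ≤ r → ENNReal.ofReal (r ^ 2) = ENNReal.ofReal r ^ 2 :=
    fun r hr => ENNReal.ofReal_pow hr 2
  rw [← ofReal_norm, ← h3 _ (norm_nonneg x), ← h.tsum_eq,
    ENNReal.ofReal_tsum_of_nonneg (fun i => by positivity) h.summable]
  exact tsum_congr fun i => by rw [← ofReal_norm, h3 _ (norm_nonneg _)]

/-- The unitary map that matches two Hilbert bases along a bijection of the index sets. -/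
def unitaryOfBases {ι' : Type*} (b : HilbertBasis ι ℂ E) (b' : HilbertBasis ι' ℂ E) (σ : ι ≃ ι')
    [CompleteSpace E] : E ≃ₗᵢ[ℂ] E :=
  let b'' := HilbertBasis.mk (v := fun i => b' (σ i)) (b'.orthonormal.comp σ σ.injective) (by
    have : Set.range (fun i => b' (σ i)) = Set.range b' := σ.surjective.range_comp b'
    rw [this, b'.dense_span])
  b.repr.trans b''.repr.symm

theorem unitaryOfBases_apply {ι' : Type*} (b : HilbertBasis ι ℂ E) (b' : HilbertBasis ι' ℂ E)
    (σ : ι ≃ ι') [CompleteSpace E] (i : ι) : unitaryOfBases b b' σ (b i) = b' (σ i) := by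
  classical
  rw [unitaryOfBases, LinearIsometryEquiv.trans_apply, HilbertBasis.repr_self,
    HilbertBasis.repr_symm_single, HilbertBasis.coe_mk]

end HilbertBasis

/-! ### Plancherel's theorem through an explicit basis of $L^2(K)$. -/

section Plancherel

variable {K : Type*} [NontriviallyNormedField K]

attribute [local instance] properSpace_of_locallyCompact

/-- The function `1_{𝒪 + u(k)}(x) χ(u(n) x)`. -/
def cellFun (p : ℕ) {c : ℕ} (π : K) (ε : Fin c → K) (χ : AddChar K Circle) (k n : ℕ) : K → ℂ :=
  (closedBall (u p π ε k) 1).indicator fun x => (χ (u p π ε n * x) : ℂ)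

variable [IsUltrametricDist K] {p c : ℕ} [Fact p.Prime] [CharP K p] [NeZero c] {π : K}
  {ε : Fin c → K} {χ : AddChar K Circle}

/-- The index of `-u(n)`. -/
def negIndex (π : K) (hε : IsResidueBasis p c ε) (n : ℕ) : ℕ :=
  Classical.choose (hε.exists_u_neg (π := π) n)

theorem u_negIndex (hε : IsResidueBasis p c ε) (n : ℕ) :
    u p π ε (negIndex π hε n) = -u p π ε n :=
  (Classical.choose_spec (hε.exists_u_neg (π := π) n)).symm

theorem negIndex_negIndex (hπ : IsPrimeElement π) (hε : IsResidueBasis p c ε) (n : ℕ) :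
    negIndex π hε (negIndex π hε n) = n :=
  u_injective hπ hε (by rw [u_negIndex, u_negIndex, neg_neg])

theorem cellFun_add_u (hπ : IsPrimeElement π) (hε : IsResidueBasis p c ε)
    (hχ : IsBasicCharacter π ε χ) {x : K} (hx : x ∈ closedBall (0 : K) 1) (k n m : ℕ) :
    cellFun p π ε χ k n (x + u p π ε m) = if m = k then (χ (u p π ε n * x) : ℂ) else 0 := by
  classical
  rw [cellFun, Set.indicator_apply]
  simp only [add_u_mem_closedBall_iff hπ hε hx, mul_add, AddChar.map_add_eq_mul,
    hχ.u_mul_u hε, mul_one]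

theorem conj_cellFun (hε : IsResidueBasis p c ε) (k n : ℕ) (x : K) :
    starRingEnd ℂ (cellFun p π ε χ k n x) = cellFun p π ε χ k (negIndex π hε n) x := by
  classical
  simp only [cellFun, Set.indicator_apply]
  split_ifs
  · rw [u_negIndex, neg_mul, AddChar.map_neg_eq_inv, Circle.coe_inv_eq_conj]
  · simp

variable [LocallyCompactSpace K] [MeasurableSpace K] [BorelSpace K] {μ : Measure K}
  [μ.IsAddHaarMeasure]

theorem memLp_cellFun (hχ : IsBasicCharacter π ε χ) (k n : ℕ) (r : ℝ≥0∞) :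
    MemLp (cellFun p π ε χ k n) r μ := by
  rw [cellFun, memLp_indicator_iff_restrict measurableSet_closedBall]
  have : IsFiniteMeasure (μ.restrict (closedBall (u p π ε k) 1)) :=
    ⟨by simpa using measure_closedBall_lt_top⟩
  exact MemLp.of_bound (continuous_character_mul hχ _).aestronglyMeasurable 1
    (Filter.Eventually.of_forall fun _ => (Circle.norm_coe _).le)

theorem integrable_cellFun (hχ : IsBasicCharacter π ε χ) (k n : ℕ) :
    Integrable (cellFun p π ε χ k n) μ := memLp_one_iff_integrable.1 (memLp_cellFun hχ k n 1)

/-- The function `cellFun` as an element of `L²`. -/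
def cell (μ : Measure K) [μ.IsAddHaarMeasure] (hχ : IsBasicCharacter π ε χ) (k n : ℕ) :
    Lp ℂ 2 μ :=
  (memLp_cellFun (p := p) hχ k n 2).toLp _

theorem coeFn_cell (hχ : IsBasicCharacter π ε χ) (k n : ℕ) :
    cell (p := p) μ hχ k n =ᵐ[μ] cellFun p π ε χ k n := MemLp.coeFn_toLp _

theorem inner_cell (hχ : IsBasicCharacter π ε χ) (k n : ℕ) (f : Lp ℂ 2 μ) :
    inner ℂ (cell (p := p) μ hχ k n) f
      = ∫ x, starRingEnd ℂ (cellFun p π ε χ k n x) * f x ∂μ := by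
  rw [L2.inner_def]
  refine integral_congr_ae ?_
  filter_upwards [coeFn_cell (p := p) (μ := μ) hχ k n] with x hx
  rw [hx, RCLike.inner_apply, mul_comm]

/-- Moving the coset to $\mathcal O$ costs no phase, because $\chi(u(-n)u(k))=1$. The coordinates of
$f$ are thus the Fourier coefficients of its restrictions to the cosets. -/
theorem inner_cell_eq_setIntegral (hε : IsResidueBasis p c ε)
    (hχ : IsBasicCharacter π ε χ) (k n : ℕ) (f : Lp ℂ 2 μ) :
    inner ℂ (cell (p := p) μ hχ k n) f
      = ∫ x in closedBall 0 1, (χ (u p π ε (negIndex π hε n) * x) : ℂ) * f (x + u p π ε k) ∂μ := by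
  rw [inner_cell]
  simp_rw [conj_cellFun hε, cellFun, ← Set.indicator_mul_left]
  rw [integral_indicator measurableSet_closedBall, setIntegral_closedBall_eq]
  simp_rw [mul_add, AddChar.map_add_eq_mul, hχ.u_mul_u hε, mul_one]

theorem orthonormal_cell (hμ : μ (closedBall 0 1) = 1) (hπ : IsPrimeElement π)
    (hε : IsResidueBasis p c ε) (hχ : IsBasicCharacter π ε χ) :
    Orthonormal ℂ fun i : ℕ × ℕ => cell (p := p) μ hχ i.1 i.2 := by
  rw [orthonormal_iff_ite]
  rintro ⟨k, n⟩ ⟨l, m⟩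
  dsimp only
  rw [inner_cell_eq_setIntegral hε]
  have h1 := (ae_iff_ae_add_u hπ hε _).1 (coeFn_cell (p := p) (μ := μ) hχ l m)
  obtain ⟨t, ht⟩ := hε.exists_u_add (π := π) (negIndex π hε n) m
  rw [u_negIndex] at ht
  have h2 : ∫ x in closedBall 0 1, (χ (u p π ε (negIndex π hε n) * x) : ℂ) *
      (cell (p := p) μ hχ l m) (x + u p π ε k) ∂μ
      = ∫ x in closedBall 0 1, (if k = l then (1 : ℂ) else 0) * (χ (u p π ε t * x) : ℂ) ∂μ := by
    refine integral_congr_ae ?_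
    filter_upwards [h1, ae_restrict_mem measurableSet_closedBall] with x hx hx1
    rw [hx k, cellFun_add_u hπ hε hχ hx1, ← ht, add_mul, AddChar.map_add_eq_mul, Circle.coe_mul,
      u_negIndex]
    split_ifs <;> simp
  rw [h2, integral_const_mul, setIntegral_character hμ hπ hε hχ]
  have h3 : t = 0 ↔ n = m := by
    constructor
    · rintro rfl
      rw [u_zero] at ht
      exact u_injective hπ hε (by linear_combination -ht)
    · rintro rfl
      exact u_injective hπ hε (by rw [← ht, u_zero]; ring)
  by_cases hkl : k = l <;> by_cases hnm : n = m <;> simp [hkl, hnm, h3]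

theorem integrableOn_comp_add (f : Lp ℂ 2 μ) (a : K) :
    IntegrableOn (fun x => f (x + a)) (closedBall 0 1) μ := by
  have : IsFiniteMeasure (μ.restrict (closedBall (0 : K) 1)) :=
    ⟨by simpa using measure_closedBall_lt_top⟩
  have h : MemLp (fun x => f (x + a)) 2 μ :=
    (Lp.memLp f).comp_measurePreserving (measurePreserving_add_right μ a)
  exact (h.restrict _).integrable (by norm_num)

/-- The functions `1_{𝒪 + u(k)}(x) χ(u(n) x)` form a Hilbert basis of `L²(K)`. -/
def cellBasis (hμ : μ (closedBall 0 1) = 1) (hπ : IsPrimeElement π)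
    (hε : IsResidueBasis p c ε) (hχ : IsBasicCharacter π ε χ) :
    HilbertBasis (ℕ × ℕ) ℂ (Lp ℂ 2 μ) :=
  HilbertBasis.mkOfOrthogonalEqBot (orthonormal_cell hμ hπ hε hχ) (by
    rw [Submodule.eq_bot_iff]
    intro f hf
    have h : ∀ k n, inner ℂ (cell (p := p) μ hχ k n) f = 0 := fun k n =>
      (Submodule.mem_orthogonal _ f).1 hf _ (Submodule.subset_span ⟨(k, n), rfl⟩)
    refine Lp.ext (Filter.EventuallyEq.trans ?_ (Lp.coeFn_zero ℂ 2 μ).symm)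
    refine (ae_iff_ae_add_u hπ hε _).2 (ae_all_iff.2 fun k => ?_)
    refine ae_eq_zero_of_forall_coeff_eq_zero hπ hε hχ (integrableOn_comp_add f _) fun n => ?_
    have := h k (negIndex π hε n)
    rwa [inner_cell_eq_setIntegral hε, negIndex_negIndex hπ hε] at this)

theorem cellBasis_apply (hμ : μ (closedBall 0 1) = 1) (hπ : IsPrimeElement π)
    (hε : IsResidueBasis p c ε) (hχ : IsBasicCharacter π ε χ) (k n : ℕ) :
    cellBasis hμ hπ hε hχ (k, n) = cell (p := p) μ hχ k n := by
  rw [cellBasis, HilbertBasis.coe_mkOfOrthogonalEqBot]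

/-- Write $v=x+u(k)$ and $\xi=y+u(m)$ with $x,y\in\mathcal O$. In the phase, $xy$ and all products
of two translations are invisible to $\chi$; what remains is $\chi(-u(k)y)$ times the integral of
$\chi((u(n)-u(m))x)$ over $\mathcal O$. The transform therefore permutes the cells. -/
theorem fourierIntegral_cellFun (hμ : μ (closedBall 0 1) = 1) (hπ : IsPrimeElement π)
    (hε : IsResidueBasis p c ε) (hχ : IsBasicCharacter π ε χ) (k n : ℕ) (ξ : K) :
    Fourier.fourierIntegral χ μ (cellFun p π ε χ k n) ξ
      = cellFun p π ε χ n (negIndex π hε k) ξ := by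
  obtain ⟨m, hm⟩ := exists_norm_sub_u_le_one hπ hε ξ
  obtain ⟨y, rfl⟩ : ∃ y, ξ = y + u p π ε m := ⟨ξ - u p π ε m, by ring⟩
  have hy : y ∈ closedBall (0 : K) 1 := by simpa using hm
  rw [cellFun_add_u hπ hε hχ hy, Fourier.fourierIntegral_def]
  have h1 : ∀ v, χ (-(v * (y + u p π ε m))) • cellFun p π ε χ k n v
      = (closedBall (u p π ε k) 1).indicator
        (fun v => (χ (-(v * (y + u p π ε m))) : ℂ) * (χ (u p π ε n * v) : ℂ)) v := by
    intro v
    rw [Circle.smul_def, smul_eq_mul, cellFun, Set.indicator_mul_right]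
  simp_rw [h1]
  rw [integral_indicator measurableSet_closedBall, setIntegral_closedBall_eq]
  obtain ⟨t, ht⟩ := hε.exists_u_sub (π := π) n m
  have h2 : ∫ x in closedBall 0 1, (χ (-((x + u p π ε k) * (y + u p π ε m))) : ℂ) *
      (χ (u p π ε n * (x + u p π ε k)) : ℂ) ∂μ
      = ∫ x in closedBall 0 1, (χ (u p π ε (negIndex π hε k) * y) : ℂ) *
        (χ (u p π ε t * x) : ℂ) ∂μ := by
    refine setIntegral_congr_fun measurableSet_closedBall fun x hx => ?_
    rw [mem_closedBall, dist_zero_right] at hx hy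
    have h3 : -((x + u p π ε k) * (y + u p π ε m)) + u p π ε n * (x + u p π ε k)
        = u p π ε (negIndex π hε k) * y + u p π ε t * x + -(x * y)
          + u p π ε n * u p π ε k + -(u p π ε k * u p π ε m) := by
      rw [u_negIndex, ← ht]; ring
    have h4 : χ (x * y) = 1 := hχ.trivial_on_integers _ (by
      rw [norm_mul]; exact mul_le_one₀ hx (norm_nonneg _) hy)
    rw [← Circle.coe_mul, ← AddChar.map_add_eq_mul, h3, AddChar.map_add_eq_mul,
      AddChar.map_add_eq_mul, AddChar.map_add_eq_mul, AddChar.map_add_eq_mul,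
      AddChar.map_neg_eq_inv χ (_ * _), AddChar.map_neg_eq_inv χ (_ * _), hχ.u_mul_u hε,
      hχ.u_mul_u hε, h4]
    simp
  rw [h2, integral_const_mul, setIntegral_character hμ hπ hε hχ]
  have h5 : t = 0 ↔ m = n := by
    constructor
    · rintro rfl
      rw [u_zero] at ht
      exact u_injective hπ hε (by linear_combination -ht)
    · rintro rfl
      exact u_injective hπ hε (by rw [← ht, u_zero]; ring)
  by_cases hmn : m = n <;> simp [hmn, h5]

/-- The bijection `(k, n) ↦ (n, -k)` of the index set. -/
def cellPerm (hπ : IsPrimeElement π) (hε : IsResidueBasis p c ε) : ℕ × ℕ ≃ ℕ × ℕ where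
  toFun i := (i.2, negIndex π hε i.1)
  invFun i := (negIndex π hε i.2, i.1)
  left_inv i := by simp [negIndex_negIndex hπ hε]
  right_inv i := by simp [negIndex_negIndex hπ hε]

/-- The Fourier transform as a unitary operator of `L²(K)`. -/
def plancherel (hμ : μ (closedBall 0 1) = 1) (hπ : IsPrimeElement π)
    (hε : IsResidueBasis p c ε) (hχ : IsBasicCharacter π ε χ) : Lp ℂ 2 μ ≃ₗᵢ[ℂ] Lp ℂ 2 μ :=
  unitaryOfBases (cellBasis hμ hπ hε hχ) (cellBasis hμ hπ hε hχ) (cellPerm hπ hε)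

theorem plancherel_cell (hμ : μ (closedBall 0 1) = 1) (hπ : IsPrimeElement π)
    (hε : IsResidueBasis p c ε) (hχ : IsBasicCharacter π ε χ) (k n : ℕ) :
    plancherel hμ hπ hε hχ (cell (p := p) μ hχ k n)
      = cell (p := p) μ hχ n (negIndex π hε k) := by
  rw [← cellBasis_apply hμ hπ hε hχ, plancherel, unitaryOfBases_apply, ← cellBasis_apply hμ hπ hε hχ]
  rfl

theorem integral_fourierIntegral_mul_eq (hχ : IsBasicCharacter π ε χ) {f g : K → ℂ}
    (hf : Integrable f μ) (hg : Integrable g μ) :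
    ∫ ξ, Fourier.fourierIntegral χ μ f ξ * g ξ ∂μ
      = ∫ x, f x * Fourier.fourierIntegral χ μ g x ∂μ := by
  have h := VectorFourier.integral_fourierIntegral_smul_eq_flip (μ := μ) (ν := μ)
    (L := LinearMap.mul K K) (f := f) (g := g) hχ.continuous
    (by simpa using continuous_mul) hf hg
  have h2 : (LinearMap.mul K K).flip = LinearMap.mul K K := by
    ext; simp
  rw [h2] at h
  exact h

/-- Both sides have the same coordinates in the cell basis: the multiplication formula moves the
Fourier integral from $f$ onto a cell, where it is known explicitly. -/
theorem eq_plancherel_of_integrable (hμ : μ (closedBall 0 1) = 1) (hπ : IsPrimeElement π)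
    (hε : IsResidueBasis p c ε) (hχ : IsBasicCharacter π ε χ) {f g : Lp ℂ 2 μ}
    (hf : Integrable f μ) (hg : g =ᵐ[μ] Fourier.fourierIntegral χ μ f) :
    g = plancherel hμ hπ hε hχ f := by
  refine eq_of_forall_inner_hilbertBasis_eq (cellBasis hμ hπ hε hχ) ?_
  rintro ⟨a, b⟩
  rw [cellBasis_apply]
  have h1 : cell (p := p) μ hχ a b
      = plancherel hμ hπ hε hχ (cell μ hχ (negIndex π hε b) a) := by
    rw [plancherel_cell, negIndex_negIndex hπ hε]
  conv_rhs => rw [h1, LinearIsometryEquiv.inner_map_map, inner_cell]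
  rw [inner_cell]
  simp_rw [conj_cellFun hε]
  have h2 : ∫ x, cellFun p π ε χ a (negIndex π hε b) x * g x ∂μ
      = ∫ x, Fourier.fourierIntegral χ μ f x * cellFun p π ε χ a (negIndex π hε b) x ∂μ := by
    refine integral_congr_ae ?_
    filter_upwards [hg] with x hx
    rw [hx, mul_comm]
  rw [h2, integral_fourierIntegral_mul_eq hχ hf (integrable_cellFun hχ _ _)]
  simp_rw [fourierIntegral_cellFun hμ hπ hε hχ, mul_comm (f _)]

/-- The graph of the unitary operator is closed and contains all pairs coming from $L^1\cap L^2$.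
Conversely, finite combinations of cells are integrable and dense. This existence and uniqueness is
what determines the choice made in `fourier`. -/
theorem isFourierTransform_iff (hμ : μ (closedBall 0 1) = 1) (hπ : IsPrimeElement π)
    (hε : IsResidueBasis p c ε) (hχ : IsBasicCharacter π ε χ) (f g : Lp ℂ 2 μ) :
    IsFourierTransform χ f g ↔ g = plancherel hμ hπ hε hχ f := by
  constructor
  · intro h
    have hc : IsClosed {P : Lp ℂ 2 μ × Lp ℂ 2 μ | P.2 = plancherel hμ hπ hε hχ P.1} :=
      isClosed_eq continuous_snd ((plancherel hμ hπ hε hχ).continuous.comp continuous_fst)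
    exact closure_minimal (fun P hP => eq_plancherel_of_integrable hμ hπ hε hχ hP.1 hP.2) hc h
  · rintro rfl
    have hd : f ∈ closure (Submodule.span ℂ (Set.range (cellBasis hμ hπ hε hχ)) :
        Set (Lp ℂ 2 μ)) := by
      rw [← Submodule.topologicalClosure_coe, (cellBasis hμ hπ hε hχ).dense_span]
      trivial
    refine map_mem_closure (f := fun f => (f, plancherel hμ hπ hε hχ f))
      (continuous_id.prodMk (plancherel hμ hπ hε hχ).continuous) hd ?_
    intro F hF
    dsimp only
    rw [Set.mem_ofPred_eq]
    induction hF using Submodule.span_induction with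
    | mem x hx =>
      obtain ⟨⟨k, n⟩, rfl⟩ := hx
      rw [cellBasis_apply, plancherel_cell]
      have h1 := coeFn_cell (p := p) (μ := μ) hχ k n
      refine ⟨(integrable_congr h1).2 (integrable_cellFun hχ k n), ?_⟩
      have h2 : Fourier.fourierIntegral χ μ (cell (p := p) μ hχ k n)
          = Fourier.fourierIntegral χ μ (cellFun p π ε χ k n) :=
        VectorFourier.fourierIntegral_congr_ae χ μ _ h1
      dsimp only
      rw [h2]
      filter_upwards [coeFn_cell (p := p) (μ := μ) hχ n (negIndex π hε k)] with x hx
      rw [hx, fourierIntegral_cellFun hμ hπ hε hχ]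
    | zero =>
      simp only [map_zero]
      have h0 := Lp.coeFn_zero ℂ 2 μ
      refine ⟨(integrable_congr h0).2 (integrable_zero _ _ _), ?_⟩
      have h2 : Fourier.fourierIntegral χ μ (0 : Lp ℂ 2 μ)
          = Fourier.fourierIntegral χ μ (0 : K → ℂ) :=
        VectorFourier.fourierIntegral_congr_ae χ μ _ h0
      rw [h2]
      filter_upwards [h0] with x hx
      rw [hx, Fourier.fourierIntegral_def]
      simp
    | add x y _ _ hx hy =>
      rw [map_add]
      have h0 := Lp.coeFn_add x y
      refine ⟨(integrable_congr h0).2 (hx.1.add hy.1), ?_⟩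
      have h2 : Fourier.fourierIntegral χ μ (x + y : Lp ℂ 2 μ)
          = Fourier.fourierIntegral χ μ (x + y : K → ℂ) :=
        VectorFourier.fourierIntegral_congr_ae χ μ _ h0
      have h3 : Fourier.fourierIntegral χ μ (x + y : K → ℂ)
          = Fourier.fourierIntegral χ μ x + Fourier.fourierIntegral χ μ y :=
        VectorFourier.fourierIntegral_add hχ.continuous (by simpa using continuous_mul) hx.1 hy.1
      dsimp only
      rw [h2, h3]
      filter_upwards [Lp.coeFn_add (plancherel hμ hπ hε hχ x) (plancherel hμ hπ hε hχ y),
        hx.2, hy.2] with t h4 h5 h6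
      rw [h4, Pi.add_apply, Pi.add_apply, h5, h6]
    | smul a x _ hx =>
      rw [map_smul]
      have h0 := Lp.coeFn_smul a x
      refine ⟨(integrable_congr h0).2 (hx.1.smul a), ?_⟩
      have h2 : Fourier.fourierIntegral χ μ (a • x : Lp ℂ 2 μ)
          = Fourier.fourierIntegral χ μ (a • x : K → ℂ) :=
        VectorFourier.fourierIntegral_congr_ae χ μ _ h0
      have h3 : Fourier.fourierIntegral χ μ (a • x : K → ℂ)
          = a • Fourier.fourierIntegral χ μ x :=
        VectorFourier.fourierIntegral_const_smul χ μ _ _ a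
      dsimp only
      rw [h2, h3]
      filter_upwards [Lp.coeFn_smul a (plancherel hμ hπ hε hχ x), hx.2] with t h4 h5
      rw [h4, Pi.smul_apply, Pi.smul_apply, h5]

theorem fourier_eq_plancherel (hμ : μ (closedBall 0 1) = 1) (hπ : IsPrimeElement π)
    (hε : IsResidueBasis p c ε) (hχ : IsBasicCharacter π ε χ) (f : Lp ℂ 2 μ) :
    fourier χ f = plancherel hμ hπ hε hχ f :=
  (isFourierTransform_iff hμ hπ hε hχ f _).1 (Classical.epsilon_spec
    (p := fun g => IsFourierTransform χ f g)
    ⟨_, (isFourierTransform_iff hμ hπ hε hχ f _).2 rfl⟩)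

theorem isFourierTransform_fourier (hμ : μ (closedBall 0 1) = 1) (hπ : IsPrimeElement π)
    (hε : IsResidueBasis p c ε) (hχ : IsBasicCharacter π ε χ) (f : Lp ℂ 2 μ) :
    IsFourierTransform χ f (fourier χ f) :=
  (isFourierTransform_iff hμ hπ hε hχ f _).2 (fourier_eq_plancherel hμ hπ hε hχ f)

end Plancherel

/-! ### Translations, dilations and modulations as isometries, and their commutation rules. -/

section Operators

theorem enorm_sq_eq_lintegral {α : Type*} [MeasurableSpace α] {μ : Measure α} (f : Lp ℂ 2 μ) :
    ‖f‖ₑ ^ 2 = ∫⁻ x, ‖f x‖ₑ ^ 2 ∂μ := by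
  have h := eLpNorm_nnreal_pow_eq_lintegral (f := f) (p := 2) (μ := μ) (by norm_num)
  rw [Lp.enorm_def]
  simpa using h

/-- An isometry of `L²` given by a weighted composition. -/
def weightedComp {α : Type*} [MeasurableSpace α] {μ : Measure α} (A : Lp ℂ 2 μ → Lp ℂ 2 μ)
    (w : α → ℂ) (τ : α → α) (hτ : Measure.QuasiMeasurePreserving τ μ μ)
    (hA : ∀ f : Lp ℂ 2 μ, A f =ᵐ[μ] fun x => w x * f (τ x))
    (hw : ∀ h : α → ℝ≥0∞, ∫⁻ x, ‖w x‖ₑ ^ 2 * h (τ x) ∂μ = ∫⁻ x, h x ∂μ) :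
    Lp ℂ 2 μ →ₗᵢ[ℂ] Lp ℂ 2 μ where
  toFun := A
  map_add' f g := by
    refine Lp.ext ?_
    filter_upwards [hA (f + g), Lp.coeFn_add (A f) (A g), hA f, hA g,
      hτ.ae (Lp.coeFn_add f g)] with x h1 h2 h3 h4 h5
    rw [h1, h2, Pi.add_apply, h3, h4, h5, Pi.add_apply, mul_add]
  map_smul' a f := by
    refine Lp.ext ?_
    filter_upwards [hA (a • f), Lp.coeFn_smul a (A f), hA f,
      hτ.ae (Lp.coeFn_smul a f)] with x h1 h2 h3 h5
    rw [h1, RingHom.id_apply, h2, Pi.smul_apply, h3, h5, Pi.smul_apply, smul_eq_mul, smul_eq_mul]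
    ring
  norm_map' f := by
    have h : ‖A f‖ₑ ^ 2 = ‖f‖ₑ ^ 2 := by
      rw [enorm_sq_eq_lintegral, enorm_sq_eq_lintegral, ← hw fun x => ‖f x‖ₑ ^ 2]
      refine lintegral_congr_ae ?_
      filter_upwards [hA f] with x hx
      rw [hx, enorm_mul, mul_pow]
    have h1 := congrArg ENNReal.toReal h
    simp only [ENNReal.toReal_pow, toReal_enorm] at h1
    exact (pow_left_inj₀ (norm_nonneg _) (norm_nonneg _) two_ne_zero).1 h1

theorem ofReal_rpow_half_sq (q : ℕ) (hq : 0 < q) (j : ℤ) :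
    ‖(((q : ℝ) ^ ((j : ℝ) / 2) : ℝ) : ℂ)‖ₑ ^ 2 = (q : ℝ≥0∞) ^ j := by
  have hq' : (0 : ℝ) < q := by exact_mod_cast hq
  rw [← ofReal_norm, Complex.norm_real, Real.norm_of_nonneg (by positivity),
    ← ENNReal.ofReal_pow (by positivity), ← Real.rpow_natCast, ← Real.rpow_mul hq'.le]
  have : (j : ℝ) / 2 * (2 : ℕ) = j := by push_cast; ring
  rw [this, Real.rpow_intCast]
  obtain ⟨n, rfl | rfl⟩ := j.eq_nat_or_neg
  · rw [zpow_natCast, zpow_natCast, ENNReal.ofReal_pow hq'.le, ENNReal.ofReal_natCast]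
  · rw [zpow_neg, ENNReal.zpow_neg, zpow_natCast, zpow_natCast, ENNReal.ofReal_inv_of_pos (by positivity),
      ENNReal.ofReal_pow hq'.le, ENNReal.ofReal_natCast]

variable {K : Type*} [NontriviallyNormedField K]

attribute [local instance] properSpace_of_locallyCompact

variable [IsUltrametricDist K] {p c : ℕ} [Fact p.Prime] [CharP K p] [NeZero c] {π : K}
  {ε : Fin c → K} {χ : AddChar K Circle}
  [LocallyCompactSpace K] [MeasurableSpace K] [BorelSpace K] {μ : Measure K}
  [μ.IsAddHaarMeasure]

theorem coeFn_translate (a : K) (f : Lp ℂ 2 μ) :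
    translate a f =ᵐ[μ] fun x => f (x - a) :=
  Lp.coeFn_compMeasurePreserving f (measurePreserving_sub_right μ a)

theorem coeFn_dilate (q : ℕ) (hπ : IsPrimeElement π) (j : ℤ) (f : Lp ℂ 2 μ) :
    dilate q hπ j f =ᵐ[μ]
      fun x => (((q : ℝ) ^ ((j : ℝ) / 2) : ℝ) : ℂ) * f (π ^ (-j) * x) :=
  MemLp.coeFn_toLp _

/-- Translation as a linear isometry. -/
def translateₗᵢ (μ : Measure K) [μ.IsAddHaarMeasure] (a : K) : Lp ℂ 2 μ →ₗᵢ[ℂ] Lp ℂ 2 μ :=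
  weightedComp (translate a) (fun _ => 1) (fun x => x - a)
    (measurePreserving_sub_right μ a).quasiMeasurePreserving
    (fun f => by simpa using coeFn_translate a f)
    (fun h => by simpa using lintegral_sub_right_eq_self h a)

/-- Dilation as a linear isometry. -/
def dilateₗᵢ (hμ : μ (closedBall 0 1) = 1) (hπ : IsPrimeElement π) (hε : IsResidueBasis p c ε)
    (j : ℤ) : Lp ℂ 2 μ →ₗᵢ[ℂ] Lp ℂ 2 μ :=
  weightedComp (dilate (p ^ c) hπ j) (fun _ => ((((p ^ c : ℕ) : ℝ) ^ ((j : ℝ) / 2) : ℝ) : ℂ))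
    (fun x => π ^ (-j) * x) (quasiMeasurePreserving_zpow_mul hμ hπ hε (-j))
    (fun f => coeFn_dilate _ hπ j f) (fun h => by
      rw [ofReal_rpow_half_sq _ (residueCard_pos p c), lintegral_const_mul',
        lintegral_comp_zpow_mul hμ hπ hε (-j) h, ← mul_assoc,
        ← ENNReal.zpow_add (residueCard_ne_zero p c) (ENNReal.natCast_ne_top _)]
      · simp
      · exact (ENNReal.zpow_lt_top (residueCard_ne_zero p c) (ENNReal.natCast_ne_top _) _).ne)

theorem memLp_modulate (hχ : IsBasicCharacter π ε χ) (a : K) (f : Lp ℂ 2 μ) :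
    MemLp (fun x => (χ (-(a * x)) : ℂ) * f x) 2 μ := by
  refine (Lp.memLp f).of_le ?_ (Filter.Eventually.of_forall fun x => ?_)
  · have := continuous_character_mul hχ (-a)
    simp_rw [neg_mul] at this
    exact this.aestronglyMeasurable.mul (Lp.aestronglyMeasurable f)
  · rw [norm_mul, Circle.norm_coe, one_mul]

/-- Multiplication by `χ(-a ·)`. -/
def modulate (hχ : IsBasicCharacter π ε χ) (a : K) (f : Lp ℂ 2 μ) : Lp ℂ 2 μ :=
  (memLp_modulate hχ a f).toLp _

theorem coeFn_modulate (hχ : IsBasicCharacter π ε χ) (a : K) (f : Lp ℂ 2 μ) :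
    modulate hχ a f =ᵐ[μ] fun x => (χ (-(a * x)) : ℂ) * f x := MemLp.coeFn_toLp _

/-- Modulation as a linear isometry. -/
def modulateₗᵢ (μ : Measure K) [μ.IsAddHaarMeasure] (hχ : IsBasicCharacter π ε χ) (a : K) :
    Lp ℂ 2 μ →ₗᵢ[ℂ] Lp ℂ 2 μ :=
  weightedComp (modulate hχ a) (fun x => (χ (-(a * x)) : ℂ)) id
    (Measure.QuasiMeasurePreserving.id μ) (fun f => coeFn_modulate hχ a f) (fun h => by
      have : ∀ x, ‖(χ (-(a * x)) : ℂ)‖ₑ = 1 := fun x => by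
        rw [← ofReal_norm, Circle.norm_coe, ENNReal.ofReal_one]
      simp [this])

theorem fourierIntegral_translate (χ : AddChar K Circle) (a : K) (f : Lp ℂ 2 μ) (ξ : K) :
    Fourier.fourierIntegral χ μ (translate a f) ξ
      = (χ (-(a * ξ)) : ℂ) * Fourier.fourierIntegral χ μ f ξ := by
  have h : Fourier.fourierIntegral χ μ (translate a f)
      = Fourier.fourierIntegral χ μ (fun x => f (x - a)) :=
    VectorFourier.fourierIntegral_congr_ae χ μ _ (coeFn_translate a f)
  rw [h, Fourier.fourierIntegral_def, Fourier.fourierIntegral_def, ← integral_const_mul,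
    ← integral_add_right_eq_self _ a]
  refine integral_congr_ae (Filter.Eventually.of_forall fun x => ?_)
  dsimp only
  rw [add_sub_cancel_right, Circle.smul_def, Circle.smul_def, smul_eq_mul, smul_eq_mul, ← mul_assoc,
    ← Circle.coe_mul, ← AddChar.map_add_eq_mul]
  congr 4
  ring

theorem rpow_half_mul_zpow {q : ℕ} (hq : 0 < q) (j : ℤ) :
    (((q : ℝ) ^ ((j : ℝ) / 2) : ℝ) : ℂ) * (q : ℂ) ^ (-j)
      = (((q : ℝ) ^ (((-j : ℤ) : ℝ) / 2) : ℝ) : ℂ) := by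
  have hq' : (0 : ℝ) < q := by exact_mod_cast hq
  have : (q : ℂ) ^ (-j) = (((q : ℝ) ^ (((-j : ℤ) : ℝ)) : ℝ) : ℂ) := by
    rw [Real.rpow_intCast]; push_cast; rfl
  rw [this, ← Complex.ofReal_mul, ← Real.rpow_add hq']
  congr 2
  push_cast
  ring

theorem fourierIntegral_dilate (hμ : μ (closedBall 0 1) = 1) (hπ : IsPrimeElement π)
    (hε : IsResidueBasis p c ε) (j : ℤ) (f : Lp ℂ 2 μ) (ξ : K) :
    Fourier.fourierIntegral χ μ (dilate (p ^ c) hπ j f) ξ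
      = ((((p ^ c : ℕ) : ℝ) ^ (((-j : ℤ) : ℝ) / 2) : ℝ) : ℂ) *
        Fourier.fourierIntegral χ μ f (π ^ j * ξ) := by
  have h : Fourier.fourierIntegral χ μ (dilate (p ^ c) hπ j f) = Fourier.fourierIntegral χ μ _ :=
    VectorFourier.fourierIntegral_congr_ae χ μ _ (coeFn_dilate _ hπ j f)
  rw [h, Fourier.fourierIntegral_def, Fourier.fourierIntegral_def,
    ← rpow_half_mul_zpow (residueCard_pos p c), mul_assoc, ← integral_comp_zpow_mul hμ hπ hε,
    ← integral_const_mul]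
  refine integral_congr_ae (Filter.Eventually.of_forall fun x => ?_)
  dsimp only
  have h0 : π ^ (-j) * x * (π ^ j * ξ) = x * ξ := by
    have := zpow_ne_zero j hπ.ne_zero
    rw [zpow_neg]; field_simp
  rw [h0, Circle.smul_def, Circle.smul_def, smul_eq_mul, smul_eq_mul]
  ring

variable (hμ : μ (closedBall 0 1) = 1) (hπ : IsPrimeElement π)
    (hε : IsResidueBasis p c ε) (hχ : IsBasicCharacter π ε χ)

include hμ hπ hε hχ in
/-- The Fourier transform converts translations into modulations. -/
theorem fourier_translate (a : K) (f : Lp ℂ 2 μ) :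
    fourier χ (translate a f) = modulate hχ a (fourier χ f) := by
  refine (fourier_eq_plancherel hμ hπ hε hχ _).trans
    ((isFourierTransform_iff hμ hπ hε hχ _ _).1 ?_).symm
  -- A continuous map of pairs that preserves the $L^1\cap L^2$ part of the graph preserves its
  -- closure, so the identity is checked on Fourier integrals only.
  refine map_mem_closure (f := fun P : Lp ℂ 2 μ × Lp ℂ 2 μ => (translate a P.1, modulate hχ a P.2))
    (((translateₗᵢ μ a).continuous.comp continuous_fst).prodMk
      ((modulateₗᵢ μ hχ a).continuous.comp continuous_snd))
    (isFourierTransform_fourier hμ hπ hε hχ f) ?_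
  rintro ⟨F, G⟩ ⟨hF, hG⟩
  refine ⟨(integrable_congr (coeFn_translate a F)).2 (hF.comp_sub_right a), ?_⟩
  filter_upwards [coeFn_modulate hχ a G, hG] with x h1 h2
  rw [h1, h2, fourierIntegral_translate]

include hμ hπ hε hχ in
/-- The Fourier transform converts dilations into inverse dilations. -/
theorem fourier_dilate (j : ℤ) (f : Lp ℂ 2 μ) :
    fourier χ (dilate (p ^ c) hπ j f) = dilate (p ^ c) hπ (-j) (fourier χ f) := by
  refine (fourier_eq_plancherel hμ hπ hε hχ _).trans
    ((isFourierTransform_iff hμ hπ hε hχ _ _).1 ?_).symm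
  refine map_mem_closure (f := fun P : Lp ℂ 2 μ × Lp ℂ 2 μ =>
      (dilate (p ^ c) hπ j P.1, dilate (p ^ c) hπ (-j) P.2))
    (((dilateₗᵢ hμ hπ hε j).continuous.comp continuous_fst).prodMk
      ((dilateₗᵢ hμ hπ hε (-j)).continuous.comp continuous_snd))
    (isFourierTransform_fourier hμ hπ hε hχ f) ?_
  rintro ⟨F, G⟩ ⟨hF, hG⟩
  constructor
  · refine (integrable_congr (coeFn_dilate (p ^ c) hπ j F)).2 (Integrable.const_mul ?_ _)
    refine Integrable.comp_measurable (g := F) (f := fun x => π ^ (-j) * x) ?_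
      (measurable_const_mul _)
    rw [map_mul_zpow hμ hπ hε]
    exact hF.smul_measure
      (ENNReal.zpow_lt_top (residueCard_ne_zero p c) (ENNReal.natCast_ne_top _) _).ne
  · filter_upwards [coeFn_dilate (p ^ c) hπ (-j) G,
      (quasiMeasurePreserving_zpow_mul hμ hπ hε j).ae hG] with x h1 h2
    rw [h1, neg_neg, h2, fourierIntegral_dilate hμ hπ hε]

include hμ hπ hε hχ in
theorem inner_fourier_fourier (f g : Lp ℂ 2 μ) :
    inner ℂ (fourier χ f) (fourier χ g) = inner ℂ f g := by
  rw [fourier_eq_plancherel hμ hπ hε hχ, fourier_eq_plancherel hμ hπ hε hχ,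
    LinearIsometryEquiv.inner_map_map]

include hμ hπ hε in
theorem dilate_dilate_neg (j : ℤ) (f : Lp ℂ 2 μ) :
    dilate (p ^ c) hπ j (dilate (p ^ c) hπ (-j) f) = f := by
  refine Lp.ext ?_
  filter_upwards [coeFn_dilate (p ^ c) hπ j (dilate (p ^ c) hπ (-j) f),
    (quasiMeasurePreserving_zpow_mul hμ hπ hε (-j)).ae (coeFn_dilate (p ^ c) hπ (-j) f)] with x h1 h2
  have hq : (0 : ℝ) < ((p ^ c : ℕ) : ℝ) := by exact_mod_cast residueCard_pos p c
  rw [h1, h2, neg_neg, ← mul_assoc, ← mul_assoc, ← Complex.ofReal_mul, ← Real.rpow_add hq,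
    ← zpow_add₀ hπ.ne_zero]
  have : (j : ℝ) / 2 + ((-j : ℤ) : ℝ) / 2 = 0 := by push_cast; ring
  rw [this, add_neg_cancel]
  simp

include hμ hπ hε in
theorem inner_dilate_left (j : ℤ) (f g : Lp ℂ 2 μ) :
    inner ℂ (dilate (p ^ c) hπ j f) g = inner ℂ f (dilate (p ^ c) hπ (-j) g) := by
  conv_lhs => rw [← dilate_dilate_neg hμ hπ hε j g]
  exact (dilateₗᵢ hμ hπ hε j).inner_map_map _ _

theorem translate_translate (a b : K) (f : Lp ℂ 2 μ) :
    translate a (translate b f) = translate (a + b) f := by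
  refine Lp.ext ?_
  filter_upwards [coeFn_translate a (translate b f), coeFn_translate (a + b) f,
    (measurePreserving_sub_right μ a).quasiMeasurePreserving.ae (coeFn_translate b f)]
    with x h1 h2 h3
  rw [h1, h2, h3, sub_sub]

include hμ hε in
theorem translate_dilate (a : K) (j : ℤ) (f : Lp ℂ 2 μ) :
    translate a (dilate (p ^ c) hπ j f) = dilate (p ^ c) hπ j (translate (π ^ (-j) * a) f) := by
  refine Lp.ext ?_
  filter_upwards [coeFn_translate a (dilate (p ^ c) hπ j f),
    (measurePreserving_sub_right μ a).quasiMeasurePreserving.ae (coeFn_dilate (p ^ c) hπ j f),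
    coeFn_dilate (p ^ c) hπ j (translate (π ^ (-j) * a) f),
    (quasiMeasurePreserving_zpow_mul hμ hπ hε (-j)).ae (coeFn_translate (π ^ (-j) * a) f)]
    with x h1 h2 h3 h4
  rw [h1, h2, h3, h4, mul_sub]

include hμ hε in
/-- Translating a member of the affine system at a nonnegative scale. -/
theorem translate_affine (f : Lp ℂ 2 μ) (m j : ℕ) {d : ℕ} (hd : d < (p ^ c) ^ j) :
    translate (u p π ε m) (affine p hπ ε f j d) = affine p hπ ε f j (m * (p ^ c) ^ j + d) := by
  rw [affine, translate_dilate hμ hπ hε, translate_translate, affine, u_mul_pow_add hd]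
  congr 3
  rw [zpow_neg, zpow_natCast, inv_pow, mul_comm]

include hμ hπ hε hχ in
theorem coeFn_fourier_affine (f : Lp ℂ 2 μ) (j : ℤ) (k : ℕ) :
    fourier χ (affine p hπ ε f j k) =ᵐ[μ] fun ξ =>
      ((((p ^ c : ℕ) : ℝ) ^ (((-j : ℤ) : ℝ) / 2) : ℝ) : ℂ) *
        ((χ (-(u p π ε k * (π ^ j * ξ))) : ℂ) * fourier χ f (π ^ j * ξ)) := by
  rw [affine, fourier_dilate hμ hπ hε hχ, fourier_translate hμ hπ hε hχ]
  filter_upwards [coeFn_dilate (p ^ c) hπ (-j) (modulate hχ (u p π ε k) (fourier χ f)),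
    (quasiMeasurePreserving_zpow_mul hμ hπ hε j).ae (coeFn_modulate hχ (u p π ε k) (fourier χ f))]
    with x h1 h2
  rw [h1, neg_neg, h2]

end Operators

/-! ### Fibers of $L^2$ functions over $\mathcal O$. -/

section Fibers

theorem tsum_enorm_sq_eq (v : Ell2) : ∑' k, ‖v k‖ₑ ^ 2 = ‖v‖ₑ ^ 2 := by
  have h := lp.norm_rpow_eq_tsum (p := 2) (by norm_num) v
  have hs : Summable fun k => ‖v k‖ ^ 2 := by
    have := (lp.memℓp v).summable (by norm_num)
    simpa using this
  simp only [ENNReal.toReal_ofNat, Real.rpow_ofNat] at h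
  rw [← ofReal_norm, ← ENNReal.ofReal_pow (norm_nonneg _), h,
    ENNReal.ofReal_tsum_of_nonneg (fun k => by positivity) hs]
  exact tsum_congr fun k => by rw [← ofReal_norm, ENNReal.ofReal_pow (norm_nonneg _)]

theorem memℓp_two_of_tsum_ne_top {v : ℕ → ℂ} (h : ∑' k, ‖v k‖ₑ ^ 2 ≠ ⊤) :
    Memℓp (E := fun _ : ℕ => ℂ) v 2 := by
  refine memℓp_gen ?_
  have := ENNReal.summable_toReal h
  simpa using this

theorem aemeasurable_of_hasSum {α ι : Type*} [MeasurableSpace α] {μ : Measure α} [Countable ι]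
    {f : ι → α → ℂ} {g : α → ℂ} (hf : ∀ i, AEMeasurable (f i) μ)
    (h : ∀ᵐ x ∂μ, HasSum (fun i => f i x) (g x)) : AEMeasurable g μ :=
  aemeasurable_of_tendsto_metrizable_ae (f := fun (s : Finset ι) x => ∑ i ∈ s, f i x) Filter.atTop
    (fun s => Finset.aemeasurable_fun_sum s fun i _ => hf i) h

open Classical in
/-- The sequence `(F(ξ + u(k)))ₖ`, as an element of `ℓ²` (zero if it is not square summable). -/
def fiber (p : ℕ) {c : ℕ} {K : Type*} [NontriviallyNormedField K] (π : K) (ε : Fin c → K)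
    (F : K → ℂ) (ξ : K) : Ell2 :=
  if h : Memℓp (E := fun _ : ℕ => ℂ) (fun k => F (ξ + u p π ε k)) 2 then ⟨_, h⟩ else 0

variable {K : Type*} [NontriviallyNormedField K]

attribute [local instance] properSpace_of_locallyCompact

variable [IsUltrametricDist K] {p c : ℕ} [Fact p.Prime] [CharP K p] [NeZero c] {π : K}
  {ε : Fin c → K} {χ : AddChar K Circle}
  [LocallyCompactSpace K] [MeasurableSpace K] [BorelSpace K] {μ : Measure K}
  [μ.IsAddHaarMeasure]

variable (hμ : μ (closedBall 0 1) = 1) (hπ : IsPrimeElement π)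
    (hε : IsResidueBasis p c ε) (hχ : IsBasicCharacter π ε χ)

include hπ hε in
theorem aemeasurable_comp_add_u {β : Type*} [MeasurableSpace β] {f : K → β} (n : ℕ)
    (hf : AEMeasurable f μ) :
    AEMeasurable (fun x => f (x + u p π ε n)) (μ.restrict (closedBall 0 1)) :=
  (hf.comp_quasiMeasurePreserving
    (measurePreserving_add_right μ (u p π ε n)).quasiMeasurePreserving).restrict

include hπ hε in
/-- Integration over `K` by summing over the fibers `ξ + u(n)`. -/
theorem lintegral_eq_setLIntegral_tsum {f : K → ℝ≥0∞} (hf : AEMeasurable f μ) :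
    ∫⁻ x, f x ∂μ = ∫⁻ x in closedBall 0 1, ∑' n, f (x + u p π ε n) ∂μ := by
  rw [lintegral_tsum fun n => aemeasurable_comp_add_u hπ hε n hf,
    lintegral_eq_tsum_lintegral_add_u hπ hε]

include hπ hε in
theorem ae_tsum_ne_top {f : K → ℝ≥0∞} (hf : AEMeasurable f μ) (h : ∫⁻ x, f x ∂μ ≠ ⊤) :
    ∀ᵐ x ∂μ.restrict (closedBall 0 1), ∑' n, f (x + u p π ε n) ≠ ⊤ := by
  rw [lintegral_eq_setLIntegral_tsum hπ hε hf] at h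
  filter_upwards [ae_lt_top' (AEMeasurable.tsum fun n =>
    aemeasurable_comp_add_u hπ hε n hf) h] with x hx using hx.ne

include hπ hε in
theorem ae_summable_add_u {f : K → ℂ} (hf : Integrable f μ) :
    ∀ᵐ x ∂μ.restrict (closedBall 0 1), Summable fun n => f (x + u p π ε n) := by
  filter_upwards [ae_tsum_ne_top hπ hε hf.1.enorm hf.2.ne] with x hx
  refine Summable.of_norm ?_
  have := ENNReal.summable_toReal hx
  simpa using this

include hπ hε in
theorem integrableOn_tsum_add_u {f : K → ℂ} (hf : Integrable f μ) :
    IntegrableOn (fun x => ∑' n, f (x + u p π ε n)) (closedBall 0 1) μ := by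
  constructor
  · refine AEMeasurable.aestronglyMeasurable (aemeasurable_of_hasSum
      (fun n => aemeasurable_comp_add_u hπ hε n hf.1.aemeasurable) ?_)
    filter_upwards [ae_summable_add_u hπ hε hf] with x hx using hx.hasSum
  · refine lt_of_le_of_lt ?_ hf.2
    rw [lintegral_eq_setLIntegral_tsum hπ hε hf.1.enorm]
    exact lintegral_mono fun x => enorm_tsum_le_tsum_enorm

include hπ hε in
theorem setIntegral_tsum_add_u {f : K → ℂ} (hf : Integrable f μ) :
    ∫ x in closedBall 0 1, ∑' n, f (x + u p π ε n) ∂μ = ∫ x, f x ∂μ := by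
  rw [integral_tsum (fun n =>
    (aemeasurable_comp_add_u hπ hε n hf.1.aemeasurable).aestronglyMeasurable)]
  · exact (hasSum_integral_add_u hπ hε hf).tsum_eq
  · rw [← lintegral_eq_tsum_lintegral_add_u hπ hε (fun x => ‖f x‖ₑ)]
    exact hf.2.ne

include hπ hε in
theorem ae_fiber_apply (F : Lp ℂ 2 μ) :
    ∀ᵐ ξ ∂μ.restrict (closedBall 0 1), ∀ k, fiber p π ε F ξ k = F (ξ + u p π ε k) := by
  have hF : AEMeasurable (fun x => ‖F x‖ₑ ^ 2) μ := (Lp.aestronglyMeasurable F).enorm.pow_const 2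
  filter_upwards [ae_tsum_ne_top hπ hε hF (by
    rw [← enorm_sq_eq_lintegral]; exact ENNReal.pow_ne_top enorm_ne_top)] with ξ hξ k
  rw [fiber, dif_pos (memℓp_two_of_tsum_ne_top hξ)]

include hπ hε in
theorem ae_inner_fiber_eq (F G : Lp ℂ 2 μ) :
    ∀ᵐ ξ ∂μ.restrict (closedBall 0 1), inner ℂ (fiber p π ε G ξ) (fiber p π ε F ξ)
      = ∑' n, inner ℂ (G (ξ + u p π ε n)) (F (ξ + u p π ε n)) := by
  filter_upwards [ae_fiber_apply hπ hε F, ae_fiber_apply hπ hε G] with ξ h1 h2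
  rw [lp.inner_eq_tsum]
  simp_rw [h1, h2]

include hπ hε in
theorem integrableOn_inner_fiber (F G : Lp ℂ 2 μ) :
    IntegrableOn (fun ξ => inner ℂ (fiber p π ε G ξ) (fiber p π ε F ξ)) (closedBall 0 1) μ :=
  (integrable_congr (ae_inner_fiber_eq hπ hε F G)).2
    (integrableOn_tsum_add_u hπ hε (L2.integrable_inner (𝕜 := ℂ) G F))

include hμ hπ hε hχ in
/-- The Fourier coefficients of the inner product of two fibers. -/
theorem setIntegral_inner_fiber (f g : Lp ℂ 2 μ) (k : ℕ) :
    ∫ ξ in closedBall 0 1, (χ (u p π ε k * ξ) : ℂ) *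
      inner ℂ (fiber p π ε (fourier χ g) ξ) (fiber p π ε (fourier χ f) ξ) ∂μ
      = inner ℂ (translate (u p π ε k) g) f := by
  rw [← inner_fourier_fourier hμ hπ hε hχ, fourier_translate hμ hπ hε hχ, L2.inner_def]
  have h1 : ∫ x, inner ℂ (modulate hχ (u p π ε k) (fourier χ g) x) (fourier χ f x) ∂μ
      = ∫ x, (χ (u p π ε k * x) : ℂ) * inner ℂ (fourier χ g x) (fourier χ f x) ∂μ := by
    refine integral_congr_ae ?_
    filter_upwards [coeFn_modulate hχ (u p π ε k) (fourier χ g)] with x hx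
    rw [hx, RCLike.inner_apply, RCLike.inner_apply, map_mul, ← Circle.coe_inv_eq_conj,
      AddChar.map_neg_eq_inv, inv_inv]
    ring
  rw [h1, ← setIntegral_tsum_add_u hπ hε
    (integrable_character_mul hχ _ (L2.integrable_inner (𝕜 := ℂ) (fourier χ g) (fourier χ f)))]
  refine integral_congr_ae ?_
  filter_upwards [ae_inner_fiber_eq hπ hε (fourier χ f) (fourier χ g)] with ξ hξ
  rw [hξ, ← tsum_mul_left]
  refine tsum_congr fun n => ?_
  rw [mul_add, AddChar.map_add_eq_mul, hχ.u_mul_u hε, mul_one]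

-- The fiber inner product minus the constant $a$ is integrable on $\mathcal O$ and all its Fourier
-- coefficients vanish.
include hμ hπ hε hχ in
theorem ae_inner_fiber_eq_const {f g : Lp ℂ 2 μ} {a : ℂ}
    (h : ∀ k, inner ℂ (translate (u p π ε k) g) f = if k = 0 then a else 0) :
    ∀ᵐ ξ ∂μ.restrict (closedBall 0 1),
      inner ℂ (fiber p π ε (fourier χ g) ξ) (fiber p π ε (fourier χ f) ξ) = a := by
  have : IsFiniteMeasure (μ.restrict (closedBall (0 : K) 1)) :=
    ⟨by simpa using measure_closedBall_lt_top⟩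
  have hi := integrableOn_inner_fiber hπ hε (fourier χ f) (fourier χ g)
  have hc : IntegrableOn (fun _ : K => a) (closedBall 0 1) μ := integrable_const a
  have h0 := ae_eq_zero_of_forall_coeff_eq_zero hπ hε hχ (hi.sub hc) (fun k => by
    simp only [Pi.sub_apply, mul_sub]
    rw [integral_sub (integrable_character_mul hχ _ hi) (integrable_character_mul hχ _ hc),
      setIntegral_inner_fiber hμ hπ hε hχ, h, integral_mul_const,
      setIntegral_character hμ hπ hε hχ]
    split_ifs <;> simp)
  filter_upwards [h0] with ξ hξ
  exact sub_eq_zero.1 hξ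

-- This turns a global orthogonality relation into a pointwise one in $\ell^2$, from which the range
-- function is read off.
include hμ hπ hε hχ in
theorem forall_inner_translate_eq_zero_iff (f g : Lp ℂ 2 μ) :
    (∀ k, inner ℂ (translate (u p π ε k) g) f = 0) ↔ ∀ᵐ ξ ∂μ.restrict (closedBall 0 1),
      inner ℂ (fiber p π ε (fourier χ g) ξ) (fiber p π ε (fourier χ f) ξ) = 0 := by
  constructor
  · intro h
    exact ae_inner_fiber_eq_const hμ hπ hε hχ fun k => by simp [h k]
  · intro h k
    rw [← setIntegral_inner_fiber hμ hπ hε hχ]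
    refine integral_eq_zero_of_ae ?_
    filter_upwards [h] with ξ hξ
    rw [hξ, mul_zero, Pi.zero_apply]

include hμ hπ hε hχ in
/-- A bounded measurable field of sequences is the fiber of a Fourier transform. -/
theorem exists_fourier_fiber_eq {W : K → Ell2}
    (hW : ∀ k, AEMeasurable (fun ξ => W ξ k) (μ.restrict (closedBall 0 1)))
    (hb : ∀ ξ, ‖W ξ‖ ≤ 1) :
    ∃ f : Lp ℂ 2 μ, ∀ᵐ ξ ∂μ.restrict (closedBall 0 1),
      ∀ k, fourier χ f (ξ + u p π ε k) = W ξ k := by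
  choose idx hidx using exists_norm_sub_u_le_one hπ hε
  have hidx' : ∀ ξ ∈ closedBall (0 : K) 1, ∀ k, idx (ξ + u p π ε k) = k := by
    intro ξ hξ k
    refine ((add_u_mem_closedBall_iff hπ hε hξ).1 ?_).symm
    rw [mem_closedBall, dist_eq_norm]
    exact hidx _
  -- On the coset $\mathcal O+u(k)$ the index `idx` equals $k$, so the $k$-th coordinates of the
  -- field are glued to one function on $K$.
  let h : K → ℂ := fun x => W (x - u p π ε (idx x)) (idx x)
  have hh : ∀ ξ ∈ closedBall (0 : K) 1, ∀ k, h (ξ + u p π ε k) = W ξ k := by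
    intro ξ hξ k
    simp only [h, hidx' ξ hξ, add_sub_cancel_right]
  have hmeas : AEMeasurable h μ := by
    rw [← Measure.restrict_univ (μ := μ), ← iUnion_closedBall_u hπ hε, aemeasurable_iUnion_iff]
    intro k
    have h1 := (measurePreserving_add_right μ (u p π ε k)).restrict_preimage_emb
      (measurableEmbedding_addRight (u p π ε k)) (closedBall (u p π ε k) 1)
    rw [preimage_add_right_closedBall] at h1
    rw [← h1.map_eq, (measurableEmbedding_addRight _).aemeasurable_map_iff]
    refine (hW k).congr ?_
    filter_upwards [ae_restrict_mem measurableSet_closedBall] with ξ hξ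
    exact (hh ξ hξ k).symm
  have hL2 : MemLp h 2 μ := by
    refine ⟨hmeas.aestronglyMeasurable, ?_⟩
    rw [eLpNorm_lt_top_iff_lintegral_rpow_enorm_lt_top (by norm_num) (by norm_num)]
    simp only [ENNReal.toReal_ofNat, ENNReal.rpow_ofNat]
    rw [lintegral_eq_setLIntegral_tsum hπ hε (hmeas.enorm.pow_const 2)]
    refine lt_of_le_of_lt (setLIntegral_mono measurable_const (g := fun _ => 1) ?_)
      (by simp [hμ])
    intro ξ hξ
    simp_rw [hh ξ hξ]
    rw [tsum_enorm_sq_eq]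
    refine pow_le_one₀ zero_le ?_
    rw [← ofReal_norm]
    exact ENNReal.ofReal_le_one.2 (hb ξ)
  refine ⟨(plancherel hμ hπ hε hχ).symm (hL2.toLp h), ?_⟩
  rw [fourier_eq_plancherel hμ hπ hε hχ, LinearIsometryEquiv.apply_symm_apply]
  filter_upwards [(ae_iff_ae_add_u hπ hε _).1 hL2.coeFn_toLp,
    ae_restrict_mem measurableSet_closedBall] with ξ h1 h2 k
  rw [h1 k, hh ξ h2]

end Fibers

/-! ### Orthonormal systems, projections and the trace formula in Hilbert space. -/

section Hilbert

variable {ι E : Type*} [NormedAddCommGroup E] [InnerProductSpace ℂ E] [CompleteSpace E]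

theorem mem_orthogonal_span_range_iff (v : ι → E) (x : E) :
    x ∈ (Submodule.span ℂ (Set.range v))ᗮ ↔ ∀ i, inner ℂ (v i) x = 0 := by
  rw [Submodule.mem_orthogonal]
  constructor
  · intro h i
    exact h _ (Submodule.subset_span ⟨i, rfl⟩)
  · intro h y hy
    induction hy using Submodule.span_induction with
    | mem z hz => obtain ⟨i, rfl⟩ := hz; exact h i
    | zero => simp
    | add y z _ _ hy hz => rw [inner_add_left, hy, hz, add_zero]
    | smul a y _ hy => rw [inner_smul_left, hy, mul_zero]

/-- A family as a family in the closure of its span. -/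
def toClosedSpan (v : ι → E) (i : ι) : (Submodule.span ℂ (Set.range v)).topologicalClosure :=
  ⟨v i, Submodule.le_topologicalClosure _ (Submodule.subset_span ⟨i, rfl⟩)⟩

theorem Orthonormal.toClosedSpan {v : ι → E} (hv : Orthonormal ℂ v) :
    Orthonormal ℂ (toClosedSpan v) :=
  ⟨fun i => hv.1 i, fun _ _ hij => hv.2 hij⟩

/-- An orthonormal family as a Hilbert basis of the closure of its span. -/
def closedSpanBasis {v : ι → E} (hv : Orthonormal ℂ v) :
    HilbertBasis ι ℂ (Submodule.span ℂ (Set.range v)).topologicalClosure :=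
  HilbertBasis.mkOfOrthogonalEqBot (Orthonormal.toClosedSpan hv) (by
    rw [Submodule.eq_bot_iff]
    rintro ⟨x, hx⟩ h
    have h1 : ∀ i, inner ℂ (v i) x = 0 := (mem_orthogonal_span_range_iff (toClosedSpan v) ⟨x, hx⟩).1 h
    rw [← mem_orthogonal_span_range_iff, ← Submodule.orthogonal_closure] at h1
    exact Subtype.ext (inner_self_eq_zero.1 ((Submodule.mem_orthogonal _ _).1 h1 x hx)))

theorem coe_closedSpanBasis {v : ι → E} (hv : Orthonormal ℂ v) (i : ι) :
    (closedSpanBasis hv i : E) = v i := by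
  rw [closedSpanBasis, HilbertBasis.coe_mkOfOrthogonalEqBot]
  rfl

/-- The right side is the projection of $x$ onto the closed span. Writing it through the complement
matches the form of `orthogonalFibers`. -/
theorem Orthonormal.hasSum_inner_smul {v : ι → E} (hv : Orthonormal ℂ v) (x : E) :
    HasSum (fun i => inner ℂ (v i) x • v i)
      (x - (Submodule.span ℂ (Set.range v))ᗮ.starProjection x) := by
  have h := (closedSpanBasis hv).hasSum_orthogonalProjectionOnto x
  have h2 := h.mapL (Submodule.span ℂ (Set.range v)).topologicalClosure.subtypeL
  have h3 : x - (Submodule.span ℂ (Set.range v))ᗮ.starProjection x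
      = (Submodule.span ℂ (Set.range v)).topologicalClosure.starProjection x := by
    simp_rw [← Submodule.orthogonal_closure (Submodule.span ℂ (Set.range v))]
    rw [Submodule.starProjection_orthogonal_val, sub_sub_cancel]
  rw [h3]
  simpa [coe_closedSpanBasis] using h2

/-- Parseval in the closed span, combined with Pythagoras. -/
theorem Orthonormal.tsum_enorm_inner_sq_add {v : ι → E} (hv : Orthonormal ℂ v) (x : E) :
    ∑' i, ‖inner ℂ (v i) x‖ₑ ^ 2
      + ‖(Submodule.span ℂ (Set.range v))ᗮ.starProjection x‖ₑ ^ 2 = ‖x‖ₑ ^ 2 := by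
  simp_rw [← Submodule.orthogonal_closure (Submodule.span ℂ (Set.range v))]
  set T := (Submodule.span ℂ (Set.range v)).topologicalClosure with hT
  have h1 : ∑' i, ‖inner ℂ (v i) x‖ₑ ^ 2 = ‖T.starProjection x‖ₑ ^ 2 := by
    have := tsum_enorm_inner_sq (closedSpanBasis hv) (T.orthogonalProjectionOnto x)
    have h2 : ‖T.orthogonalProjectionOnto x‖ₑ = ‖T.starProjection x‖ₑ := rfl
    rw [← h2, ← this]
    refine tsum_congr fun i => ?_
    rw [Submodule.inner_orthogonalProjectionOnto_eq_of_mem_left, coe_closedSpanBasis]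
  have h3 := Submodule.norm_sq_eq_add_norm_sq_starProjection x T
  rw [h1, ← ofReal_norm, ← ofReal_norm, ← ofReal_norm, ← ENNReal.ofReal_pow (norm_nonneg _),
    ← ENNReal.ofReal_pow (norm_nonneg _), ← ENNReal.ofReal_pow (norm_nonneg _),
    ← ENNReal.ofReal_add (by positivity) (by positivity), h3]

/-- A Hilbert basis is an algebraic basis only in finite dimension. In infinite dimension the two
cardinalities can differ, but `Cardinal.toENat` sends every infinite cardinal to `⊤`. -/
theorem HilbertBasis.toENat_rank (b : HilbertBasis ι ℂ E) :
    Cardinal.toENat (Module.rank ℂ E) = ENat.card ι := by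
  rcases finite_or_infinite ι with hι | hι
  · have := Fintype.ofFinite ι
    rw [rank_eq_card_basis b.toOrthonormalBasis.toBasis]
    simp
  · rw [ENat.card_eq_top_of_infinite, Cardinal.toENat_eq_top]
    have h := b.orthonormal.linearIndependent.aleph0_le_rank
    exact h

/-- The trace of an orthogonal projection of `ℓ²` is the dimension of its range. -/
theorem tsum_enorm_starProjection_single (J : Submodule ℂ Ell2) [CompleteSpace J] :
    ∑' m, ‖J.starProjection (lp.single 2 m (1 : ℂ))‖ₑ ^ 2
      = ((Cardinal.toENat (Module.rank ℂ J) : ℕ∞) : ℝ≥0∞) := by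
  obtain ⟨w, b, -⟩ := exists_hilbertBasis ℂ J
  rw [HilbertBasis.toENat_rank b]
  -- In a Hilbert basis $(b_i)$ of $J$ the trace is a double sum of $|b_i(m)|^2$; summing over $m$
  -- first gives $1$ for each basis vector.
  have h1 : ∀ m, ‖J.starProjection (lp.single 2 m (1 : ℂ))‖ₑ ^ 2
      = ∑' i, ‖(b i : Ell2) m‖ₑ ^ 2 := by
    intro m
    have h2 : ‖J.starProjection (lp.single 2 m (1 : ℂ))‖ₑ
      = ‖J.orthogonalProjectionOnto (lp.single 2 m (1 : ℂ))‖ₑ := rfl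
    rw [h2, ← tsum_enorm_inner_sq b]
    refine tsum_congr fun i => ?_
    rw [Submodule.inner_orthogonalProjectionOnto_eq_of_mem_left, lp.inner_single_right,
      RCLike.inner_apply, one_mul, RCLike.enorm_conj]
  simp_rw [h1]
  rw [ENNReal.tsum_comm]
  have h3 : ∀ i, ∑' m, ‖(b i : Ell2) m‖ₑ ^ 2 = 1 := by
    intro i
    rw [tsum_enorm_sq_eq, ← ofReal_norm]
    have : ‖(b i : Ell2)‖ = 1 := b.orthonormal.1 i
    rw [this]; simp
  simp_rw [h3]
  rw [ENNReal.tsum_const, mul_one]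

end Hilbert

/-! ### The range function of the complement of an orthonormal translation system, and uniqueness.
-/

section RangeFunctions

variable {K : Type*} [NontriviallyNormedField K]

attribute [local instance] properSpace_of_locallyCompact

variable [IsUltrametricDist K] {p c : ℕ} [Fact p.Prime] [CharP K p] [NeZero c] {π : K}
  {ε : Fin c → K} {χ : AddChar K Circle}
  [LocallyCompactSpace K] [MeasurableSpace K] [BorelSpace K] {μ : Measure K}
  [μ.IsAddHaarMeasure]

variable (hμ : μ (closedBall 0 1) = 1) (hπ : IsPrimeElement π)
    (hε : IsResidueBasis p c ε) (hχ : IsBasicCharacter π ε χ)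

/-- The orthogonal complement of the fibers of a family in `L²(K)`. -/
def orthogonalFibers (p : ℕ) {c : ℕ} {K : Type*} [NontriviallyNormedField K]
    [LocallyCompactSpace K] [MeasurableSpace K] [BorelSpace K] {μ : Measure K}
    [μ.IsAddHaarMeasure] (π : K) (ε : Fin c → K) (χ : AddChar K Circle)
    {ι : Type*} (φ : ι → Lp ℂ 2 μ) (ξ : K) : ClosedSubmodule ℂ Ell2 :=
  ⟨(Submodule.span ℂ (Set.range fun i => fiber p π ε (fourier χ (φ i)) ξ))ᗮ,
    Submodule.isClosed_orthogonal _⟩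

theorem mem_orthogonalFibers {ι : Type*} (φ : ι → Lp ℂ 2 μ) (ξ : K) (v : Ell2) :
    v ∈ orthogonalFibers p π ε χ φ ξ ↔
      ∀ i, inner ℂ (fiber p π ε (fourier χ (φ i)) ξ) v = 0 :=
  mem_orthogonal_span_range_iff _ _

-- Each inner product of two fibers is a.e. the constant given by $k=0$; countability of the index
-- set gives one exceptional null set.
include hμ hπ hε hχ in
theorem ae_orthonormal_fiber {ι : Type*} [Countable ι] [DecidableEq ι] {φ : ι → Lp ℂ 2 μ}
    (h : ∀ i j k, inner ℂ (translate (u p π ε k) (φ i)) (φ j)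
      = if k = 0 then if i = j then 1 else 0 else 0) :
    ∀ᵐ ξ ∂μ.restrict (closedBall 0 1),
      Orthonormal ℂ fun i => fiber p π ε (fourier χ (φ i)) ξ := by
  simp_rw [orthonormal_iff_ite, ae_all_iff]
  exact fun i j => ae_inner_fiber_eq_const hμ hπ hε hχ (h i j)

include hπ hε in
theorem aemeasurable_inner_fiber (F : Lp ℂ 2 μ) (v : Ell2) :
    AEMeasurable (fun ξ => inner ℂ v (fiber p π ε F ξ)) (μ.restrict (closedBall 0 1)) := by
  have h : ∀ k, AEMeasurable (fun ξ => inner ℂ (v k) (F (ξ + u p π ε k)))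
      (μ.restrict (closedBall 0 1)) := fun k =>
    aemeasurable_const.inner
      (aemeasurable_comp_add_u hπ hε k (Lp.aestronglyMeasurable F).aemeasurable)
  refine aemeasurable_of_hasSum h ?_
  filter_upwards [ae_fiber_apply hπ hε F] with ξ hξ
  simpa only [hξ] using lp.hasSum_inner v (fiber p π ε F ξ)

include hμ hπ hε hχ in
/-- The orthogonal complement of an orthonormal translation system has a range function. -/
theorem isRangeFunction_orthogonalFibers {ι : Type*} [Countable ι] [DecidableEq ι]
    {φ : ι → Lp ℂ 2 μ} (h : ∀ i j k, inner ℂ (translate (u p π ε k) (φ i)) (φ j)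
      = if k = 0 then if i = j then 1 else 0 else 0)
    {V : Submodule ℂ (Lp ℂ 2 μ)}
    (hV : ∀ f, f ∈ V ↔ ∀ i k, inner ℂ (translate (u p π ε k) (φ i)) f = 0) :
    IsRangeFunction p π ε χ V (orthogonalFibers p π ε χ φ) where
  measurable a b := by
    have h1 : ∀ i, AEMeasurable (fun ξ =>
        inner ℂ (fiber p π ε (fourier χ (φ i)) ξ) b * inner ℂ a (fiber p π ε (fourier χ (φ i)) ξ))
        (μ.restrict (closedBall 0 1)) := by
      intro i
      have h2 := (aemeasurable_inner_fiber hπ hε (fourier χ (φ i)) b)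
      have h3 : AEMeasurable (fun ξ => inner ℂ (fiber p π ε (fourier χ (φ i)) ξ) b)
          (μ.restrict (closedBall 0 1)) := by
        refine (Complex.continuous_conj.measurable.comp_aemeasurable h2).congr ?_
        exact Filter.Eventually.of_forall fun ξ => inner_conj_symm _ _
      exact h3.mul (aemeasurable_inner_fiber hπ hε _ a)
    -- The matrix coefficient of the projection onto the closed span of the fibers is a countable
    -- sum of measurable functions; the complementary projection follows by subtraction.
    have h4 : AEMeasurable (fun ξ => inner ℂ a b - inner ℂ a
        ((orthogonalFibers p π ε χ φ ξ).toSubmodule.starProjection b))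
        (μ.restrict (closedBall 0 1)) := by
      refine aemeasurable_of_hasSum h1 ?_
      filter_upwards [ae_orthonormal_fiber hμ hπ hε hχ h] with ξ hξ
      have h5 := (Orthonormal.hasSum_inner_smul hξ b).mapL (innerSL ℂ a)
      rw [innerSL_apply_apply, inner_sub_right] at h5
      simpa [inner_smul_right, orthogonalFibers] using h5
    refine (aemeasurable_const (b := inner ℂ a b) |>.sub h4).congr
      (Filter.Eventually.of_forall fun ξ => ?_)
    simp
  mem_iff f := by
    rw [hV]
    simp_rw [forall_inner_translate_eq_zero_iff hμ hπ hε hχ]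
    rw [← ae_all_iff]
    refine Filter.eventually_congr ?_
    filter_upwards [ae_fiber_apply hπ hε (fourier χ f)] with ξ hξ
    constructor
    · intro h1
      exact ⟨_, (mem_orthogonalFibers φ ξ _).2 h1, hξ⟩
    · rintro ⟨v, hv, hv1⟩
      have : v = fiber p π ε (fourier χ f) ξ := lp.ext (funext fun k => by rw [hv1, hξ])
      rw [← this]
      exact (mem_orthogonalFibers φ ξ _).1 hv

-- The coordinates of the unit vector $e_m$ along the orthonormal fibers are, up to conjugation, the
-- values $\hat\varphi_i(\xi+u(m))$.
include hμ hπ hε hχ in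
theorem ae_tsum_add_enorm_orthogonalFibers {ι : Type*} [Countable ι] [DecidableEq ι]
    {φ : ι → Lp ℂ 2 μ} (h : ∀ i j k, inner ℂ (translate (u p π ε k) (φ i)) (φ j)
      = if k = 0 then if i = j then 1 else 0 else 0) :
    ∀ᵐ ξ ∂μ.restrict (closedBall 0 1), ∀ m,
      ∑' i, ‖fourier χ (φ i) (ξ + u p π ε m)‖ₑ ^ 2
      + ‖(orthogonalFibers p π ε χ φ ξ).toSubmodule.starProjection
          (lp.single 2 m (1 : ℂ))‖ₑ ^ 2 = 1 := by
  filter_upwards [ae_orthonormal_fiber hμ hπ hε hχ h,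
    ae_all_iff.2 fun i => ae_fiber_apply hπ hε (fourier χ (φ i))] with ξ h1 h2 m
  have h3 := Orthonormal.tsum_enorm_inner_sq_add h1 (lp.single 2 m (1 : ℂ))
  have h4 : ‖(lp.single 2 m (1 : ℂ) : Ell2)‖ₑ ^ 2 = 1 := by
    rw [← ofReal_norm, lp.norm_single (by norm_num)]; simp
  rw [h4] at h3
  rw [← h3]
  congr 1
  refine tsum_congr fun i => ?_
  rw [lp.inner_single_right, h2, RCLike.inner_apply, one_mul, RCLike.enorm_conj]

-- The field $\xi\mapsto P_{J(\xi)}e_m$ is measurable and bounded by $1$, hence the fiber of the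
-- transform of some $f\in V$. Membership of $f$ read through $J'$ puts $P_{J(\xi)}e_m$ into
-- $J'(\xi)$ a.e., for all $m$ at once.
include hμ hπ hε hχ in
theorem IsRangeFunction.ae_le {V : Submodule ℂ (Lp ℂ 2 μ)} {J J' : K → ClosedSubmodule ℂ Ell2}
    (hJ : IsRangeFunction p π ε χ V J) (hJ' : IsRangeFunction p π ε χ V J') :
    ∀ᵐ ξ ∂μ.restrict (closedBall 0 1), (J ξ).toSubmodule ≤ (J' ξ).toSubmodule := by
  have key : ∀ m : ℕ, ∀ᵐ ξ ∂μ.restrict (closedBall 0 1),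
      (J ξ).toSubmodule.starProjection (lp.single 2 m (1 : ℂ)) ∈ (J' ξ).toSubmodule := by
    intro m
    obtain ⟨f, hf⟩ := exists_fourier_fiber_eq hμ hπ hε hχ
      (W := fun ξ => (J ξ).toSubmodule.starProjection (lp.single 2 m (1 : ℂ)))
      (fun k => by
        have := hJ.measurable (lp.single 2 k (1 : ℂ)) (lp.single 2 m (1 : ℂ))
        simpa [lp.inner_single_left] using this)
      (fun ξ => by
        refine (Submodule.norm_starProjection_apply_le _ _).trans ?_
        rw [lp.norm_single (by norm_num)]; simp)
    have h1 : f ∈ V := by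
      rw [hJ.mem_iff]
      filter_upwards [hf] with ξ hξ
      exact ⟨_, Submodule.starProjection_apply_mem _ _, fun k => (hξ k).symm⟩
    filter_upwards [hf, (hJ'.mem_iff f).1 h1] with ξ hξ ⟨v, hv, hv1⟩
    have : v = (J ξ).toSubmodule.starProjection (lp.single 2 m (1 : ℂ)) :=
      lp.ext (funext fun k => by rw [hv1, hξ])
    rw [← this]
    exact hv
  filter_upwards [ae_all_iff.2 key] with ξ hξ v hv
  -- Any $v\in J(\xi)$ equals $\sum_m v_mP_{J(\xi)}e_m$, and $J'(\xi)$ is closed.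
  have h1 := (lp.hasSum_single (p := 2) (by norm_num) v).mapL (J ξ).toSubmodule.starProjection
  rw [Submodule.starProjection_eq_self_iff.2 hv] at h1
  refine (J' ξ).isClosed.mem_of_tendsto h1 (Filter.Eventually.of_forall fun s => ?_)
  refine Submodule.sum_mem (J' ξ).toSubmodule fun m _ => ?_
  have h2 : (lp.single 2 m (v m) : Ell2) = v m • lp.single 2 m (1 : ℂ) := by
    rw [← lp.single_smul, smul_eq_mul, mul_one]
  rw [h2, map_smul]
  exact Submodule.smul_mem _ _ (hξ m)

include hμ hπ hε hχ in
/-- The range function of a space is unique almost everywhere. -/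
theorem IsRangeFunction.ae_eq {V : Submodule ℂ (Lp ℂ 2 μ)} {J J' : K → ClosedSubmodule ℂ Ell2}
    (hJ : IsRangeFunction p π ε χ V J) (hJ' : IsRangeFunction p π ε χ V J') :
    ∀ᵐ ξ ∂μ.restrict (closedBall 0 1), (J ξ).toSubmodule = (J' ξ).toSubmodule := by
  filter_upwards [hJ.ae_le hμ hπ hε hχ hJ', hJ'.ae_le hμ hπ hε hχ hJ] with ξ h1 h2
  exact le_antisymm h1 h2

end RangeFunctions

/-! ### Energy of indicator functions at a single scale of the affine system. -/

section Coefficients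

theorem enorm_sum_sq_le {ι : Type*} (s : Finset ι) (f : ι → ℂ) :
    ‖∑ i ∈ s, f i‖ₑ ^ 2 ≤ s.card * ∑ i ∈ s, ‖f i‖ₑ ^ 2 := by
  have h : ‖∑ i ∈ s, f i‖₊ ^ 2 ≤ s.card * ∑ i ∈ s, ‖f i‖₊ ^ 2 :=
    (pow_le_pow_left' (nnnorm_sum_le s f) 2).trans sq_sum_le_card_mul_sum_sq
  simp only [enorm_eq_nnnorm]
  exact_mod_cast h

theorem coeFn_finsetSum {α ι : Type*} [MeasurableSpace α] {μ : Measure α} (s : Finset ι)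
    (g : ι → Lp ℂ 2 μ) : ⇑(∑ i ∈ s, g i) =ᵐ[μ] fun x => ∑ i ∈ s, g i x := by
  classical
  induction s using Finset.induction_on with
  | empty =>
    simp only [Finset.sum_empty]
    exact Lp.coeFn_zero ℂ 2 μ
  | insert a s ha ih =>
    rw [Finset.sum_insert ha]
    filter_upwards [Lp.coeFn_add (g a) (∑ i ∈ s, g i), ih] with x h1 h2
    rw [h1, Pi.add_apply, h2, Finset.sum_insert ha]

variable {K : Type*} [NontriviallyNormedField K]

attribute [local instance] properSpace_of_locallyCompact

variable [IsUltrametricDist K] {p c : ℕ} [Fact p.Prime] [CharP K p] [NeZero c] {π : K}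
  {ε : Fin c → K} {χ : AddChar K Circle}
  [LocallyCompactSpace K] [MeasurableSpace K] [BorelSpace K] {μ : Measure K}
  [μ.IsAddHaarMeasure]

variable (hμ : μ (closedBall 0 1) = 1) (hπ : IsPrimeElement π)
    (hε : IsResidueBasis p c ε) (hχ : IsBasicCharacter π ε χ)

theorem closedBall_eq_of_norm_sub_le {a b : K} {r : ℝ} (h : ‖a - b‖ ≤ r) :
    closedBall a r = closedBall b r :=
  (IsUltrametricDist.closedBall_eq_of_mem (by rwa [mem_closedBall, dist_eq_norm])).symm

/-- Negation of the translations as a permutation of the indices. -/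
def negIndexEquiv (hπ : IsPrimeElement π) (hε : IsResidueBasis p c ε) : ℕ ≃ ℕ where
  toFun := negIndex π hε
  invFun := negIndex π hε
  left_inv := negIndex_negIndex hπ hε
  right_inv := negIndex_negIndex hπ hε

theorem memLp_conj_mul_indicator (F : Lp ℂ 2 μ) {B : Set K} (hB : MeasurableSet B) (a : ℂ) :
    MemLp (fun x => starRingEnd ℂ (F x) * B.indicator (fun _ => a) x) 2 μ := by
  refine ((Lp.memLp F).const_mul a).of_le ?_ (Filter.Eventually.of_forall fun x => ?_)
  · exact (Complex.continuous_conj.comp_aestronglyMeasurable (Lp.aestronglyMeasurable F)).mul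
      (aestronglyMeasurable_const.indicator hB)
  · rw [norm_mul, norm_mul, RCLike.norm_conj, mul_comm]
    exact mul_le_mul_of_nonneg_right (norm_indicator_le_norm_self _ _) (norm_nonneg _)

include hμ hπ hε hχ in
/-- The coefficients of a multiple of an indicator function supported in a single coset of `𝒪`. -/
theorem tsum_enorm_inner_modulate_sq (F G : Lp ℂ 2 μ) {B : Set K} (hB : MeasurableSet B) {a : K}
    (hBa : B ⊆ closedBall a 1) {b : ℂ} (hG : G =ᵐ[μ] B.indicator fun _ => b) :
    ∑' k, ‖inner ℂ (modulate hχ (u p π ε k) F) G‖ₑ ^ 2 = ‖b‖ₑ ^ 2 * ∫⁻ x in B, ‖F x‖ₑ ^ 2 ∂μ := by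
  obtain ⟨n, hn⟩ := exists_norm_sub_u_le_one hπ hε a
  rw [closedBall_eq_of_norm_sub_le hn] at hBa
  -- The inner products with the modulations of $F$ are the coordinates of $H=\overline F\,b\,1_B$
  -- on the cells over one coset. The other coordinates of $H$ vanish, so Parseval for $H$ is the
  -- claim.
  set H := (memLp_conj_mul_indicator F hB b).toLp with hH
  have hHae : H =ᵐ[μ] fun x => starRingEnd ℂ (F x) * B.indicator (fun _ => b) x :=
    MemLp.coeFn_toLp _
  have h1 : ∀ k, inner ℂ (modulate hχ (u p π ε k) F) G
      = inner ℂ (cell (p := p) μ hχ n (negIndexEquiv hπ hε k)) H := by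
    intro k
    rw [inner_cell, L2.inner_def]
    refine integral_congr_ae ?_
    filter_upwards [hHae, hG, coeFn_modulate hχ (u p π ε k) F] with x h2 h3 h4
    rw [h2, h3, h4, RCLike.inner_apply, conj_cellFun hε, negIndexEquiv, Equiv.coe_fn_mk,
      negIndex_negIndex hπ hε, map_mul, ← Circle.coe_inv_eq_conj, AddChar.map_neg_eq_inv, inv_inv]
    by_cases hx : x ∈ B
    · rw [cellFun, Set.indicator_of_mem (hBa hx)]
      ring
    · rw [Set.indicator_of_notMem hx]
      ring
  have h5 : ∀ m, m ≠ n → ∑' k, ‖inner ℂ (cell (p := p) μ hχ m k) H‖ₑ ^ 2 = 0 := by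
    intro m hm
    rw [ENNReal.tsum_eq_zero]
    intro k
    have : inner ℂ (cell (p := p) μ hχ m k) H = 0 := by
      rw [inner_cell]
      refine integral_eq_zero_of_ae ?_
      filter_upwards [hHae] with x h2
      rw [h2, Pi.zero_apply]
      by_cases hx : x ∈ B
      · have : x ∉ closedBall (u p π ε m) 1 := fun h =>
          Set.disjoint_left.1 (pairwise_disjoint_closedBall_u hπ hε hm) h (hBa hx)
        rw [cellFun, Set.indicator_of_notMem this, map_zero, zero_mul]
      · rw [Set.indicator_of_notMem hx, mul_zero, mul_zero]
    simp [this]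
  have h7 : ∑' m, ∑' k, ‖inner ℂ (cell (p := p) μ hχ m k) H‖ₑ ^ 2
      = ∑' k, ‖inner ℂ (cell (p := p) μ hχ n k) H‖ₑ ^ 2 := tsum_eq_single n h5
  simp_rw [h1]
  rw [(negIndexEquiv hπ hε).tsum_eq (fun k => ‖inner ℂ (cell (p := p) μ hχ n k) H‖ₑ ^ 2), ← h7,
    ← ENNReal.tsum_prod (f := fun m k => ‖inner ℂ (cell (p := p) μ hχ m k) H‖ₑ ^ 2)]
  have h6 : ∑' i : ℕ × ℕ, ‖inner ℂ (cell (p := p) μ hχ i.1 i.2) H‖ₑ ^ 2 = ‖H‖ₑ ^ 2 := by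
    rw [← tsum_enorm_inner_sq (cellBasis hμ hπ hε hχ) H]
    exact tsum_congr fun ⟨m, k⟩ => by rw [cellBasis_apply]
  rw [h6, enorm_sq_eq_lintegral, ← lintegral_const_mul' _ _ (ENNReal.pow_ne_top enorm_ne_top),
    ← lintegral_indicator hB]
  refine lintegral_congr_ae ?_
  filter_upwards [hHae] with x h2
  rw [h2]
  by_cases hx : x ∈ B
  · rw [Set.indicator_of_mem hx, Set.indicator_of_mem hx, enorm_mul, RCLike.enorm_conj, mul_pow,
      mul_comm]
  · rw [Set.indicator_of_notMem hx, Set.indicator_of_notMem hx]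
    simp

-- Cut $B$ into its $q^s$ intersections with cosets of $\mathcal O$, where the exact formula holds;
-- the Cauchy–Schwarz inequality for a sum of $q^s$ terms costs the factor $q^s$.
include hμ hπ hε hχ in
theorem tsum_enorm_inner_modulate_sq_le (F G : Lp ℂ 2 μ) {B : Set K} (hB : MeasurableSet B)
    {a : K} {s : ℕ} (hBa : B ⊆ closedBall a (‖π⁻¹‖ ^ s)) {b : ℂ}
    (hG : G =ᵐ[μ] B.indicator fun _ => b) :
    ∑' k, ‖inner ℂ (modulate hχ (u p π ε k) F) G‖ₑ ^ 2
      ≤ ((p ^ c : ℕ) : ℝ≥0∞) ^ s * (‖b‖ₑ ^ 2 * ∫⁻ x in B, ‖F x‖ₑ ^ 2 ∂μ) := by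
  have hfin : μ B ≠ ⊤ := ((measure_mono hBa).trans_lt measure_closedBall_lt_top).ne
  let P : Fin ((p ^ c) ^ s) → Set K := fun d => B ∩ closedBall (a + u p π ε d) 1
  have hP : ∀ d, MeasurableSet (P d) := fun d => hB.inter measurableSet_closedBall
  have hdisj : Pairwise (Function.onFun Disjoint P) := by
    intro d e hde
    refine Disjoint.mono Set.inter_subset_right Set.inter_subset_right ?_
    refine (IsUltrametricDist.closedBall_eq_or_disjoint _ _ _).resolve_left fun h => hde ?_
    have h1 : a + u p π ε d ∈ closedBall (a + u p π ε e) 1 := h ▸ mem_closedBall_self zero_le_one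
    rw [mem_closedBall, dist_eq_norm, add_sub_add_left_eq_sub] at h1
    exact Fin.ext (eq_of_norm_u_sub_le_one hπ hε h1)
  have hunion : B = ⋃ d, P d := by
    refine Set.Subset.antisymm (fun x hx => ?_) (Set.iUnion_subset fun d => Set.inter_subset_left)
    have h1 : ‖x - a‖ ≤ ‖π⁻¹‖ ^ s := by
      rw [← dist_eq_norm]; exact hBa hx
    obtain ⟨d, hd, h2⟩ := exists_norm_sub_u_le_one_of_norm_le hπ hε h1
    refine Set.mem_iUnion.2 ⟨⟨d, hd⟩, hx, ?_⟩
    rwa [mem_closedBall, dist_eq_norm, ← sub_sub]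
  let g : Fin ((p ^ c) ^ s) → Lp ℂ 2 μ := fun d => indicatorConstLp 2 (hP d)
    ((measure_mono Set.inter_subset_left).trans_lt hfin.lt_top).ne b
  have hg : ∀ d, g d =ᵐ[μ] (P d).indicator fun _ => b := fun d => indicatorConstLp_coeFn
  have hGsum : G = ∑ d, g d := by
    refine Lp.ext ?_
    filter_upwards [hG, coeFn_finsetSum Finset.univ g, ae_all_iff.2 hg] with x h1 h2 h3
    rw [h1, h2]
    simp_rw [h3]
    by_cases hx : x ∈ B
    · rw [Set.indicator_of_mem hx]
      rw [hunion, Set.mem_iUnion] at hx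
      obtain ⟨d, hd⟩ := hx
      rw [Finset.sum_eq_single d, Set.indicator_of_mem hd]
      · intro e _ hed
        exact Set.indicator_of_notMem (fun h => Set.disjoint_left.1 (hdisj hed) h hd) _
      · simp
    · rw [Set.indicator_of_notMem hx, Finset.sum_eq_zero]
      intro d _
      exact Set.indicator_of_notMem (fun h => hx h.1) _
  calc ∑' k, ‖inner ℂ (modulate hχ (u p π ε k) F) G‖ₑ ^ 2
      ≤ ∑' k, ((p ^ c : ℕ) : ℝ≥0∞) ^ s *
          ∑ d, ‖inner ℂ (modulate hχ (u p π ε k) F) (g d)‖ₑ ^ 2 := by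
        refine ENNReal.tsum_le_tsum fun k => ?_
        rw [hGsum, inner_sum]
        refine (enorm_sum_sq_le _ _).trans_eq ?_
        simp
    _ = ((p ^ c : ℕ) : ℝ≥0∞) ^ s * ∑ d, ‖b‖ₑ ^ 2 * ∫⁻ x in P d, ‖F x‖ₑ ^ 2 ∂μ := by
        rw [ENNReal.tsum_mul_left, Summable.tsum_finsetSum fun _ _ => ENNReal.summable]
        congr 1
        exact Finset.sum_congr rfl fun d _ => tsum_enorm_inner_modulate_sq hμ hπ hε hχ F (g d)
          (hP d) Set.inter_subset_right (hg d)
    _ = _ := by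
        rw [← Finset.mul_sum]
        conv_rhs => rw [hunion, lintegral_iUnion hP hdisj, tsum_fintype]

-- With the dilation moved to $f$, the index $k$ enters only through a modulation, so the sum over
-- $k$ is a Parseval sum.
include hμ hπ hε hχ in
theorem inner_affine_eq (ψ f : Lp ℂ 2 μ) (j : ℤ) (k : ℕ) :
    inner ℂ (affine p hπ ε ψ j k) f = inner ℂ (modulate hχ (u p π ε k) (fourier χ ψ))
      (dilate (p ^ c) hπ j (fourier χ f)) := by
  rw [affine, inner_dilate_left hμ hπ hε, ← inner_fourier_fourier hμ hπ hε hχ,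
    fourier_translate hμ hπ hε hχ, fourier_dilate hμ hπ hε hχ, neg_neg]

theorem dilate_indicator (hμ : μ (closedBall 0 1) = 1) (hε : IsResidueBasis p c ε)
    (hπ : IsPrimeElement π) {g : Lp ℂ 2 μ} {E : Set K} (hg : g =ᵐ[μ] E.indicator fun _ => 1)
    (j : ℤ) :
    dilate (p ^ c) hπ j g =ᵐ[μ] ((fun x => π ^ (-j) * x) ⁻¹' E).indicator fun _ =>
      ((((p ^ c : ℕ) : ℝ) ^ ((j : ℝ) / 2) : ℝ) : ℂ) := by
  classical
  filter_upwards [coeFn_dilate (p ^ c) hπ j g,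
    (quasiMeasurePreserving_zpow_mul hμ hπ hε (-j)).ae hg] with x h1 h2
  rw [h1, h2, Set.indicator_apply, Set.indicator_apply, Set.mem_preimage]
  split_ifs <;> simp

/-- The measure of the dilated set `π ^ j E` with density `|F|²`. -/
def dilatedMass (π : K) (F : Lp ℂ 2 μ) (j : ℤ) (E : Set K) : ℝ≥0∞ :=
  ∫⁻ x in (fun x => π ^ (-j) * x) ⁻¹' E, ‖F x‖ₑ ^ 2 ∂μ

include hμ hπ hε in
theorem setLIntegral_comp_zpow_mul (F : Lp ℂ 2 μ) (j : ℤ) {E : Set K} (hE : MeasurableSet E) :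
    ∫⁻ x in E, ‖F (π ^ j * x)‖ₑ ^ 2 ∂μ = ((p ^ c : ℕ) : ℝ≥0∞) ^ j * dilatedMass π F j E := by
  have hm : MeasurableSet ((fun x => π ^ (-j) * x) ⁻¹' E) := measurable_const_mul (π ^ (-j)) hE
  rw [dilatedMass, ← lintegral_indicator hm, ← lintegral_comp_zpow_mul hμ hπ hε j,
    ← lintegral_indicator hE]
  refine lintegral_congr fun x => ?_
  have h0 : π ^ (-j) * (π ^ j * x) = x := by
    have := zpow_ne_zero j hπ.ne_zero
    rw [zpow_neg]; field_simp
  by_cases hx : x ∈ E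
  · rw [Set.indicator_of_mem hx, Set.indicator_of_mem (by rwa [Set.mem_preimage, h0])]
  · rw [Set.indicator_of_notMem hx, Set.indicator_of_notMem (by rwa [Set.mem_preimage, h0])]

include hπ in
theorem preimage_zpow_mul_subset (j : ℤ) (r : ℕ) {E : Set K} {a : K}
    (hE : E ⊆ (fun x => π ^ (-(r : ℤ)) * x) ⁻¹' closedBall a 1) :
    (fun x => π ^ (-j) * x) ⁻¹' E ⊆ closedBall (π ^ (r + j) * a) (‖π‖ ^ (r + j)) := by
  intro x hx
  have h1 := hE hx
  rw [Set.mem_preimage, mem_closedBall, dist_eq_norm] at h1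
  have h0 := hπ.ne_zero
  have h2 : x - π ^ (r + j) * a = π ^ (r + j) * (π ^ (-(r : ℤ)) * (π ^ (-j) * x) - a) := by
    have h3 : π ^ ((r : ℤ) + j) * (π ^ (-(r : ℤ)) * π ^ (-j)) = 1 := by
      rw [← zpow_add₀ h0, ← zpow_add₀ h0]
      have : (r : ℤ) + j + (-r + -j) = 0 := by ring
      rw [this, zpow_zero]
    linear_combination (-x) * h3
  rw [mem_closedBall, dist_eq_norm, h2, norm_mul, norm_zpow]
  exact mul_le_of_le_one_right (by positivity) h1

include hμ hπ hε hχ in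
/-- The exact energy of an indicator function at the scales where its support is small. -/
theorem tsum_enorm_inner_affine_sq (ψ f : Lp ℂ 2 μ) {E : Set K} (hE : MeasurableSet E) {a : K}
    {r : ℕ} (hEa : E ⊆ (fun x => π ^ (-(r : ℤ)) * x) ⁻¹' closedBall a 1)
    (hf : fourier χ f =ᵐ[μ] E.indicator fun _ => 1) {j : ℤ} (hj : 0 ≤ r + j) :
    ∑' k, ‖inner ℂ (affine p hπ ε ψ j k) f‖ₑ ^ 2
      = ((p ^ c : ℕ) : ℝ≥0∞) ^ j * dilatedMass π (fourier χ ψ) j E := by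
  simp_rw [inner_affine_eq hμ hπ hε hχ]
  rw [tsum_enorm_inner_modulate_sq hμ hπ hε hχ _ _ (measurable_const_mul (π ^ (-j)) hE)
    ((preimage_zpow_mul_subset hπ j r hEa).trans (closedBall_subset_closedBall ?_))
    (dilate_indicator hμ hε hπ hf j), ofReal_rpow_half_sq _ (residueCard_pos p c)]
  · rfl
  · obtain ⟨s, hs⟩ := Int.eq_ofNat_of_zero_le hj
    rw [hs, zpow_natCast]
    exact pow_le_one₀ (norm_nonneg _) hπ.norm_lt_one.le

-- For $r+j\ge0$ the first term is exact. For $r+j=-s\le0$ the dilated support lies in a ball of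
-- radius $|\mathfrak p|^{-s}$, and the loss $q^s$ times the weight $q^j$ is $q^{-r}$. Adding both
-- terms gives one bound for all $j$.
include hμ hπ hε hχ in
theorem tsum_enorm_inner_affine_sq_le (ψ f : Lp ℂ 2 μ) {E : Set K} (hE : MeasurableSet E) {a : K}
    {r : ℕ} (hEa : E ⊆ (fun x => π ^ (-(r : ℤ)) * x) ⁻¹' closedBall a 1)
    (hf : fourier χ f =ᵐ[μ] E.indicator fun _ => 1) (j : ℤ) :
    ∑' k, ‖inner ℂ (affine p hπ ε ψ j k) f‖ₑ ^ 2
      ≤ ((p ^ c : ℕ) : ℝ≥0∞) ^ j * dilatedMass π (fourier χ ψ) j E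
        + ((p ^ c : ℕ) : ℝ≥0∞) ^ (-(r : ℤ)) * dilatedMass π (fourier χ ψ) j E := by
  rcases le_total 0 (r + j) with hj | hj
  · rw [tsum_enorm_inner_affine_sq hμ hπ hε hχ ψ f hE hEa hf hj]
    exact le_self_add
  · refine le_trans ?_ le_add_self
    obtain ⟨s, hs⟩ := Int.eq_ofNat_of_zero_le (neg_nonneg.2 hj)
    have hs' : (r : ℤ) + j = -s := by linarith
    have hr : -(r : ℤ) = s + j := by linarith
    have hsub := preimage_zpow_mul_subset hπ j r hEa
    have hn : ‖π‖ ^ ((r : ℤ) + j) = ‖π⁻¹‖ ^ s := by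
      rw [hs', zpow_neg, zpow_natCast, ← inv_pow, ← norm_inv]
    rw [hn] at hsub
    simp_rw [inner_affine_eq hμ hπ hε hχ]
    refine (tsum_enorm_inner_modulate_sq_le hμ hπ hε hχ _ _ (measurable_const_mul (π ^ (-j)) hE)
      hsub (dilate_indicator hμ hε hπ hf j)).trans_eq ?_
    rw [ofReal_rpow_half_sq _ (residueCard_pos p c), hr,
      ENNReal.zpow_add (residueCard_ne_zero p c) (ENNReal.natCast_ne_top _), zpow_natCast, mul_assoc]
    rfl

end Coefficients

/-! ### The Calderón identity. -/

section Calderon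

variable {K : Type*} [NontriviallyNormedField K]

attribute [local instance] properSpace_of_locallyCompact

variable [IsUltrametricDist K] {p c : ℕ} [Fact p.Prime] [CharP K p] [NeZero c] {π : K}
  {ε : Fin c → K} {χ : AddChar K Circle}
  [LocallyCompactSpace K] [MeasurableSpace K] [BorelSpace K] {μ : Measure K}
  [μ.IsAddHaarMeasure]

variable (hμ : μ (closedBall 0 1) = 1) (hπ : IsPrimeElement π)
    (hε : IsResidueBasis p c ε) (hχ : IsBasicCharacter π ε χ)
    {L : ℕ} {ψ : Fin L → Lp ℂ 2 μ} (hψ : IsOrthonormalMultiwavelet p hπ ε ψ)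

/-- The Hilbert basis generated by a multiwavelet. -/
def waveletBasis (hψ : IsOrthonormalMultiwavelet p hπ ε ψ) :
    HilbertBasis (Fin L × ℤ × ℕ) ℂ (Lp ℂ 2 μ) :=
  HilbertBasis.mk hψ.orthonormal hψ.complete.ge

theorem waveletBasis_apply (i : Fin L × ℤ × ℕ) :
    waveletBasis hπ hψ i = affine p hπ ε (ψ i.1) i.2.1 i.2.2 := by
  rw [waveletBasis, HilbertBasis.coe_mk]

include hψ in
theorem tsum_enorm_inner_wavelet_sq (f : Lp ℂ 2 μ) :
    ∑' (j : ℤ) (l : Fin L) (k : ℕ), ‖inner ℂ (affine p hπ ε (ψ l) j k) f‖ₑ ^ 2 = ‖f‖ₑ ^ 2 := by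
  rw [← tsum_enorm_inner_sq (waveletBasis hπ hψ) f, ENNReal.tsum_comm]
  simp_rw [waveletBasis_apply]
  rw [ENNReal.tsum_prod (f := fun (l : Fin L) (i : ℤ × ℕ) =>
    ‖inner ℂ (affine p hπ ε (ψ l) i.1 i.2) f‖ₑ ^ 2)]
  exact tsum_congr fun l => (ENNReal.tsum_prod (f := fun (j : ℤ) (k : ℕ) =>
    ‖inner ℂ (affine p hπ ε (ψ l) j k) f‖ₑ ^ 2)).symm

theorem dilatedMass_iUnion {ι : Type*} [Countable ι] (F : Lp ℂ 2 μ) (j : ℤ) {P : ι → Set K}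
    (hP : ∀ n, MeasurableSet (P n)) (hd : Pairwise (Function.onFun Disjoint P)) :
    dilatedMass π F j (⋃ n, P n) = ∑' n, dilatedMass π F j (P n) := by
  rw [dilatedMass, Set.preimage_iUnion,
    lintegral_iUnion (fun n => measurable_const_mul (π ^ (-j)) (hP n))
    (fun m n hmn => (hd hmn).preimage _)]
  rfl

/-- Disjointness of the dilates bounds the error terms at all scales together by a fixed finite
quantity. -/
theorem tsum_dilatedMass_le (F : Lp ℂ 2 μ) {E : Set K} (hE : MeasurableSet E)
    (hd : Pairwise (Function.onFun Disjoint fun j : ℤ => (fun x => π ^ (-j) * x) ⁻¹' E)) :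
    ∑' j, dilatedMass π F j E ≤ ‖F‖ₑ ^ 2 := by
  simp_rw [dilatedMass]
  rw [← lintegral_iUnion (fun j : ℤ => measurable_const_mul (π ^ (-j)) hE) hd,
    enorm_sq_eq_lintegral]
  exact setLIntegral_le_lintegral _ _

include hμ hπ hε hχ in
theorem exists_fourier_eq_indicator {E : Set K} (hE : MeasurableSet E) (hfin : μ E ≠ ⊤) :
    ∃ f : Lp ℂ 2 μ, fourier χ f =ᵐ[μ] (E.indicator fun _ => 1) ∧ ‖f‖ₑ ^ 2 = μ E := by
  refine ⟨(plancherel hμ hπ hε hχ).symm (indicatorConstLp 2 hE hfin 1), ?_, ?_⟩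
  · rw [fourier_eq_plancherel hμ hπ hε hχ, LinearIsometryEquiv.apply_symm_apply]
    exact indicatorConstLp_coeFn
  · rw [← ofReal_norm, LinearIsometryEquiv.norm_map, ofReal_norm, enorm_sq_eq_lintegral,
      ← lintegral_indicator_one hE]
    refine lintegral_congr_ae ?_
    filter_upwards [indicatorConstLp_coeFn (p := 2) (hs := hE) (hμs := hfin) (c := (1 : ℂ))]
      with x hx
    rw [hx]
    by_cases h : x ∈ E <;> simp [h]

include hμ hπ hε hχ hψ in
/-- The integrated form of the Calderón identity. -/
theorem tsum_dilatedMass_eq_measure {E : Set K} (hE : MeasurableSet E) (hfin : μ E ≠ ⊤)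
    (hd : Pairwise (Function.onFun Disjoint fun j : ℤ => (fun x => π ^ (-j) * x) ⁻¹' E)) :
    ∑' (j : ℤ) (l : Fin L), ((p ^ c : ℕ) : ℝ≥0∞) ^ j * dilatedMass π (fourier χ (ψ l)) j E
      = μ E := by
  -- The cells `C r n` are the balls of radius $|\mathfrak p|^r$ about $\mathfrak p^ru(n)$; they cut
  -- $E$ into pieces on which the scales $j\ge-r$ are exact.
  let C : ℕ → ℕ → Set K := fun r n => (fun x => π ^ (-(r : ℤ)) * x) ⁻¹' closedBall (u p π ε n) 1
  let P : ℕ → ℕ → Set K := fun r n => E ∩ C r n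
  have hP : ∀ r n, MeasurableSet (P r n) := fun r n =>
    hE.inter (measurable_const_mul (π ^ (-(r : ℤ))) measurableSet_closedBall)
  have hPd : ∀ r, Pairwise (Function.onFun Disjoint (P r)) := fun r n m hnm =>
    ((pairwise_disjoint_closedBall_u hπ hε hnm).preimage _).mono Set.inter_subset_right
      Set.inter_subset_right
  have hPu : ∀ r, ⋃ n, P r n = E := by
    intro r
    rw [← Set.inter_iUnion, ← Set.preimage_iUnion, iUnion_closedBall_u hπ hε, Set.preimage_univ,
      Set.inter_univ]
  have hmass : ∀ r l j, dilatedMass π (fourier χ (ψ l)) j E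
      = ∑' n, dilatedMass π (fourier χ (ψ l)) j (P r n) := by
    intro r l j
    rw [← dilatedMass_iUnion _ _ (hP r) (hPd r), hPu r]
  have hmeas : ∀ r, μ E = ∑' n, μ (P r n) := by
    intro r
    rw [← measure_iUnion (hPd r) (hP r), hPu r]
  choose f hf1 hf2 using fun r n => exists_fourier_eq_indicator hμ hπ hε hχ (hP r n)
    ((measure_mono Set.inter_subset_left).trans_lt hfin.lt_top).ne
  have hpars : ∀ r, μ E = ∑' (n : ℕ) (j : ℤ) (l : Fin L) (k : ℕ),
      ‖inner ℂ (affine p hπ ε (ψ l) j k) (f r n)‖ₑ ^ 2 := by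
    intro r
    rw [hmeas r]
    exact tsum_congr fun n => by rw [tsum_enorm_inner_wavelet_sq hπ hψ, hf2]
  refine le_antisymm ?_ ?_
  · rw [ENNReal.tsum_eq_iSup_sum]
    refine iSup_le fun s => ?_
    -- A finite set of scales becomes exact once $r$ is large, so each partial sum is part of the
    -- Parseval sum for $\mu(E)$.
    obtain ⟨r, hr⟩ : ∃ r : ℕ, ∀ j ∈ s, (0 : ℤ) ≤ r + j := by
      refine ⟨s.sup Int.natAbs, fun j hj => ?_⟩
      have := Finset.le_sup (f := Int.natAbs) hj
      omega
    calc ∑ j ∈ s, ∑' l : Fin L, ((p ^ c : ℕ) : ℝ≥0∞) ^ j * dilatedMass π (fourier χ (ψ l)) j E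
        = ∑ j ∈ s, ∑' n, ∑' l : Fin L, ∑' k,
            ‖inner ℂ (affine p hπ ε (ψ l) j k) (f r n)‖ₑ ^ 2 := by
          refine Finset.sum_congr rfl fun j hj => ?_
          rw [ENNReal.tsum_comm]
          refine tsum_congr fun l => ?_
          rw [hmass r, ← ENNReal.tsum_mul_left]
          exact tsum_congr fun n => (tsum_enorm_inner_affine_sq hμ hπ hε hχ (ψ l) (f r n) (hP r n)
            Set.inter_subset_right (hf1 r n) (hr j hj)).symm
      _ = ∑' n, ∑ j ∈ s, ∑' l : Fin L, ∑' k,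
            ‖inner ℂ (affine p hπ ε (ψ l) j k) (f r n)‖ₑ ^ 2 :=
          (Summable.tsum_finsetSum fun _ _ => ENNReal.summable).symm
      _ ≤ μ E := by
          rw [hpars r]
          exact ENNReal.tsum_le_tsum fun n => ENNReal.sum_le_tsum s
  · set X := ∑' (j : ℤ) (l : Fin L), ((p ^ c : ℕ) : ℝ≥0∞) ^ j *
      dilatedMass π (fourier χ (ψ l)) j E with hX
    set M := ∑' l : Fin L, ‖fourier χ (ψ l)‖ₑ ^ 2 with hM
    have hMfin : M ≠ ⊤ := by
      rw [hM, tsum_fintype]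
      exact ENNReal.sum_ne_top.2 fun l _ => ENNReal.pow_ne_top enorm_ne_top
    have hq : (((p ^ c : ℕ) : ℝ≥0∞))⁻¹ < 1 := by
      rw [ENNReal.inv_lt_one]
      exact_mod_cast one_lt_residueCard p c
    -- For the reverse inequality every scale is bounded, and the masses of the pieces add up to
    -- those of $E$, so the error is $q^{-r}M$ independently of the number of pieces.
    have hbound : ∀ r : ℕ, μ E ≤ X + (((p ^ c : ℕ) : ℝ≥0∞))⁻¹ ^ r * M := by
      intro r
      calc μ E ≤ ∑' (n : ℕ) (j : ℤ) (l : Fin L),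
            (((p ^ c : ℕ) : ℝ≥0∞) ^ j * dilatedMass π (fourier χ (ψ l)) j (P r n)
            + ((p ^ c : ℕ) : ℝ≥0∞) ^ (-(r : ℤ)) * dilatedMass π (fourier χ (ψ l)) j (P r n)) := by
            rw [hpars r]
            exact ENNReal.tsum_le_tsum fun n => ENNReal.tsum_le_tsum fun j =>
              ENNReal.tsum_le_tsum fun l => tsum_enorm_inner_affine_sq_le hμ hπ hε hχ (ψ l) (f r n)
                (hP r n) Set.inter_subset_right (hf1 r n) j
        _ = ∑' (j : ℤ) (l : Fin L),
            (((p ^ c : ℕ) : ℝ≥0∞) ^ j * dilatedMass π (fourier χ (ψ l)) j E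
            + ((p ^ c : ℕ) : ℝ≥0∞) ^ (-(r : ℤ)) * dilatedMass π (fourier χ (ψ l)) j E) := by
            rw [ENNReal.tsum_comm]
            refine tsum_congr fun j => ?_
            rw [ENNReal.tsum_comm]
            refine tsum_congr fun l => ?_
            rw [ENNReal.tsum_add, ENNReal.tsum_mul_left, ENNReal.tsum_mul_left, ← hmass r]
        _ = X + (((p ^ c : ℕ) : ℝ≥0∞))⁻¹ ^ r *
              ∑' (l : Fin L) (j : ℤ), dilatedMass π (fourier χ (ψ l)) j E := by
            rw [ENNReal.tsum_comm (α := Fin L)]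
            simp_rw [ENNReal.tsum_add, ENNReal.tsum_mul_left]
            rw [hX, ENNReal.zpow_neg, zpow_natCast, ENNReal.inv_pow]
            simp_rw [ENNReal.tsum_mul_left]
        _ ≤ _ := by
            exact add_le_add le_rfl (mul_le_mul_right (ENNReal.tsum_le_tsum fun l =>
              tsum_dilatedMass_le (fourier χ (ψ l)) hE hd) _)
    have hlim : Filter.Tendsto (fun r : ℕ => X + (((p ^ c : ℕ) : ℝ≥0∞))⁻¹ ^ r * M)
        Filter.atTop (nhds (X + 0 * M)) :=
      (ENNReal.Tendsto.mul_const (ENNReal.tendsto_pow_atTop_nhds_zero_of_lt_one hq)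
        (Or.inr hMfin)).const_add X
    rw [zero_mul, add_zero] at hlim
    exact ge_of_tendsto' hlim hbound

include hμ hπ hε in
theorem aemeasurable_enorm_comp_zpow_mul_sq (F : Lp ℂ 2 μ) (j : ℤ) :
    AEMeasurable (fun x => ‖F (π ^ j * x)‖ₑ ^ 2) μ :=
  ((Lp.aestronglyMeasurable F).enorm.comp_quasiMeasurePreserving
    (quasiMeasurePreserving_zpow_mul hμ hπ hε j)).pow_const 2

theorem pairwise_disjoint_preimage_zpow_mul (hπ : IsPrimeElement π) {E : Set K} {t : ℤ}
    (hE : E ⊆ {x : K | ‖x‖ = ‖π‖ ^ t}) :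
    Pairwise (Function.onFun Disjoint fun j : ℤ => (fun x => π ^ (-j) * x) ⁻¹' E) := by
  have hnorm : ∀ (j : ℤ) (x : K), π ^ (-j) * x ∈ E → ‖x‖ = ‖π‖ ^ (t + j) := by
    intro j x hx
    have h1 : ‖π ^ (-j) * x‖ = ‖π‖ ^ t := hE hx
    have h0 := hπ.norm_pos.ne'
    rw [zpow_add₀ h0, ← h1, norm_mul, norm_zpow, mul_right_comm, ← zpow_add₀ h0, neg_add_cancel,
      zpow_zero, one_mul]
  intro i j hij
  refine Set.disjoint_left.2 fun x hi hj => hij ?_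
  have h1 := (hnorm i x hi).symm.trans (hnorm j x hj)
  have := zpow_right_injective₀ hπ.norm_pos hπ.norm_lt_one.ne h1
  linarith

-- Shells have finite measure, and dilates of any subset of a shell are disjoint, so the integrated
-- identity applies to every measurable subset and gives the pointwise one.
include hμ hπ hε hχ hψ in
theorem ae_tsum_eq_one_of_norm_eq (t : ℤ) :
    ∀ᵐ x ∂μ.restrict {x : K | ‖x‖ = ‖π‖ ^ t},
      ∑' (j : ℤ) (l : Fin L), ‖fourier χ (ψ l) (π ^ j * x)‖ₑ ^ 2 = 1 := by
  have hS : MeasurableSet {x : K | ‖x‖ = ‖π‖ ^ t} :=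
    measurableSet_eq_fun measurable_norm measurable_const
  have hSfin : μ {x : K | ‖x‖ = ‖π‖ ^ t} ≠ ⊤ := by
    refine ((measure_mono (t := closedBall 0 (‖π‖ ^ t)) fun x hx => ?_).trans_lt
      measure_closedBall_lt_top).ne
    rw [mem_closedBall, dist_zero_right]
    exact le_of_eq hx
  have hm : ∀ (j : ℤ) (l : Fin L), AEMeasurable (fun x => ‖fourier χ (ψ l) (π ^ j * x)‖ₑ ^ 2) μ := fun j l =>
    aemeasurable_enorm_comp_zpow_mul_sq hμ hπ hε _ j
  have hm' : AEMeasurable (fun x => ∑' (j : ℤ) (l : Fin L),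
      ‖fourier χ (ψ l) (π ^ j * x)‖ₑ ^ 2) μ :=
    AEMeasurable.tsum fun j => AEMeasurable.tsum fun l => hm j l
  refine ae_eq_of_forall_setLIntegral_eq_of_sigmaFinite₀ (g := fun _ => 1) hm'.restrict
    aemeasurable_const fun s hs _ => ?_
  rw [Measure.restrict_restrict hs, setLIntegral_one]
  have hE := hs.inter hS
  rw [lintegral_tsum fun j => (AEMeasurable.tsum fun l => hm j l).restrict]
  have h1 : ∀ j : ℤ, ∫⁻ x in s ∩ {x : K | ‖x‖ = ‖π‖ ^ t}, ∑' l : Fin L,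
      ‖fourier χ (ψ l) (π ^ j * x)‖ₑ ^ 2 ∂μ = ∑' l : Fin L, ((p ^ c : ℕ) : ℝ≥0∞) ^ j *
        dilatedMass π (fourier χ (ψ l)) j (s ∩ {x : K | ‖x‖ = ‖π‖ ^ t}) := by
    intro j
    rw [lintegral_tsum fun l => (hm j l).restrict]
    exact tsum_congr fun l => setLIntegral_comp_zpow_mul hμ hπ hε _ _ hE
  rw [tsum_congr h1]
  refine tsum_dilatedMass_eq_measure hμ hπ hε hχ hψ hE
    ((measure_mono Set.inter_subset_right).trans_lt hSfin.lt_top).ne (pairwise_disjoint_preimage_zpow_mul hπ Set.inter_subset_right)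

include hμ hπ hε hχ hψ in
/-- The Calderón identity `∑_l ∑_{j ∈ ℤ} |ψ̂_l(π ^ j x)|² = 1`. -/
theorem ae_tsum_enorm_fourier_zpow_mul_sq :
    ∀ᵐ x ∂μ, ∑' (j : ℤ) (l : Fin L), ‖fourier χ (ψ l) (π ^ j * x)‖ₑ ^ 2 = 1 := by
  have h := (ae_restrict_iUnion_iff (μ := μ) (fun t : ℤ => {x : K | ‖x‖ = ‖π‖ ^ t}) _).2
    fun t => ae_tsum_eq_one_of_norm_eq hμ hπ hε hχ hψ t
  -- The shells omit only the origin, a null set.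
  have hu : ⋃ t : ℤ, {x : K | ‖x‖ = ‖π‖ ^ t} = {0}ᶜ := by
    ext x
    simp only [Set.mem_iUnion, Set.mem_ofPred_eq, Set.mem_compl_iff, Set.mem_singleton_iff]
    constructor
    · rintro ⟨t, ht⟩ rfl
      rw [norm_zero] at ht
      exact (zpow_pos hπ.norm_pos t).ne ht
    · exact fun hx => hπ.exists_norm_eq_zpow hx
  rw [hu, ae_restrict_iff' (measurableSet_singleton 0).compl] at h
  filter_upwards [h, compl_mem_ae_iff.2 (measure_singleton (0 : K))] with x h1 h2 using h1 h2

end Calderon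

/-! ### The space of negative dilates and its diagonal projection entries. -/

section Multiplicity

variable {K : Type*} [NontriviallyNormedField K]

attribute [local instance] properSpace_of_locallyCompact

variable [IsUltrametricDist K] {p c : ℕ} [Fact p.Prime] [CharP K p] [NeZero c] {π : K}
  {ε : Fin c → K} {χ : AddChar K Circle}
  [LocallyCompactSpace K] [MeasurableSpace K] [BorelSpace K] {μ : Measure K}
  [μ.IsAddHaarMeasure]

variable (hμ : μ (closedBall 0 1) = 1) (hπ : IsPrimeElement π)
    (hε : IsResidueBasis p c ε) (hχ : IsBasicCharacter π ε χ)
    {L : ℕ} {ψ : Fin L → Lp ℂ 2 μ} (hψ : IsOrthonormalMultiwavelet p hπ ε ψ)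

/-- The functions whose translates by the `u(k)` are the affine system at the scales `j ≥ 0`. -/
def generators (p : ℕ) {c : ℕ} {K : Type*} [NontriviallyNormedField K]
    [LocallyCompactSpace K] [MeasurableSpace K] [BorelSpace K] {μ : Measure K}
    [μ.IsAddHaarMeasure] {π : K} (hπ : IsPrimeElement π) (ε : Fin c → K)
    {L : ℕ} (ψ : Fin L → Lp ℂ 2 μ) (i : Σ j : ℕ, Fin L × Fin ((p ^ c) ^ j)) : Lp ℂ 2 μ :=
  affine p hπ ε (ψ i.2.1) i.1 i.2.2

include hμ hε in
theorem translate_generators (i : Σ j : ℕ, Fin L × Fin ((p ^ c) ^ j)) (k : ℕ) :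
    translate (u p π ε k) (generators p hπ ε ψ i)
      = affine p hπ ε (ψ i.2.1) i.1 (k * (p ^ c) ^ i.1 + i.2.2) :=
  translate_affine hμ hπ hε _ _ _ i.2.2.2

-- The translated generator is the member of the wavelet system with index $kq^j+d$, so this is
-- orthonormality of $\Psi$ together with uniqueness of division by $q^j$.
include hμ hε hψ in
theorem inner_translate_generators (i i' : Σ j : ℕ, Fin L × Fin ((p ^ c) ^ j)) (k : ℕ) :
    inner ℂ (translate (u p π ε k) (generators p hπ ε ψ i)) (generators p hπ ε ψ i')
      = if k = 0 then if i = i' then 1 else 0 else 0 := by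
  rw [translate_generators hμ hπ hε, generators]
  obtain ⟨j, l, d⟩ := i
  obtain ⟨j', l', d'⟩ := i'
  have h := orthonormal_iff_ite.1 hψ.orthonormal (l, (j : ℤ), k * (p ^ c) ^ j + d)
    (l', (j' : ℤ), (d' : ℕ))
  dsimp only at h ⊢
  rw [h, ← ite_and]
  refine if_congr ?_ rfl rfl
  constructor
  · intro h1
    simp only [Prod.mk.injEq, Nat.cast_inj] at h1
    obtain ⟨rfl, rfl, h2⟩ := h1
    have hk : k = 0 := by
      by_contra hk
      have h3 : (p ^ c) ^ j ≤ k * (p ^ c) ^ j := Nat.le_mul_of_pos_left _ (Nat.pos_of_ne_zero hk)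
      have := d'.2
      omega
    subst hk
    refine ⟨rfl, ?_⟩
    have : d = d' := Fin.ext (by simpa using h2)
    rw [this]
  · rintro ⟨rfl, h1⟩
    cases h1
    simp

-- In the full wavelet basis, the coefficients at the scales $j\ge0$ are exactly those that must
-- vanish.
include hψ in
theorem mem_negativeDilates_iff (f : Lp ℂ 2 μ) :
    f ∈ negativeDilates p hπ ε ψ ↔
      ∀ (l : Fin L) (j n : ℕ), inner ℂ (affine p hπ ε (ψ l) j n) f = 0 := by
  constructor
  · intro hf l j n
    have hc : IsClosed {f : Lp ℂ 2 μ | inner ℂ (affine p hπ ε (ψ l) j n) f = 0} :=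
      isClosed_eq (by fun_prop) continuous_const
    refine closure_minimal (s := (Submodule.span ℂ {g | ∃ (l : Fin L) (j : ℤ) (k : ℕ), j < 0 ∧
      g = affine p hπ ε (ψ l) j k} : Set (Lp ℂ 2 μ))) ?_ hc hf
    intro g hg
    change inner ℂ (affine p hπ ε (ψ l) j n) g = 0
    induction hg using Submodule.span_induction with
    | mem x hx =>
      obtain ⟨l', j', k', hj', rfl⟩ := hx
      refine hψ.orthonormal.2 (i := (l, (j : ℤ), n)) (j := (l', j', k')) fun h => ?_
      simp only [Prod.mk.injEq] at h
      omega
    | zero => simp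
    | add x y _ _ hx hy => rw [inner_add_right, hx, hy, add_zero]
    | smul a x _ hx => rw [inner_smul_right, hx, mul_zero]
  · intro h
    have hs := (waveletBasis hπ hψ).hasSum_repr f
    refine (Submodule.isClosed_topologicalClosure _).mem_of_tendsto hs
      (Filter.Eventually.of_forall fun s => ?_)
    refine Submodule.sum_mem _ fun i _ => ?_
    obtain ⟨l, j, k⟩ := i
    rw [HilbertBasis.repr_apply_apply, waveletBasis_apply]
    rcases lt_or_ge j 0 with hj | hj
    · exact Submodule.smul_mem _ _ (Submodule.le_topologicalClosure _
        (Submodule.subset_span ⟨l, j, k, hj, rfl⟩))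
    · obtain ⟨n, rfl⟩ := Int.eq_ofNat_of_zero_le hj
      dsimp only
      rw [h l n k, zero_smul]
      exact Submodule.zero_mem _

-- Every index at scale $j$ is $kq^j+d$ with $d<q^j$, so translates of the generators exhaust the
-- nonnegative scales.
include hμ hε hψ in
theorem mem_negativeDilates_iff_generators (f : Lp ℂ 2 μ) :
    f ∈ negativeDilates p hπ ε ψ ↔
      ∀ i k, inner ℂ (translate (u p π ε k) (generators p hπ ε ψ i)) f = 0 := by
  rw [mem_negativeDilates_iff hπ hψ]
  simp_rw [translate_generators hμ hπ hε]
  constructor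
  · exact fun h i k => h _ _ _
  · intro h l j n
    have hq : 0 < (p ^ c) ^ j := pow_pos (residueCard_pos p c) j
    have := h ⟨j, l, ⟨n % (p ^ c) ^ j, Nat.mod_lt _ hq⟩⟩ (n / (p ^ c) ^ j)
    dsimp only at this
    rwa [Nat.div_add_mod'] at this

-- The $u(k)$ form a group, so the system of translated generators is invariant, and with it its
-- orthogonal complement.
include hμ hε hψ in
theorem isTranslationInvariant_negativeDilates :
    IsTranslationInvariant p π ε (negativeDilates p hπ ε ψ) where
  isClosed := Submodule.isClosed_topologicalClosure _
  translate_mem f hf k := by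
    rw [mem_negativeDilates_iff_generators hμ hπ hε hψ] at hf ⊢
    intro i n
    obtain ⟨t, ht⟩ := hε.exists_u_sub (π := π) n k
    have h1 : translate (u p π ε n) (generators p hπ ε ψ i)
        = translate (u p π ε k) (translate (u p π ε t) (generators p hπ ε ψ i)) := by
      rw [translate_translate, ← ht, add_sub_cancel]
    rw [h1]
    exact ((translateₗᵢ μ (u p π ε k)).inner_map_map _ _).trans (hf i t)

-- For each $l$ there are $q^j$ generators at scale $j$; they differ only by unimodular factors on
-- the Fourier side, and the normalization $q^{-j}$ cancels their number.
include hμ hπ hε hχ in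
theorem ae_tsum_enorm_fourier_generators_sq :
    ∀ᵐ x ∂μ, ∑' i, ‖fourier χ (generators p hπ ε ψ i) x‖ₑ ^ 2
      = ∑' (j : ℕ) (l : Fin L), ‖fourier χ (ψ l) (π ^ (j : ℤ) * x)‖ₑ ^ 2 := by
  filter_upwards [ae_all_iff.2 fun i : Σ j : ℕ, Fin L × Fin ((p ^ c) ^ j) =>
    coeFn_fourier_affine hμ hπ hε hχ (ψ i.2.1) i.1 i.2.2] with x hx
  rw [ENNReal.tsum_sigma']
  refine tsum_congr fun j => ?_
  have h1 : ∀ i : Fin L × Fin ((p ^ c) ^ j), ‖fourier χ (generators p hπ ε ψ ⟨j, i⟩) x‖ₑ ^ 2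
      = ((p ^ c : ℕ) : ℝ≥0∞) ^ (-(j : ℤ)) * ‖fourier χ (ψ i.1) (π ^ (j : ℤ) * x)‖ₑ ^ 2 := by
    intro i
    have h2 : ∀ z : Circle, ‖(z : ℂ)‖ₑ = 1 := fun z => by
      rw [← ofReal_norm, Circle.norm_coe, ENNReal.ofReal_one]
    rw [generators, hx ⟨j, i⟩, enorm_mul, enorm_mul, h2, one_mul, mul_pow,
      ofReal_rpow_half_sq _ (residueCard_pos p c)]
  rw [tsum_congr h1, ENNReal.tsum_prod (f := fun (l : Fin L) (_ : Fin ((p ^ c) ^ j)) =>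
    ((p ^ c : ℕ) : ℝ≥0∞) ^ (-(j : ℤ)) * ‖fourier χ (ψ l) (π ^ (j : ℤ) * x)‖ₑ ^ 2)]
  refine tsum_congr fun l => ?_
  rw [tsum_fintype, Finset.sum_const, Finset.card_univ, Fintype.card_fin, nsmul_eq_mul,
    ← mul_assoc, Nat.cast_pow, ENNReal.zpow_neg, zpow_natCast, ENNReal.mul_inv_cancel, one_mul]
  · exact pow_ne_zero _ (residueCard_ne_zero p c)
  · exact ENNReal.pow_ne_top (ENNReal.natCast_ne_top _)

/-- The energy `∑_{j ≥ 1} ∑_l |ψ̂_l(π⁻ʲ x)|²` at the negative scales. -/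
def negativeEnergy (π : K) (χ : AddChar K Circle) (ψ : Fin L → Lp ℂ 2 μ) (x : K) : ℝ≥0∞ :=
  ∑' (j : ℕ) (l : Fin L), ‖fourier χ (ψ l) (π ^ (-((j : ℤ) + 1)) * x)‖ₑ ^ 2

theorem tsum_negativeEnergy_eq (ξ : K) :
    ∑' k, negativeEnergy π χ ψ (ξ + u p π ε k) = dimensionFunction p π ε χ ψ ξ := by
  have hz : ∀ (j : ℕ) (x : K), π ^ (-((j : ℤ) + 1)) * x = π⁻¹ ^ (j + 1) * x := fun j x => by
    rw [zpow_neg, inv_pow]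
    norm_cast
  have hs : ∀ f : Fin L → ℝ≥0∞, ∑ l, f l = ∑' l, f l := fun f => (tsum_fintype f).symm
  rw [dimensionFunction, hs]
  simp_rw [negativeEnergy, hz]
  rw [ENNReal.tsum_comm]
  refine (tsum_congr fun j => ENNReal.tsum_comm).trans ENNReal.tsum_comm

include hμ hπ hε in
theorem aemeasurable_negativeEnergy : AEMeasurable (negativeEnergy π χ ψ) μ :=
  AEMeasurable.tsum fun _ => AEMeasurable.tsum fun _ =>
    aemeasurable_enorm_comp_zpow_mul_sq hμ hπ hε _ _

-- Scale $-(j+1)$ contributes $q^{-(j+1)}\sum_l\|\hat\psi_l\|^2$. Convergence of this series is the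
-- source of the a.e. finiteness of the multiplicity.
include hμ hπ hε in
theorem lintegral_negativeEnergy_ne_top : ∫⁻ x, negativeEnergy π χ ψ x ∂μ ≠ ⊤ := by
  have hm : ∀ (j : ℤ) (l : Fin L), AEMeasurable (fun x => ‖fourier χ (ψ l) (π ^ j * x)‖ₑ ^ 2) μ :=
    fun j l => aemeasurable_enorm_comp_zpow_mul_sq hμ hπ hε _ j
  have h1 : ∀ j : ℕ, ∫⁻ x, ∑' l : Fin L, ‖fourier χ (ψ l) (π ^ (-((j : ℤ) + 1)) * x)‖ₑ ^ 2 ∂μ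
      = (((p ^ c : ℕ) : ℝ≥0∞))⁻¹ ^ (j + 1) * ∑' l : Fin L, ‖fourier χ (ψ l)‖ₑ ^ 2 := by
    intro j
    rw [lintegral_tsum fun l => hm _ l, ← ENNReal.tsum_mul_left]
    refine tsum_congr fun l => ?_
    rw [lintegral_comp_zpow_mul hμ hπ hε _ (fun y => ‖fourier χ (ψ l) y‖ₑ ^ 2),
      ← enorm_sq_eq_lintegral, ENNReal.zpow_neg, ← Nat.cast_succ, zpow_natCast,
      ENNReal.inv_pow]
  simp_rw [negativeEnergy]
  rw [lintegral_tsum fun j => AEMeasurable.tsum fun l => hm _ l, tsum_congr h1,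
    ENNReal.tsum_mul_right]
  refine ENNReal.mul_ne_top ?_ ?_
  · simp_rw [pow_succ]
    have h2 : (1 : ℝ≥0∞) < ((p ^ c : ℕ) : ℝ≥0∞) := by exact_mod_cast one_lt_residueCard p c
    rw [ENNReal.tsum_mul_right, ENNReal.tsum_geometric]
    refine ENNReal.mul_ne_top (ENNReal.inv_ne_top.2 ?_) (ENNReal.inv_ne_top.2 ?_)
    · exact (tsub_pos_of_lt (ENNReal.inv_lt_one.2 h2)).ne'
    · exact residueCard_ne_zero p c
  · rw [tsum_fintype]
    exact ENNReal.sum_ne_top.2 fun l _ => ENNReal.pow_ne_top enorm_ne_top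

include hμ hπ hε hχ hψ in
/-- The diagonal entries of the projections onto the fibers of the space of negative dilates. -/
theorem ae_enorm_starProjection_single_sq :
    ∀ᵐ ξ ∂μ.restrict (closedBall 0 1), ∀ m,
      ‖(orthogonalFibers p π ε χ (generators p hπ ε ψ) ξ).toSubmodule.starProjection
          (lp.single 2 m (1 : ℂ))‖ₑ ^ 2 = negativeEnergy π χ ψ (ξ + u p π ε m) := by
  filter_upwards [
    ae_tsum_add_enorm_orthogonalFibers hμ hπ hε hχ (inner_translate_generators hμ hπ hε hψ),
    (ae_iff_ae_add_u hπ hε _).1 (ae_tsum_enorm_fourier_generators_sq hμ hπ hε hχ (ψ := ψ)),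
    (ae_iff_ae_add_u hπ hε _).1 (ae_tsum_enorm_fourier_zpow_mul_sq hμ hπ hε hχ hψ)]
    with ξ h1 h2 h3 m
  have h4 := h1 m
  have h5 := h3 m
  rw [h2 m] at h4
  -- Split the Calderón sum into $j\ge0$, the energy of the generators, and $j=-(n+1)$, the negative
  -- energy. Cancellation in `ℝ≥0∞` is legitimate because the first part is finite.
  rw [(HasSum.of_nat_of_neg_add_one
    (f := fun j : ℤ => ∑' l : Fin L, ‖fourier χ (ψ l) (π ^ j * (ξ + u p π ε m))‖ₑ ^ 2)
    ENNReal.summable.hasSum ENNReal.summable.hasSum).tsum_eq, ← h4] at h5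
  refine ((ENNReal.add_right_inj ?_).1 h5).symm
  intro htop
  rw [htop, top_add] at h4
  exact ENNReal.top_ne_one h4

include hμ hπ hε hχ hψ in
theorem isRangeFunction_negativeDilates :
    IsRangeFunction p π ε χ (negativeDilates p hπ ε ψ)
      (orthogonalFibers p π ε χ (generators p hπ ε ψ)) :=
  isRangeFunction_orthogonalFibers hμ hπ hε hχ (inner_translate_generators hμ hπ hε hψ)
    (mem_negativeDilates_iff_generators hμ hπ hε hψ)

end Multiplicity

end LocalFieldWavelet

end

/-! ### The multiplicity function equals the dimension function. -/

theorem corollary3p3p7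
    {K : Type*} [NontriviallyNormedField K] [IsUltrametricDist K] [LocallyCompactSpace K]
    [MeasurableSpace K] [BorelSpace K]
    {p c : ℕ} [Fact p.Prime] [CharP K p] [NeZero c]
    (μ : MeasureTheory.Measure K) [μ.IsAddHaarMeasure] (hμ : μ (Metric.closedBall 0 1) = 1)
    (π : K) (hπ : LocalFieldWavelet.IsPrimeElement π)
    (ε : Fin c → K) (hε : LocalFieldWavelet.IsResidueBasis p c ε)
    (χ : AddChar K Circle) (hχ : LocalFieldWavelet.IsBasicCharacter π ε χ)
    {L : ℕ} (ψ : Fin L → MeasureTheory.Lp ℂ 2 μ)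
    (hψ : LocalFieldWavelet.IsOrthonormalMultiwavelet p hπ ε ψ) :
    (∃ m : K → ℕ∞, LocalFieldWavelet.IsMultiplicityFunction p π ε χ
      (LocalFieldWavelet.negativeDilates p hπ ε ψ) m) ∧
    ∀ m : K → ℕ∞, LocalFieldWavelet.IsMultiplicityFunction p π ε χ
      (LocalFieldWavelet.negativeDilates p hπ ε ψ) m →
      ∀ᵐ ξ ∂(μ.restrict (Metric.closedBall 0 1)),
        m ξ ≠ ⊤ ∧ (m ξ : ℝ≥0∞) = LocalFieldWavelet.dimensionFunction p π ε χ ψ ξ := by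
  have hJ := LocalFieldWavelet.isRangeFunction_negativeDilates hμ hπ hε hχ hψ
  refine ⟨⟨_, LocalFieldWavelet.isTranslationInvariant_negativeDilates hμ hπ hε hψ, _, hJ,
    Filter.Eventually.of_forall fun ξ => rfl⟩, ?_⟩
  rintro m ⟨-, J', hJ', hm⟩
  -- Uniqueness replaces the given range function by the explicit one; its dimension is the trace of
  -- the projection, that is, the sum of the negative energy along the fiber.
  filter_upwards [hm, hJ'.ae_eq hμ hπ hε hχ hJ,
    LocalFieldWavelet.ae_enorm_starProjection_single_sq hμ hπ hε hχ hψ,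
    LocalFieldWavelet.ae_tsum_ne_top hπ hε
      (LocalFieldWavelet.aemeasurable_negativeEnergy (χ := χ) (ψ := ψ) hμ hπ hε)
      (LocalFieldWavelet.lintegral_negativeEnergy_ne_top hμ hπ hε)] with ξ h1 h2 h3 h4
  have : CompleteSpace (LocalFieldWavelet.orthogonalFibers p π ε χ
      (LocalFieldWavelet.generators p hπ ε ψ) ξ).toSubmodule :=
    (LocalFieldWavelet.orthogonalFibers p π ε χ
      (LocalFieldWavelet.generators p hπ ε ψ) ξ).isClosed'.completeSpace_coe
  have h5 := LocalFieldWavelet.tsum_enorm_starProjection_single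
    (LocalFieldWavelet.orthogonalFibers p π ε χ
      (LocalFieldWavelet.generators p hπ ε ψ) ξ).toSubmodule
  rw [tsum_congr h3] at h5
  rw [h5] at h4
  rw [h1, h2]
  refine ⟨fun h => h4 (by rw [h]; rfl), ?_⟩
  rw [← h5, LocalFieldWavelet.tsum_negativeEnergy_eq]
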